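/- Let $\mathbb{K}$ be a field of characteristic zero with a topology (for instance $\mathbb{R}$ or $\mathbb{C}$, or an algebraically closed field with the Zariski topology), let $(X,\mathcal{O}_X)$ be a topological ringed space, i.e. a topological space with a sheaf $\mathcal{O}_X$ of $\mathbb{K}$-subalgebras of the sheaf of continuous $\mathbb{K}$-valued functions, let $(\mathcal{L},[\cdot,\cdot]_{\mathcal{L}},\mathfrak{a})$ be a Lie algebroid over $(X,\mathcal{O}_X)$ whose underlying $\mathcal{O}_X$-module is locally free of finite rank, and let $\mathcal{L}'$ be a locally free $\mathcal{O}_X$-module of finite rank with dual $\mathcal{L}'^*=\mathscr{H}om_{\mathcal{O}_X}(\mathcal{L}',\mathcal{O}_X)$. Here $\wedge^\bullet\mathcal{E}$ is the sheafification of $U\mapsto\wedge^\bullet_{\mathcal{O}_X(U)}\mathcal{E}(U)$. Definitions. * For a Lie algebroid $\mathcal{F}$, the Schouten bracket $[\cdot,\cdot]^{\mathcal{F}}$ is the Gerstenhaber bracket on $\wedge^\bullet\mathcal{F}$ that extends the Lie bracket and satisfies $[D,f]^{\mathcal{F}}=\mathfrak{a}_{\mathcal{F}}(D)(f)$; write $\mathcal{G}_{\mathcal{F}}=(\wedge^\bullet\mathcal{F},\wedge,[\cdot,\cdot]^{\mathcal{F}})$.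 If $\mathcal{F}$ is locally free of finite rank, $\Omega^\bullet_{\mathcal{F}}=(\wedge^\bullet\mathcal{F}^*,d_{\mathcal{F}})$, where $d_{\mathcal{F}}$ is given by the Chevalley–Eilenberg formula $$d_{\mathcal{F}}\omega(D_1,\dots,D_{k+1})=\sum_{i}(-1)^{i+1}\mathfrak{a}_{\mathcal{F}}(D_i)\bigl(\omega(\dots,\hat{D_i},\dots)\bigr)+\sum_{i<j}(-1)^{i+j}\omega([D_i,D_j],\dots,\hat{D_i},\dots,\hat{D_j},\dots).$$ * An $\mathcal{L}$-Lie bialgebroid structure on $(\mathcal{L}',\mathcal{L}'^*)$ consists of Lie algebroid structures on $\mathcal{L}'$ and on $\mathcal{L}'^*$ and Lie algebroid morphisms $\phi:\mathcal{L}'\to\mathcal{L}$ and $\phi':\mathcal{L}'^*\to\mathcal{L}$ such that, with $d'_*$ the differential on $\wedge^\bullet\mathcal{L}'\cong\wedge^\bullet(\mathcal{L}'^*)^*$ defined by the Lie algebroid $\mathcal{L}'^*$, $d'_*[D_1,D_2]=[d'_*D_1,D_2]^{\mathcal{L}'}+[D_1,d'_*D_2]^{\mathcal{L}'}$ for all local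 sections $D_1,D_2$ of $\mathcal{L}'$. * A strong differential $\mathcal{G}_{\mathcal{L}}$-Gerstenhaber algebra structure on $\wedge^\bullet\mathcal{L}'$ consists of a Gerstenhaber bracket $[\cdot,\cdot]$ on $(\wedge^\bullet\mathcal{L}',\wedge)$, a morphism of Gerstenhaber algebras $\bar\phi:\wedge^\bullet\mathcal{L}'\to\mathcal{G}_{\mathcal{L}}$, a $\mathbb{K}$-linear operator $\tilde d$ of degree $1$ on $\wedge^\bullet\mathcal{L}'$ with $\tilde d^2=0$ that is a graded derivation of $\wedge$ and of $[\cdot,\cdot]$, and a morphism of differential graded ($\mathcal{O}_X$-)algebras $\psi:\Omega^\bullet_{\mathcal{L}}\to(\wedge^\bullet\mathcal{L}',\tilde d)$. * Two such structures correspond to each other if $[\cdot,\cdot]=[\cdot,\cdot]^{\mathcal{L}'}$, $\tilde d=d'_*$, $\bar\phi|_{\mathcal{L}'}=\phi$, and $\psi|_{\mathcal{L}^*}:\mathcal{L}^*\to\mathcal{L}'$ is the transpose of $\phi':\mathcal{L}'^*\to\mathcal{L}$. Theorem. (0) The Schouten brackets and differentials used above exist and are unique: on $\wedge^\bullet\mathcal{L}$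 and $\wedge^\bullet\mathcal{L}^*$ for $\mathcal{L}$, and on $\wedge^\bullet\mathcal{L}'$ for every Lie algebroid structure on $\mathcal{L}'$, respectively on $\mathcal{L}'^*$. (1) The pair $(\mathcal{L}',\mathcal{L}'^*)$ admits an $\mathcal{L}$-Lie bialgebroid structure if and only if $\wedge^\bullet\mathcal{L}'$ admits a strong differential $\mathcal{G}_{\mathcal{L}}$-Gerstenhaber algebra structure. (2) Every strong differential $\mathcal{G}_{\mathcal{L}}$-Gerstenhaber algebra structure on $\wedge^\bullet\mathcal{L}'$ corresponds to exactly one $\mathcal{L}$-Lie bialgebroid structure on $(\mathcal{L}',\mathcal{L}'^*)$. (3) If the rank of $\mathcal{L}'$ is equal to $1$ at no point of $X$, then every $\mathcal{L}$-Lie bialgebroid structure on $(\mathcal{L}',\mathcal{L}'^*)$ corresponds to exactly one strong differential $\mathcal{G}_{\mathcal{L}}$-Gerstenhaber algebra structure on $\wedge^\bullet\mathcal{L}'$. -/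

import Mathlib

universe u v w w'

noncomputable section

open TopologicalSpace

namespace LBialg

/-! ## Topological ringed spaces -/

/-- A topological ringed space `(X, 𝒪)` over `K`: a sheaf `𝒪` of `K`-subalgebras of the sheaf of
continuous `K`-valued functions on `X`. -/
structure TopRingedSpace (K : Type u) (X : Type v) [Field K] [TopologicalSpace K]
    [TopologicalSpace X] where
  sections : ∀ U : Opens X, Subalgebra K (U → K)
  continuous_of_mem : ∀ (U : Opens X) (f : U → K), f ∈ sections U → Continuous f
  restrict_mem : ∀ {U V : Opens X} (h : V ≤ U) (f : U → K), f ∈ sections U →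
    (fun y : V => f ⟨y.1, h y.2⟩) ∈ sections V
  local_mem : ∀ (U : Opens X) (f : U → K),
    (∀ x : U, ∃ V : Opens X, x.1 ∈ V ∧ ∃ h : V ≤ U,
      (fun y : V => f ⟨y.1, h y.2⟩) ∈ sections V) → f ∈ sections U

variable {K : Type u} {X : Type v} [Field K] [TopologicalSpace K] [TopologicalSpace X]

/-- The `K`-algebra `𝒪(U)`. -/
def TopRingedSpace.Sec (𝒪 : TopRingedSpace K X) (U : Opens X) : Type (max u v) :=
  ↥(𝒪.sections U)

instance (𝒪 : TopRingedSpace K X) (U : Opens X) : CommRing (𝒪.Sec U) :=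
  inferInstanceAs (CommRing ↥(𝒪.sections U))

instance (𝒪 : TopRingedSpace K X) (U : Opens X) : Algebra K (𝒪.Sec U) :=
  inferInstanceAs (Algebra K ↥(𝒪.sections U))

/-- Restriction of functions. -/
def TopRingedSpace.res (𝒪 : TopRingedSpace K X) {U V : Opens X} (h : V ≤ U) :
    𝒪.Sec U →+* 𝒪.Sec V where
  toFun f := ⟨fun y => f.1 ⟨y.1, h y.2⟩, 𝒪.restrict_mem h f.1 f.2⟩
  map_one' := rfl
  map_mul' _ _ := rfl
  map_zero' := rfl
  map_add' _ _ := rfl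

@[simp] theorem TopRingedSpace.res_apply (𝒪 : TopRingedSpace K X) {U V : Opens X} (h : V ≤ U)
    (f : 𝒪.Sec U) (y : V) : (𝒪.res h f).1 y = f.1 ⟨y.1, h y.2⟩ := rfl

/-! ## Sheaves of `𝒪`-modules -/

/-- A sheaf of `𝒪`-modules: a presheaf of modules satisfying the two sheaf axioms (separation and
gluing) for every family `𝒰` of open sets. -/
structure ModSheaf (𝒪 : TopRingedSpace K X) where
  Sec : Opens X → Type w
  [addCommGroup : ∀ U, AddCommGroup (Sec U)]
  [module : ∀ U, Module (𝒪.Sec U) (Sec U)]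
  res : ∀ {U V : Opens X} (h : V ≤ U), Sec U →ₛₗ[𝒪.res h] Sec V
  res_id : ∀ (U : Opens X) (s : Sec U), res le_rfl s = s
  res_res : ∀ {U V W : Opens X} (h : V ≤ U) (h' : W ≤ V) (s : Sec U),
    res h' (res h s) = res (h'.trans h) s
  separated : ∀ (𝒰 : Set (Opens X)) (s t : Sec (sSup 𝒰)),
    (∀ V : 𝒰, res (le_sSup V.2) s = res (le_sSup V.2) t) → s = t
  glue : ∀ (𝒰 : Set (Opens X)) (s : ∀ V : 𝒰, Sec V.1),
    (∀ V W : 𝒰, res (inf_le_left : V.1 ⊓ W.1 ≤ V.1) (s V) =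
      res (inf_le_right : V.1 ⊓ W.1 ≤ W.1) (s W)) →
    ∃ t : Sec (sSup 𝒰), ∀ V : 𝒰, res (le_sSup V.2) t = s V

attribute [instance] ModSheaf.addCommGroup ModSheaf.module

variable {𝒪 : TopRingedSpace K X}

/-- `E` is free of rank `n` on `U`: there are sections `e₁, …, eₙ` over `U` which define an
isomorphism `(𝒪|U)ⁿ ≅ E|U`. -/
def ModSheaf.IsFreeOn (E : ModSheaf.{u, v, w} 𝒪) (U : Opens X) (n : ℕ) : Prop :=
  ∃ e : Fin n → E.Sec U, ∀ (V : Opens X) (h : V ≤ U),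
    Function.Bijective (fun c : Fin n → 𝒪.Sec V => ∑ i, c i • E.res h (e i))

/-- `E` is locally free of finite rank. -/
def ModSheaf.IsLocallyFree (E : ModSheaf.{u, v, w} 𝒪) : Prop :=
  ∀ x : X, ∃ (U : Opens X) (n : ℕ), x ∈ U ∧ E.IsFreeOn U n

/-- The rank of `E` is equal to one at no point: `E` is free of rank one on no nonempty open
set. -/
def ModSheaf.NowhereRankOne (E : ModSheaf.{u, v, w} 𝒪) : Prop :=
  ∀ U : Opens X, (U : Set X).Nonempty → ¬ E.IsFreeOn U 1

/-! ## The dual sheaf -/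

/-- Sections over `U` of `ℋom(E, 𝒪)`: morphisms of sheaves of modules `E|U → 𝒪|U`. -/
@[ext] structure DualSec (E : ModSheaf.{u, v, w} 𝒪) (U : Opens X) where
  app : ∀ V : Opens X, V ≤ U → (E.Sec V →ₗ[𝒪.Sec V] 𝒪.Sec V)
  natural : ∀ (V W : Opens X) (hV : V ≤ U) (hW : W ≤ V) (s : E.Sec V),
    𝒪.res hW (app V hV s) = app W (hW.trans hV) (E.res hW s)

namespace DualSec

variable {E : ModSheaf.{u, v, w} 𝒪} {U : Opens X}

instance : Zero (DualSec E U) := ⟨⟨fun _ _ => 0, by intros; simp⟩⟩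
instance : Add (DualSec E U) :=
  ⟨fun a b => ⟨fun V h => a.app V h + b.app V h, by intros; simp [a.natural, b.natural]⟩⟩
instance : Neg (DualSec E U) :=
  ⟨fun a => ⟨fun V h => - a.app V h, by intros; simp [a.natural]⟩⟩
instance : SMul (𝒪.Sec U) (DualSec E U) :=
  ⟨fun f a => ⟨fun V h => 𝒪.res h f • a.app V h, by
    intro V W hV hW s
    simp only [LinearMap.smul_apply, smul_eq_mul, map_mul, a.natural]
    rfl⟩⟩

@[simp] theorem zero_app (V : Opens X) (h : V ≤ U) : (0 : DualSec E U).app V h = 0 := rfl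
@[simp] theorem add_app (a b : DualSec E U) (V : Opens X) (h : V ≤ U) :
    (a + b).app V h = a.app V h + b.app V h := rfl
@[simp] theorem neg_app (a : DualSec E U) (V : Opens X) (h : V ≤ U) :
    (-a).app V h = -a.app V h := rfl
@[simp] theorem smul_app (f : 𝒪.Sec U) (a : DualSec E U) (V : Opens X) (h : V ≤ U) :
    (f • a).app V h = 𝒪.res h f • a.app V h := rfl

instance : AddCommGroup (DualSec E U) where
  add_assoc a b c := by ext1; funext V h; simp [add_assoc]
  zero_add a := by ext1; funext V h; simp
  add_zero a := by ext1; funext V h; simp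
  nsmul := nsmulRec
  zsmul := zsmulRec
  neg_add_cancel a := by
    ext1
    funext V h
    exact LinearMap.ext fun s => neg_add_cancel (a.app V h s)
  add_comm a b := by ext1; funext V h; simp [add_comm]

instance : Module (𝒪.Sec U) (DualSec E U) where
  one_smul a := by ext1; funext V h; simp
  mul_smul f g a := by ext1; funext V h; simp [mul_smul]
  smul_zero f := by ext1; funext V h; simp
  smul_add f a b := by ext1; funext V h; simp
  add_smul f g a := by ext1; funext V h; simp [add_smul]
  zero_smul a := by ext1; funext V h; simp

/-- Restriction of a morphism `E|U → 𝒪|U` to `V ⊆ U`. -/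
def res {V : Opens X} (h : V ≤ U) : DualSec E U →ₛₗ[𝒪.res h] DualSec E V where
  toFun a := ⟨fun W hW => a.app W (hW.trans h), fun W W' _ hW' s => a.natural W W' _ hW' s⟩
  map_add' _ _ := rfl
  map_smul' _ _ := rfl

@[simp] theorem res_app {V : Opens X} (h : V ≤ U) (a : DualSec E U) (W : Opens X) (hW : W ≤ V) :
    (res h a).app W hW = a.app W (hW.trans h) := rfl

theorem separated (𝒰 : Set (Opens X)) (a b : DualSec E (sSup 𝒰))
    (h : ∀ V : 𝒰, res (le_sSup V.2) a = res (le_sSup V.2) b) : a = b := by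
  ext1
  funext W hW
  refine LinearMap.ext fun s => Subtype.ext (funext fun x => ?_)
  obtain ⟨V, hV, hxV⟩ := Opens.mem_sSup.1 (hW x.2)
  have key := congrArg (fun c => (c.app (W ⊓ V) inf_le_right (E.res inf_le_left s)).1
    ⟨x.1, x.2, hxV⟩) (h ⟨V, hV⟩)
  simp only [res_app] at key
  rw [← a.natural W _ hW inf_le_left, ← b.natural W _ hW inf_le_left] at key
  exact key

theorem glue (𝒰 : Set (Opens X)) (a : ∀ V : 𝒰, DualSec E V.1)
    (h : ∀ V W : 𝒰, res (inf_le_left : V.1 ⊓ W.1 ≤ V.1) (a V) =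
      res (inf_le_right : V.1 ⊓ W.1 ≤ W.1) (a W)) :
    ∃ b : DualSec E (sSup 𝒰), ∀ V : 𝒰, res (le_sSup V.2) b = a V := by
  have hcov : ∀ W : Opens X, W ≤ sSup 𝒰 → ∀ x : W, ∃ V : 𝒰, x.1 ∈ V.1 := by
    intro W hW x
    obtain ⟨V, hV, hxV⟩ := Opens.mem_sSup.1 (hW x.2)
    exact ⟨⟨V, hV⟩, hxV⟩
  choose c hc using hcov
  -- the value at a point may be computed with any member of the family, on any neighbourhood
  have indep : ∀ (V V' : 𝒰) (W : Opens X) (s : E.Sec W) (x : X) (hx : x ∈ W) (hV : x ∈ V.1)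
      (hV' : x ∈ V'.1),
      ((a V).app (W ⊓ V.1) inf_le_right (E.res inf_le_left s)).1 ⟨x, hx, hV⟩ =
      ((a V').app (W ⊓ V'.1) inf_le_right (E.res inf_le_left s)).1 ⟨x, hx, hV'⟩ := by
    intro V V' W s x hx hV hV'
    have h1 : W ⊓ (V.1 ⊓ V'.1) ≤ W ⊓ V.1 := inf_le_inf le_rfl inf_le_left
    have h2 : W ⊓ (V.1 ⊓ V'.1) ≤ W ⊓ V'.1 := inf_le_inf le_rfl inf_le_right
    have e1 := congrArg (fun f => f.1 ⟨x, hx, hV, hV'⟩)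
      ((a V).natural (W ⊓ V.1) (W ⊓ (V.1 ⊓ V'.1)) inf_le_right h1 (E.res inf_le_left s))
    have e2 := congrArg (fun f => f.1 ⟨x, hx, hV, hV'⟩)
      ((a V').natural (W ⊓ V'.1) (W ⊓ (V.1 ⊓ V'.1)) inf_le_right h2 (E.res inf_le_left s))
    have e3 := congrArg (fun b => (b.app (W ⊓ (V.1 ⊓ V'.1)) inf_le_right
      (E.res inf_le_left s)).1 ⟨x, hx, hV, hV'⟩) (h V V')
    simp only [TopRingedSpace.res_apply, E.res_res, res_app] at e1 e2 e3
    exact e1.trans (e3.trans e2.symm)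
  let F : ∀ (W : Opens X) (hW : W ≤ sSup 𝒰) (s : E.Sec W), W → K := fun W hW s x =>
    ((a (c W hW x)).app (W ⊓ (c W hW x).1) inf_le_right (E.res inf_le_left s)).1
      ⟨x.1, x.2, hc W hW x⟩
  have hF : ∀ (W : Opens X) (hW : W ≤ sSup 𝒰) (s : E.Sec W) (V : 𝒰) (y : (W ⊓ V.1 : Opens X)),
      F W hW s ⟨y.1, y.2.1⟩ =
        ((a V).app (W ⊓ V.1) inf_le_right (E.res inf_le_left s)).1 y :=
    fun W hW s V y => indep (c W hW ⟨y.1, y.2.1⟩) V W s y.1 y.2.1 (hc W hW ⟨y.1, y.2.1⟩) y.2.2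
  have mem : ∀ (W : Opens X) (hW : W ≤ sSup 𝒰) (s : E.Sec W), F W hW s ∈ 𝒪.sections W := by
    intro W hW s
    refine 𝒪.local_mem W _ fun x => ⟨W ⊓ (c W hW x).1, ⟨x.2, hc W hW x⟩, inf_le_left, ?_⟩
    have : (fun y : (W ⊓ (c W hW x).1 : Opens X) => F W hW s ⟨y.1, y.2.1⟩) =
        ((a (c W hW x)).app (W ⊓ (c W hW x).1) inf_le_right (E.res inf_le_left s)).1 :=
      funext fun y => hF W hW s _ y
    exact this ▸ Subtype.property _
  refine ⟨⟨fun W hW =>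
    { toFun := fun s => ⟨F W hW s, mem W hW s⟩
      map_add' := ?_
      map_smul' := ?_ }, ?_⟩, ?_⟩
  · intro s t
    refine Subtype.ext (funext fun x => ?_)
    simp only [F, map_add]
    rfl
  · intro f s
    refine Subtype.ext (funext fun x => ?_)
    simp only [F, map_smulₛₗ]
    rfl
  · intro V W hV hW s
    refine Subtype.ext (funext fun x => ?_)
    change F V hV s ⟨x.1, hW x.2⟩ = F W (hW.trans hV) (E.res hW s) x
    have e1 := hF V hV s (c W (hW.trans hV) x) ⟨x.1, hW x.2, hc W (hW.trans hV) x⟩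
    refine e1.trans ?_
    have e2 := congrArg (fun f => f.1 ⟨x.1, x.2, hc W (hW.trans hV) x⟩)
      ((a (c W (hW.trans hV) x)).natural (V ⊓ (c W (hW.trans hV) x).1)
        (W ⊓ (c W (hW.trans hV) x).1) inf_le_right (inf_le_inf hW le_rfl) (E.res inf_le_left s))
    simp only [TopRingedSpace.res_apply, E.res_res] at e2
    simp only [F, E.res_res]
    exact e2
  · intro V
    ext1
    funext W hW
    refine LinearMap.ext fun s => Subtype.ext (funext fun x => ?_)
    refine (hF W (hW.trans (le_sSup V.2)) s V ⟨x.1, x.2, hW x.2⟩).trans ?_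
    exact (congrArg (fun f => f.1 ⟨x.1, x.2, hW x.2⟩)
      ((a V).natural W (W ⊓ V.1) hW inf_le_left s)).symm

end DualSec

/-- The dual sheaf `E* = ℋom(E, 𝒪)`. -/
def ModSheaf.dual (E : ModSheaf.{u, v, w} 𝒪) : ModSheaf.{u, v, max u v w} 𝒪 where
  Sec U := DualSec E U
  res h := DualSec.res h
  res_id _ _ := rfl
  res_res _ _ _ := rfl
  separated := DualSec.separated
  glue := DualSec.glue

/-! ## Sheafification of presheaves of rings -/

/-- Presheaves of (not necessarily commutative) rings on `X`. -/
structure RingPresheaf (X : Type v) [TopologicalSpace X] where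
  Sec : Opens X → Type w
  [ring : ∀ U, Ring (Sec U)]
  res : ∀ {U V : Opens X} (_ : V ≤ U), Sec U →+* Sec V
  res_id : ∀ (U : Opens X) (s : Sec U), res le_rfl s = s
  res_res : ∀ {U V W : Opens X} (h : V ≤ U) (h' : W ≤ V) (s : Sec U),
    res h' (res h s) = res (h'.trans h) s

attribute [instance] RingPresheaf.ring

/-- The open neighbourhoods of `x`, ordered by reverse inclusion. -/
abbrev Nhd (x : X) : Type v := {V : Opens X // x ∈ V}ᵒᵈ

instance (x : X) : Nonempty (Nhd x) := ⟨OrderDual.toDual ⟨⊤, trivial⟩⟩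

instance (x : X) : IsDirectedOrder (Nhd x) :=
  ⟨fun V W => ⟨OrderDual.toDual ⟨V.1 ⊓ W.1, V.2, W.2⟩,
    (inf_le_left : V.1 ⊓ W.1 ≤ V.1), (inf_le_right : V.1 ⊓ W.1 ≤ W.1)⟩⟩

namespace RingPresheaf

variable (P : RingPresheaf.{v, w} X)

/-- The transition maps of the directed system whose colimit is the stalk at `x`. -/
def trans (x : X) (V W : Nhd x) (h : V ≤ W) : P.Sec V.1 →+* P.Sec W.1 := P.res h

instance (x : X) :
    DirectedSystem (fun V : Nhd x => P.Sec V.1) (fun _ _ h => P.trans x _ _ h) where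
  map_self _ t := P.res_id _ t
  map_map _ _ _ h h' t := P.res_res h h' t

/-- The stalk of `P` at `x`: the colimit of the rings `P(V)` over the open neighbourhoods `V`. -/
def Stalk (x : X) : Type (max v w) := DirectLimit (fun V : Nhd x => P.Sec V.1) (P.trans x)

instance (x : X) : Ring (P.Stalk x) :=
  inferInstanceAs (Ring (DirectLimit (fun V : Nhd x => P.Sec V.1) (P.trans x)))

/-- The germ at `x ∈ V` of an element of `P(V)`. -/
def germ {V : Opens X} (x : X) (hx : x ∈ V) : P.Sec V →+* P.Stalk x where
  toFun t := (⟦⟨OrderDual.toDual ⟨V, hx⟩, t⟩⟧ :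
    DirectLimit (fun V : Nhd x => P.Sec V.1) (P.trans x))
  map_one' := (DirectLimit.one_def (f := P.trans x) (OrderDual.toDual ⟨V, hx⟩)).symm
  map_zero' := (DirectLimit.zero_def (f := P.trans x) (OrderDual.toDual ⟨V, hx⟩)).symm
  map_mul' a b := (DirectLimit.mul_def (f := P.trans x) (OrderDual.toDual ⟨V, hx⟩) a b).symm
  map_add' a b := (DirectLimit.add_def (f := P.trans x) (OrderDual.toDual ⟨V, hx⟩) a b).symm

theorem germ_res {U V : Opens X} (h : V ≤ U) (x : X) (hx : x ∈ V) (t : P.Sec U) :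
    P.germ x hx (P.res h t) = P.germ x (h hx) t :=
  (DirectLimit.eq_of_le (f := P.trans x) (F := fun V : Nhd x => P.Sec V.1)
    ⟨OrderDual.toDual ⟨U, h hx⟩, t⟩ (OrderDual.toDual ⟨V, hx⟩) h).symm

/-- A compatible family of maps `P(V) → C`, for `x ∈ V`, induces a map on the stalk at `x`. -/
def stalkLift {C : Type*} (x : X) (g : ∀ V : Opens X, x ∈ V → P.Sec V → C)
    (hg : ∀ (V W : Opens X) (hV : x ∈ V) (hW : x ∈ W) (h : W ≤ V) (t : P.Sec V),
      g V hV t = g W hW (P.res h t)) : P.Stalk x → C :=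
  DirectLimit.lift (P.trans x) (fun V t => g V.1 V.2 t) (fun V W h t => hg V.1 W.1 V.2 W.2 h t)

theorem stalkLift_germ {C : Type*} (x : X) (g : ∀ V : Opens X, x ∈ V → P.Sec V → C)
    (hg : ∀ (V W : Opens X) (hV : x ∈ V) (hW : x ∈ W) (h : W ≤ V) (t : P.Sec V),
      g V hV t = g W hW (P.res h t)) {V : Opens X} (hV : x ∈ V) (t : P.Sec V) :
    P.stalkLift x g hg (P.germ x hV t) = g V hV t := rfl

/-- A family of germs over `U` which locally comes from elements of the presheaf. -/
def IsLocallyInduced {U : Opens X} (s : ∀ x : U, P.Stalk x.1) : Prop :=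
  ∀ x : U, ∃ (V : Opens X) (h : V ≤ U) (t : P.Sec V), x.1 ∈ V ∧
    ∀ y : V, s ⟨y.1, h y.2⟩ = P.germ y.1 y.2 t

/-- The ring of sections over `U` of the sheafification of `P`: the families of germs over `U`
which are locally induced by elements of the presheaf. -/
def Sheafify (U : Opens X) : Subring (∀ x : U, P.Stalk x.1) where
  carrier := {s | P.IsLocallyInduced s}
  mul_mem' := by
    intro a b ha hb x
    obtain ⟨V, hV, t, hx, ht⟩ := ha x
    obtain ⟨W, hW, r, hx', hr⟩ := hb x
    refine ⟨V ⊓ W, inf_le_left.trans hV,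
      P.res inf_le_left t * P.res inf_le_right r, ⟨hx, hx'⟩, fun y => ?_⟩
    rw [map_mul, germ_res, germ_res, Pi.mul_apply, ← ht ⟨y.1, y.2.1⟩, ← hr ⟨y.1, y.2.2⟩]
  one_mem' := fun x => ⟨U, le_rfl, 1, x.2, fun y => ((P.germ y.1 y.2).map_one).symm⟩
  add_mem' := by
    intro a b ha hb x
    obtain ⟨V, hV, t, hx, ht⟩ := ha x
    obtain ⟨W, hW, r, hx', hr⟩ := hb x
    refine ⟨V ⊓ W, inf_le_left.trans hV,
      P.res inf_le_left t + P.res inf_le_right r, ⟨hx, hx'⟩, fun y => ?_⟩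
    rw [map_add, germ_res, germ_res, Pi.add_apply, ← ht ⟨y.1, y.2.1⟩, ← hr ⟨y.1, y.2.2⟩]
  zero_mem' := fun x => ⟨U, le_rfl, 0, x.2, fun y => ((P.germ y.1 y.2).map_zero).symm⟩
  neg_mem' := by
    intro a ha x
    obtain ⟨V, hV, t, hx, ht⟩ := ha x
    refine ⟨V, hV, -t, hx, fun y => ?_⟩
    rw [map_neg, Pi.neg_apply, ← ht y]

/-- Restriction of sections of the sheafification. -/
def sheafifyRes {U V : Opens X} (h : V ≤ U) : P.Sheafify U →+* P.Sheafify V where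
  toFun s := ⟨fun y => s.1 ⟨y.1, h y.2⟩, fun x => by
    obtain ⟨W, hW, t, hx, ht⟩ := s.2 ⟨x.1, h x.2⟩
    refine ⟨W ⊓ V, inf_le_right, P.res inf_le_left t, ⟨hx, x.2⟩, fun y => ?_⟩
    rw [germ_res]
    exact ht ⟨y.1, y.2.1⟩⟩
  map_one' := rfl
  map_mul' _ _ := rfl
  map_zero' := rfl
  map_add' _ _ := rfl

/-- The canonical map from the presheaf to its sheafification. -/
def toSheafify (U : Opens X) : P.Sec U →+* P.Sheafify U where
  toFun t := ⟨fun y => P.germ y.1 y.2 t, fun x => ⟨U, le_rfl, t, x.2, fun _ => rfl⟩⟩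
  map_one' := Subtype.ext (funext fun y => (P.germ y.1 y.2).map_one)
  map_mul' a b := Subtype.ext (funext fun y => (P.germ y.1 y.2).map_mul a b)
  map_zero' := Subtype.ext (funext fun y => (P.germ y.1 y.2).map_zero)
  map_add' a b := Subtype.ext (funext fun y => (P.germ y.1 y.2).map_add a b)

end RingPresheaf

/-! ## The exterior algebra sheaf -/

section Algebra

variable {R S : Type*} [CommRing R] [CommRing S] {σ : R →+* S}
  {M N : Type*} [AddCommGroup M] [Module R M] [AddCommGroup N] [Module S N]

/-- The ring homomorphism `⋀_R M → ⋀_S N` induced by a semilinear map `M → N`. -/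
def extMap (g : M →ₛₗ[σ] N) : ExteriorAlgebra R M →+* ExteriorAlgebra S N :=
  letI : Module R N := Module.compHom N σ
  letI : Algebra R (ExteriorAlgebra S N) :=
    ((algebraMap S (ExteriorAlgebra S N)).comp σ).toAlgebra'
      (fun r x => Algebra.commutes (σ r) x)
  (ExteriorAlgebra.lift R (A := ExteriorAlgebra S N)
    ⟨{ toFun := fun m => ExteriorAlgebra.ι S (g m)
       map_add' := fun a b => by simp
       map_smul' := fun r a => by
        rw [map_smulₛₗ, map_smul, Algebra.smul_def (R := S)]; rfl },
      fun m => ExteriorAlgebra.ι_sq_zero (R := S) (g m)⟩).toRingHom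

@[simp] theorem extMap_ι (g : M →ₛₗ[σ] N) (m : M) :
    extMap g (ExteriorAlgebra.ι R m) = ExteriorAlgebra.ι S (g m) := by
  let : Module R N := Module.compHom N σ
  let : Algebra R (ExteriorAlgebra S N) :=
    ((algebraMap S (ExteriorAlgebra S N)).comp σ).toAlgebra'
      (fun r x => Algebra.commutes (σ r) x)
  exact ExteriorAlgebra.lift_ι_apply R (A := ExteriorAlgebra S N) _ _ _

@[simp] theorem extMap_algebraMap (g : M →ₛₗ[σ] N) (r : R) :
    extMap g (algebraMap R _ r) = algebraMap S _ (σ r) := by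
  let : Module R N := Module.compHom N σ
  let : Algebra R (ExteriorAlgebra S N) :=
    ((algebraMap S (ExteriorAlgebra S N)).comp σ).toAlgebra'
      (fun r x => Algebra.commutes (σ r) x)
  exact AlgHom.commutes (ExteriorAlgebra.lift R (A := ExteriorAlgebra S N) _) r

theorem extMap_ιMulti (g : M →ₛₗ[σ] N) (n : ℕ) (m : Fin n → M) :
    extMap g (ExteriorAlgebra.ιMulti R n m) = ExteriorAlgebra.ιMulti S n (fun i => g (m i)) := by
  simp [ExteriorAlgebra.ιMulti_apply, map_list_prod, List.map_ofFn, Function.comp_def]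

/-- For a bilinear map `B : M × N → R` and `ξ₁, …, ξₖ ∈ N`, the linear form on `⋀ M` given by
`m₁ ∧ ⋯ ∧ mₖ ↦ det (B (mᵢ, ξⱼ))` on `⋀ᵏ M` and by zero on `⋀ˡ M` for `l ≠ k`. -/
def extPair {N' : Type*} [AddCommGroup N'] [Module R N'] (B : M →ₗ[R] N' →ₗ[R] R) {k : ℕ}
    (ξ : Fin k → N') : ExteriorAlgebra R M →ₗ[R] R :=
  ExteriorAlgebra.liftAlternating
    (Pi.single k (Matrix.detRowAlternating.compLinearMap (LinearMap.pi fun j => B.flip (ξ j))))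

theorem extPair_ιMulti {N' : Type*} [AddCommGroup N'] [Module R N'] (B : M →ₗ[R] N' →ₗ[R] R)
    {k : ℕ} (ξ : Fin k → N') (m : Fin k → M) :
    extPair B ξ (ExteriorAlgebra.ιMulti R k m) = Matrix.det (Matrix.of fun i j => B (m i) (ξ j)) := by
  rw [extPair, ExteriorAlgebra.liftAlternating_apply_ιMulti, Pi.single_eq_same]
  rfl

theorem extPair_ιMulti_of_ne {N' : Type*} [AddCommGroup N'] [Module R N']
    (B : M →ₗ[R] N' →ₗ[R] R) {k l : ℕ} (hl : l ≠ k) (ξ : Fin k → N') (m : Fin l → M) :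
    extPair B ξ (ExteriorAlgebra.ιMulti R l m) = 0 := by
  rw [extPair, ExteriorAlgebra.liftAlternating_apply_ιMulti, Pi.single_eq_of_ne hl]
  rfl

theorem extPair_extMap {M' N' : Type*} [AddCommGroup M'] [Module R M']
    [AddCommGroup N'] [Module S N'] (B : M →ₗ[R] M' →ₗ[R] R) (B' : N →ₗ[S] N' →ₗ[S] S)
    (g : M →ₛₗ[σ] N) (g' : M' →ₛₗ[σ] N')
    (hB : ∀ m m', B' (g m) (g' m') = σ (B m m')) {k : ℕ} (ξ : Fin k → M')
    (t : ExteriorAlgebra R M) :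
    extPair B' (fun i => g' (ξ i)) (extMap g t) = σ (extPair B ξ t) := by
  have ht : t ∈ Submodule.span R
      (Set.range fun x : Σ n, (Fin n → M) => ExteriorAlgebra.ιMulti R x.1 x.2) := by
    rw [ExteriorAlgebra.ιMulti_span]; trivial
  induction ht using Submodule.span_induction with
  | mem x hx =>
    obtain ⟨⟨l, m⟩, rfl⟩ := hx
    simp only [extMap_ιMulti]
    by_cases hl : l = k
    · subst hl
      rw [extPair_ιMulti, extPair_ιMulti, RingHom.map_det]
      congr 1
      ext i j
      simp [hB]
    · rw [extPair_ιMulti_of_ne _ hl, extPair_ιMulti_of_ne _ hl, map_zero]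
  | zero => simp
  | add x y _ _ hx hy => simp [hx, hy]
  | smul r x _ hx =>
    rw [Algebra.smul_def, map_mul, extMap_algebraMap, ← Algebra.smul_def, map_smul, hx,
      ← Algebra.smul_def, map_smul]
    simp

end Algebra

variable (E : ModSheaf.{u, v, w} 𝒪)

/-- The presheaf of rings `U ↦ ⋀_{𝒪(U)} E(U)`. -/
abbrev ExtPre (U : Opens X) : Type (max u v w) := ExteriorAlgebra (𝒪.Sec U) (E.Sec U)

/-- The restriction maps of the presheaf `U ↦ ⋀_{𝒪(U)} E(U)`. -/
def ExtPre.res {U V : Opens X} (h : V ≤ U) : ExtPre E U →+* ExtPre E V := extMap (E.res h)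

theorem ExtPre.res_id (U : Opens X) (t : ExtPre E U) : ExtPre.res E (le_refl U) t = t := by
  induction t using ExteriorAlgebra.induction with
  | algebraMap r => simp only [ExtPre.res, extMap_algebraMap]; rfl
  | ι x => simp [ExtPre.res, E.res_id]
  | mul a b ha hb => rw [map_mul, ha, hb]
  | add a b ha hb => rw [map_add, ha, hb]

theorem ExtPre.res_res {U V W : Opens X} (h : V ≤ U) (h' : W ≤ V) (t : ExtPre E U) :
    ExtPre.res E h' (ExtPre.res E h t) = ExtPre.res E (h'.trans h) t := by
  induction t using ExteriorAlgebra.induction with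
  | algebraMap r => simp only [ExtPre.res, extMap_algebraMap]; rfl
  | ι x => simp [ExtPre.res, E.res_res]
  | mul a b ha hb => simp only [map_mul, ha, hb]
  | add a b ha hb => simp only [map_add, ha, hb]

/-- The presheaf of rings `U ↦ ⋀_{𝒪(U)} E(U)`. -/
def extPresheaf : RingPresheaf.{v, max u v w} X where
  Sec U := ExtPre E U
  res h := ExtPre.res E h
  res_id := ExtPre.res_id E
  res_res h h' t := ExtPre.res_res E h h' t

/-- The ring of sections over `U` of the exterior algebra sheaf `⋀ E = ⨁ᵢ ⋀ⁱ E`, the sheafification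
of the presheaf `U ↦ ⋀_{𝒪(U)} E(U)`. The product `∧` is the multiplication of this ring. -/
abbrev Wedge (U : Opens X) : Type (max u v w) := ↥((extPresheaf E).Sheafify U)

namespace Wedge

variable {E} {U : Opens X}

/-- Restriction of sections of `⋀ E`. -/
def res {V : Opens X} (h : V ≤ U) : Wedge E U →+* Wedge E V := (extPresheaf E).sheafifyRes h

/-- The canonical map from `⋀_{𝒪(U)} E(U)` to the sections of `⋀ E` over `U`. -/
def ofPre (U : Opens X) : ExtPre E U →+* Wedge E U := (extPresheaf E).toSheafify U

/-- The inclusion `𝒪 = ⋀⁰ E → ⋀ E`, the structure map of the `𝒪`-algebra `⋀ E`. -/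
def fn (f : 𝒪.Sec U) : Wedge E U := ofPre U (algebraMap (𝒪.Sec U) (ExtPre E U) f)

/-- The inclusion `E = ⋀¹ E → ⋀ E`. -/
def ι (D : E.Sec U) : Wedge E U := ofPre U (ExteriorAlgebra.ι (𝒪.Sec U) D)

/-- The section `a` of `⋀ E` is homogeneous of degree `i`, i.e. it belongs to the subsheaf `⋀ⁱ E`:
it is locally induced by elements of `⋀ⁱ_{𝒪(V)} E(V)`. -/
def HasDegree (i : ℕ) (a : Wedge E U) : Prop :=
  ∀ x : U, ∃ (V : Opens X) (h : V ≤ U) (t : ExtPre E V), x.1 ∈ V ∧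
    t ∈ ⋀[𝒪.Sec V]^i (E.Sec V) ∧ ∀ y : V, a.1 ⟨y.1, h y.2⟩ = (extPresheaf E).germ y.1 y.2 t

end Wedge

/-! ## Lie algebroids -/

/-- A Lie algebroid structure on the sheaf of modules `F`. A morphism of sheaves
`F → 𝒟er_K(𝒪)` is the same as a family of maps `F(U) → Der_K(𝒪(U))` compatible with restrictions;
this is how the anchor is given. -/
@[ext] structure LieAlgebroid (F : ModSheaf.{u, v, w} 𝒪) where
  /-- the Lie bracket -/
  lie : ∀ {U : Opens X}, F.Sec U → F.Sec U → F.Sec U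
  /-- the anchor -/
  anchor : ∀ {U : Opens X}, F.Sec U →ₗ[𝒪.Sec U] Derivation K (𝒪.Sec U) (𝒪.Sec U)
  lie_res : ∀ {U V : Opens X} (h : V ≤ U) (D D' : F.Sec U),
    F.res h (lie D D') = lie (F.res h D) (F.res h D')
  anchor_res : ∀ {U V : Opens X} (h : V ≤ U) (D : F.Sec U) (f : 𝒪.Sec U),
    𝒪.res h (anchor D f) = anchor (F.res h D) (𝒪.res h f)
  add_lie : ∀ {U : Opens X} (D₁ D₂ D' : F.Sec U), lie (D₁ + D₂) D' = lie D₁ D' + lie D₂ D'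
  lie_add : ∀ {U : Opens X} (D D₁ D₂ : F.Sec U), lie D (D₁ + D₂) = lie D D₁ + lie D D₂
  smul_lie : ∀ {U : Opens X} (c : K) (D D' : F.Sec U),
    lie (algebraMap K (𝒪.Sec U) c • D) D' = algebraMap K (𝒪.Sec U) c • lie D D'
  lie_smul : ∀ {U : Opens X} (c : K) (D D' : F.Sec U),
    lie D (algebraMap K (𝒪.Sec U) c • D') = algebraMap K (𝒪.Sec U) c • lie D D'
  lie_self : ∀ {U : Opens X} (D : F.Sec U), lie D D = 0
  jacobi : ∀ {U : Opens X} (D₁ D₂ D₃ : F.Sec U),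
    lie D₁ (lie D₂ D₃) = lie (lie D₁ D₂) D₃ + lie D₂ (lie D₁ D₃)
  anchor_lie : ∀ {U : Opens X} (D D' : F.Sec U), anchor (lie D D') = ⁅anchor D, anchor D'⁆
  leibniz : ∀ {U : Opens X} (D D' : F.Sec U) (f : 𝒪.Sec U),
    lie D (f • D') = f • lie D D' + anchor D f • D'

/-- Morphisms of Lie algebroids over `(X, 𝒪)`. -/
@[ext] structure LieAlgebroidHom {F : ModSheaf.{u, v, w} 𝒪} {G : ModSheaf.{u, v, w'} 𝒪}
    (𝓕 : LieAlgebroid F) (𝓖 : LieAlgebroid G) where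
  map : ∀ {U : Opens X}, F.Sec U →ₗ[𝒪.Sec U] G.Sec U
  map_res : ∀ {U V : Opens X} (h : V ≤ U) (D : F.Sec U), G.res h (map D) = map (F.res h D)
  map_lie : ∀ {U : Opens X} (D D' : F.Sec U), map (𝓕.lie D D') = 𝓖.lie (map D) (map D')
  anchor_map : ∀ {U : Opens X} (D : F.Sec U), 𝓖.anchor (map D) = 𝓕.anchor D

/-! ## Gerstenhaber brackets on exterior algebra sheaves -/

/-- A Gerstenhaber algebra structure on the graded commutative algebra `(⋀ E, ∧)`. -/
@[ext] structure GerstenhaberBracket (E : ModSheaf.{u, v, w} 𝒪) where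
  br : ∀ {U : Opens X}, Wedge E U → Wedge E U → Wedge E U
  br_res : ∀ {U V : Opens X} (h : V ≤ U) (a b : Wedge E U),
    Wedge.res h (br a b) = br (Wedge.res h a) (Wedge.res h b)
  add_br : ∀ {U : Opens X} (a a' b : Wedge E U), br (a + a') b = br a b + br a' b
  br_add : ∀ {U : Opens X} (a b b' : Wedge E U), br a (b + b') = br a b + br a b'
  smul_br : ∀ {U : Opens X} (c : K) (a b : Wedge E U),
    br (Wedge.fn (algebraMap K (𝒪.Sec U) c) * a) b = Wedge.fn (algebraMap K (𝒪.Sec U) c) * br a b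
  br_smul : ∀ {U : Opens X} (c : K) (a b : Wedge E U),
    br a (Wedge.fn (algebraMap K (𝒪.Sec U) c) * b) = Wedge.fn (algebraMap K (𝒪.Sec U) c) * br a b
  /-- the bracket has degree `-1` -/
  degree : ∀ {U : Opens X} {i j k : ℕ} (a b : Wedge E U), a.HasDegree i → b.HasDegree j →
    i + j = k + 1 → (br a b).HasDegree k
  /-- the bracket of two elements of degree `0` lies in `⋀⁻¹ E = 0` -/
  degree_zero : ∀ {U : Opens X} (a b : Wedge E U), a.HasDegree 0 → b.HasDegree 0 → br a b = 0
  antisymm : ∀ {U : Opens X} {i j : ℕ} (a b : Wedge E U), a.HasDegree i → b.HasDegree j →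
    br a b = -(((i : ℤ) - 1) * ((j : ℤ) - 1)).negOnePow • br b a
  jacobi : ∀ {U : Opens X} {i j : ℕ} (a b c : Wedge E U), a.HasDegree i → b.HasDegree j →
    br a (br b c) = br (br a b) c + (((i : ℤ) - 1) * ((j : ℤ) - 1)).negOnePow • br b (br a c)
  leibniz : ∀ {U : Opens X} {i j : ℕ} (a b c : Wedge E U), a.HasDegree i → b.HasDegree j →
    br a (b * c) = br a b * c + (((i : ℤ) - 1) * (j : ℤ)).negOnePow • (b * br a c)

/-- The zero bracket. -/
instance (E : ModSheaf.{u, v, w} 𝒪) : Nonempty (GerstenhaberBracket E) :=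
  ⟨{ br := fun _ _ => 0
     br_res := by intros; simp
     add_br := by intros; simp
     br_add := by intros; simp
     smul_br := by intros; simp
     br_smul := by intros; simp
     degree := fun {U i j k} a b _ _ _ x =>
      ⟨U, le_rfl, 0, x.2, Submodule.zero_mem _, fun y => (((extPresheaf E).germ y.1 y.2).map_zero).symm⟩
     degree_zero := by intros; rfl
     antisymm := by intros; simp
     jacobi := by intros; simp
     leibniz := by intros; simp }⟩

/-- `β` is the Schouten bracket of the Lie algebroid `𝓕`: the Gerstenhaber bracket on `⋀ F` which
extends the Lie bracket of `F` and satisfies `[D, f] = 𝔞(D)(f)`. -/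
def IsSchouten {F : ModSheaf.{u, v, w} 𝒪} (𝓕 : LieAlgebroid F) (β : GerstenhaberBracket F) :
    Prop :=
  (∀ (U : Opens X) (D D' : F.Sec U), β.br (Wedge.ι D) (Wedge.ι D') = Wedge.ι (𝓕.lie D D')) ∧
  (∀ (U : Opens X) (D : F.Sec U) (f : 𝒪.Sec U), β.br (Wedge.ι D) (Wedge.fn f) = Wedge.fn (𝓕.anchor D f))

/-- The Schouten bracket `[·,·]^𝓕` on `⋀ F`, i.e. the unique Gerstenhaber bracket with the property
`IsSchouten 𝓕`; on products of sections of `F` it is given by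
`[D₁ ∧ ⋯ ∧ Dₘ, Dₘ₊₁ ∧ ⋯ ∧ Dₙ] = ∑_{i ≤ m < j} (-1)^{i+j+m} [Dᵢ, Dⱼ] ∧ D₁ ∧ ⋯ D̂ᵢ ⋯ D̂ⱼ ⋯ ∧ Dₙ`. The pair `(⋀ F, [·,·]^𝓕)` is the standard Gerstenhaber
algebra `𝒢_𝓕` of the Lie algebroid `𝓕`. -/
def schouten {F : ModSheaf.{u, v, w} 𝒪} (𝓕 : LieAlgebroid F) : GerstenhaberBracket F :=
  Classical.epsilon (IsSchouten 𝓕)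

/-- Homomorphisms of graded `𝒪`-algebras `⋀ E → ⋀ F`. -/
@[ext] structure GradedAlgHom (E : ModSheaf.{u, v, w} 𝒪) (F : ModSheaf.{u, v, w'} 𝒪) where
  map : ∀ {U : Opens X}, Wedge E U →+* Wedge F U
  map_res : ∀ {U V : Opens X} (h : V ≤ U) (a : Wedge E U), Wedge.res h (map a) = map (Wedge.res h a)
  map_fn : ∀ {U : Opens X} (f : 𝒪.Sec U), map (Wedge.fn f : Wedge E U) = Wedge.fn f
  degree : ∀ {U : Opens X} {i : ℕ} (a : Wedge E U), a.HasDegree i → (map a).HasDegree i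

/-! ## The Chevalley-Eilenberg-de Rham differential -/

/-- A pairing of sheaves of modules `E × F → 𝒪`. -/
structure Pairing (E : ModSheaf.{u, v, w} 𝒪) (F : ModSheaf.{u, v, w'} 𝒪) where
  pair : ∀ {U : Opens X}, E.Sec U →ₗ[𝒪.Sec U] F.Sec U →ₗ[𝒪.Sec U] 𝒪.Sec U
  pair_res : ∀ {U V : Opens X} (h : V ≤ U) (e : E.Sec U) (ξ : F.Sec U),
    pair (E.res h e) (F.res h ξ) = 𝒪.res h (pair e ξ)

/-- The evaluation pairing `F* × F → 𝒪`. -/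
def evalPairing (F : ModSheaf.{u, v, w} 𝒪) : Pairing F.dual F where
  pair {U} := LinearMap.mk₂ (𝒪.Sec U) (fun (ω : DualSec F U) D => ω.app U le_rfl D)
    (fun _ _ _ => rfl) (fun _ _ _ => rfl) (fun _ _ _ => map_add _ _ _) (fun _ _ _ => map_smul _ _ _)
  pair_res {U V} h ω D := (DualSec.natural ω U V le_rfl h D).symm

/-- The pairing with the two arguments exchanged. -/
def Pairing.flip {E : ModSheaf.{u, v, w} 𝒪} {F : ModSheaf.{u, v, w'} 𝒪} (p : Pairing E F) :
    Pairing F E where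
  pair := p.pair.flip
  pair_res h e ξ := p.pair_res h ξ e

namespace Pairing

variable {E : ModSheaf.{u, v, w} 𝒪} {F : ModSheaf.{u, v, w'} 𝒪} (p : Pairing E F)

theorem extPair_res {U V : Opens X} (h : V ≤ U) {k : ℕ} (ξ : Fin k → F.Sec U) (t : ExtPre E U) :
    extPair p.pair (fun i => F.res h (ξ i)) (ExtPre.res E h t) = 𝒪.res h (extPair p.pair ξ t) :=
  extPair_extMap _ _ _ _ (fun m m' => p.pair_res h m m') ξ t

/-- The value at `x` of the pairing of a germ of `⋀ E` with `ξ₁, …, ξₖ ∈ F(U)`. -/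
def stalkValue {U : Opens X} {k : ℕ} (ξ : Fin k → F.Sec U) (x : U) :
    (extPresheaf E).Stalk x.1 → K :=
  (extPresheaf E).stalkLift x.1
    (fun V hV t => (extPair p.pair (fun i => F.res (inf_le_left : U ⊓ V ≤ U) (ξ i))
      (ExtPre.res E inf_le_right t)).1 ⟨x.1, x.2, hV⟩)
    (by
      intro V W hV hW h t
      have := congrArg (fun f => f.1 ⟨x.1, x.2, hW⟩) (p.extPair_res
        (inf_le_inf le_rfl h : U ⊓ W ≤ U ⊓ V)
        (fun i => F.res (inf_le_left : U ⊓ V ≤ U) (ξ i))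
        (ExtPre.res E (inf_le_right : U ⊓ V ≤ V) t))
      simp only [F.res_res, TopRingedSpace.res_apply] at this
      refine this.symm.trans ?_
      exact congrArg (fun r => (extPair p.pair _ r).1 _) ((ExtPre.res_res E inf_le_right
        (inf_le_inf le_rfl h) t).trans (ExtPre.res_res E h inf_le_right t).symm))

theorem stalkValue_germ {U : Opens X} {k : ℕ} (ξ : Fin k → F.Sec U) {V : Opens X} (h : V ≤ U)
    (y : V) (t : ExtPre E V) :
    p.stalkValue ξ ⟨y.1, h y.2⟩ ((extPresheaf E).germ y.1 y.2 t) =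
      (extPair p.pair (fun i => F.res h (ξ i)) t).1 y := by
  have := congrArg (fun f => f.1 ⟨y.1, h y.2, y.2⟩) (p.extPair_res
    (inf_le_right : U ⊓ V ≤ V) (fun i => F.res h (ξ i)) t)
  simp only [F.res_res, TopRingedSpace.res_apply] at this
  exact this

/-- The pairing `⟨ω, ξ₁ ∧ ⋯ ∧ ξₖ⟩ ∈ 𝒪(U)` of a section `ω` of `⋀ E` with `ξ₁, …, ξₖ ∈ F(U)`; it is
`det ⟨eᵢ, ξⱼ⟩` for `ω = e₁ ∧ ⋯ ∧ eₖ`, and zero on `⋀ˡ E` for `l ≠ k`. -/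
def ev {U : Opens X} (ω : Wedge E U) {k : ℕ} (ξ : Fin k → F.Sec U) : 𝒪.Sec U :=
  ⟨fun x => p.stalkValue ξ x (ω.1 x), 𝒪.local_mem U _ fun x => by
    obtain ⟨V, hV, t, hx, ht⟩ := ω.2 x
    refine ⟨V, hx, hV, ?_⟩
    have : (fun y : V => p.stalkValue ξ ⟨y.1, hV y.2⟩ (ω.1 ⟨y.1, hV y.2⟩)) =
        (extPair p.pair (fun i => F.res hV (ξ i)) t).1 :=
      funext fun y => by rw [ht y]; exact p.stalkValue_germ ξ hV y t
    exact this ▸ Subtype.property _⟩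

theorem ev_ofPre {U : Opens X} (t : ExtPre E U) {k : ℕ} (ξ : Fin k → F.Sec U) :
    p.ev (Wedge.ofPre U t) ξ = extPair p.pair ξ t := by
  refine Subtype.ext (funext fun x => ?_)
  have := p.stalkValue_germ ξ le_rfl x t
  simp only [F.res_id] at this
  exact this

end Pairing

/-- The Chevalley-Eilenberg formula, for a cochain `c` of degree `k` (indices start at `0`):
`∑ᵢ (-1)ⁱ 𝔞(ξᵢ)(c(ξ₀, …, ξ̂ᵢ, …, ξₖ)) + ∑_{i<j} (-1)^{i+j} c([ξᵢ, ξⱼ], ξ₀, …, ξ̂ᵢ, …, ξ̂ⱼ, …, ξₖ)`.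
In the second sum the index `j.succ` runs over the positions after `i`; once `ξᵢ` has been removed,
the entry `ξ_{j.succ}` is at position `j`. -/
def ceFormula {F : ModSheaf.{u, v, w} 𝒪} (𝓕 : LieAlgebroid F) {U : Opens X} : ∀ (k : ℕ)
    (_ : (Fin k → F.Sec U) → 𝒪.Sec U) (_ : Fin (k + 1) → F.Sec U), 𝒪.Sec U
  | 0, c, ξ => 𝓕.anchor (ξ 0) (c (Fin.removeNth 0 ξ))
  | m + 1, c, ξ =>
    ∑ i : Fin (m + 2), (-1) ^ (i : ℕ) * 𝓕.anchor (ξ i) (c (i.removeNth ξ)) +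
    ∑ i : Fin (m + 2), ∑ j : Fin (m + 1), if i ≤ j.castSucc then
      (-1) ^ ((i : ℕ) + (j.succ : ℕ)) *
        c (Fin.cons (𝓕.lie (ξ i) (ξ j.succ)) (j.removeNth (i.removeNth ξ)))
      else 0

/-- `K`-linear endomorphisms of the sheaf `⋀ E` of degree `1`. -/
@[ext] structure DegOneOp (E : ModSheaf.{u, v, w} 𝒪) where
  d : ∀ {U : Opens X}, Wedge E U → Wedge E U
  d_res : ∀ {U V : Opens X} (h : V ≤ U) (a : Wedge E U), Wedge.res h (d a) = d (Wedge.res h a)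
  d_add : ∀ {U : Opens X} (a b : Wedge E U), d (a + b) = d a + d b
  d_smul : ∀ {U : Opens X} (c : K) (a : Wedge E U),
    d (Wedge.fn (algebraMap K (𝒪.Sec U) c) * a) = Wedge.fn (algebraMap K (𝒪.Sec U) c) * d a
  degree : ∀ {U : Opens X} {i : ℕ} (a : Wedge E U), a.HasDegree i → (d a).HasDegree (i + 1)

/-- The zero operator. -/
instance (E : ModSheaf.{u, v, w} 𝒪) : Nonempty (DegOneOp E) :=
  ⟨{ d := fun _ => 0
     d_res := by intros; simp
     d_add := by intros; simp
     d_smul := by intros; simp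
     degree := fun {U i} a _ x =>
      ⟨U, le_rfl, 0, x.2, Submodule.zero_mem _, fun y => (((extPresheaf E).germ y.1 y.2).map_zero).symm⟩ }⟩

/-- Let `E` and `F` be in duality through `p`, so that `⋀ᵏ E ≅ ℋom(⋀ᵏ F, 𝒪)`. The operator `δ` on
`⋀ E` is the Chevalley-Eilenberg-de Rham differential of the Lie algebroid structure `𝓕` on `F`. -/
def IsCEDifferential {E : ModSheaf.{u, v, w} 𝒪} {F : ModSheaf.{u, v, w'} 𝒪} (p : Pairing E F)
    (𝓕 : LieAlgebroid F) (δ : DegOneOp E) : Prop :=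
  ∀ (U : Opens X) (k : ℕ) (ω : Wedge E U) (ξ : Fin (k + 1) → F.Sec U), ω.HasDegree k →
    p.ev (δ.d ω) ξ = ceFormula 𝓕 k (fun η => p.ev ω η) ξ

/-- The Chevalley-Eilenberg-de Rham differential on `⋀ E` of a Lie algebroid structure on `F`, where
`E` and `F` are in duality through `p`: the unique operator with the property
`IsCEDifferential p 𝓕`. For `E = F*` and the evaluation pairing, `(⋀ F*, d)` is `Ω_𝓕`. -/
def ceDifferential {E : ModSheaf.{u, v, w} 𝒪} {F : ModSheaf.{u, v, w'} 𝒪} (p : Pairing E F)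
    (𝓕 : LieAlgebroid F) : DegOneOp E :=
  Classical.epsilon (IsCEDifferential p 𝓕)

/-! ## The two structures -/

variable {L : ModSheaf.{u, v, w} 𝒪}

/-- The structure of an `𝓛`-Lie bialgebroid on the dual pair `(E, E*)`: `𝓛`-Lie algebroid structures
`(E, φ)` and `(E*, φ')` such that the differential `d_*` on `⋀ E` defined by the Lie algebroid
structure of `E*` is a derivation of the Lie bracket of `E`. -/
@[ext] structure LieBialgebroid (𝓛 : LieAlgebroid L) (E : ModSheaf.{u, v, w'} 𝒪) where
  str : LieAlgebroid E
  dualStr : LieAlgebroid E.dual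
  φ : LieAlgebroidHom str 𝓛
  φ' : LieAlgebroidHom dualStr 𝓛
  compat : ∀ (U : Opens X) (D₁ D₂ : E.Sec U),
    (ceDifferential (evalPairing E).flip dualStr).d (Wedge.ι (str.lie D₁ D₂)) =
      (schouten str).br ((ceDifferential (evalPairing E).flip dualStr).d (Wedge.ι D₁)) (Wedge.ι D₂) +
      (schouten str).br (Wedge.ι D₁) ((ceDifferential (evalPairing E).flip dualStr).d (Wedge.ι D₂))

/-- A strong differential `𝒢_𝓛`-Gerstenhaber algebra structure on `⋀ E`. -/
@[ext] structure StrongDiffGerstenhaber (𝓛 : LieAlgebroid L) (E : ModSheaf.{u, v, w'} 𝒪) where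
  bracket : GerstenhaberBracket E
  /-- the homomorphism of Gerstenhaber algebras to `𝒢_𝓛` -/
  toG : GradedAlgHom E L
  toG_bracket : ∀ (U : Opens X) (a b : Wedge E U),
    toG.map (bracket.br a b) = (schouten 𝓛).br (toG.map a) (toG.map b)
  diff : DegOneOp E
  diff_diff : ∀ (U : Opens X) (a : Wedge E U), diff.d (diff.d a) = 0
  diff_mul : ∀ (U : Opens X) (i : ℕ) (a b : Wedge E U), a.HasDegree i →
    diff.d (a * b) = diff.d a * b + (i : ℤ).negOnePow • (a * diff.d b)
  diff_bracket : ∀ (U : Opens X) (i : ℕ) (a b : Wedge E U), a.HasDegree i →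
    diff.d (bracket.br a b) =
      bracket.br (diff.d a) b + ((i : ℤ) - 1).negOnePow • bracket.br a (diff.d b)
  /-- the homomorphism of differential graded algebras from `Ω_𝓛 = (⋀ L*, d_𝓛)` -/
  fromΩ : GradedAlgHom L.dual E
  fromΩ_diff : ∀ (U : Opens X) (a : Wedge L.dual U),
    fromΩ.map ((ceDifferential (evalPairing L) 𝓛).d a) = diff.d (fromΩ.map a)

/-- The bialgebroid `B` and the strong differential Gerstenhaber algebra `S` correspond to each
other: the bracket of `S` is the Schouten bracket of `E`, the differential of `S` is the one defined
by the Lie algebroid `E*`, the homomorphism to `𝒢_𝓛` extends `φ`, and the homomorphism from `Ω_𝓛`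
extends the transpose `L* → E` of `φ' : E* → L`. -/
structure Corresponds {𝓛 : LieAlgebroid L} {E : ModSheaf.{u, v, w'} 𝒪} (B : LieBialgebroid 𝓛 E)
    (S : StrongDiffGerstenhaber 𝓛 E) : Prop where
  bracket : IsSchouten B.str S.bracket
  diff : IsCEDifferential (evalPairing E).flip B.dualStr S.diff
  toG : ∀ (U : Opens X) (D : E.Sec U), S.toG.map (Wedge.ι D) = Wedge.ι (B.φ.map D)
  fromΩ : ∀ (U : Opens X) (ω : L.dual.Sec U), ∃ D : E.Sec U, S.fromΩ.map (Wedge.ι ω) = Wedge.ι D ∧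
    ∀ (V : Opens X) (h : V ≤ U) (ξ : E.dual.Sec V),
      (evalPairing E).pair ξ (E.res h D) = (evalPairing L).pair (L.dual.res h ω) (B.φ'.map ξ)

end LBialg

end

universe w'' w₃

noncomputable section

open TopologicalSpace

namespace LBialg

variable {K : Type u} {X : Type v} [Field K] [TopologicalSpace K] [TopologicalSpace X]
variable {𝒪 : TopRingedSpace K X}

section

/-! ## Local sections, gluing and degrees -/

section Presheaf

variable (P : RingPresheaf.{v, w} X)

/-! The operators in play (bracket with a homogeneous section, contraction, differential, Lie
derivative) are graded derivations of `⋀ E`. A graded derivation is determined by its values on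
functions and on sections of `E` (`WOp.IsDer.ext`). Conversely, values on these generators that
satisfy the Leibniz rules and have the right parity extend to a derivation (`WOp.exists_der`).
Graded commutators of derivations of definite parity are derivations, so identities of Jacobi type
can be checked on generators as well.

Brackets. For a Lie algebroid, `[f, ·]` and `[D, ·]` are prescribed on generators. Graded
antisymmetry then prescribes `[c, ·]` on generators for every `c` of definite parity, and comparison
on generators gives antisymmetry and the Jacobi identity (`br_antisymm`, `br_jacobi`). In the other
direction, the components of a Gerstenhaber bracket in degrees 0 and 1 are an anchor and a Lie
bracket (`exists_isSchouten`). So Gerstenhaber brackets on `⋀ E` and Lie algebroid structures on `E`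
are the same data.

Differentials. Local freeness enters through a perfect pairing of `E` with `F`, that is, through
local dual frames. With `i_ξ` the contraction and `L_ξ = i_ξ δ + δ i_ξ`, the Chevalley-Eilenberg
formula follows from the Cartan formulas `i_ξ δ f = 𝔞(ξ) f` and `[L_ξ, i_η] = i_[ξ,η]` (`IsCartan`).
A Cartan differential exists (`exists_isCartan`), and the Chevalley-Eilenberg formula has at most
one solution, so the two descriptions agree. Conversely, if a derivation `δ` of degree one has
square zero, then `[L_ξ, i_η]` is a derivation of degree `-1` that kills functions, hence a
contraction; this defines a Lie algebroid on `F` (`exists_isCartan_of_sq_eq_zero`).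

Morphisms. The homomorphism to `𝒢_𝓛` is `φ` in degree one. The homomorphism from `Ω_𝓛` is in degree
one the transpose of `φ'`, and it commutes with the differentials exactly when `φ'` respects anchors
and brackets (`anchor_map`, `lie_map`, `map_d`).

These dictionaries give (2), because the bialgebroid condition is the degree-one case of the
derivation property of `diff`. For (3) one needs that this case implies all the others. The defect
of the derivation property is itself a derivation and graded antisymmetric. On a section `D` and a
function `f` it is a section `A` with `A ∧ D' = 0` for all `D'`, which forces `A = 0` wherever the
rank is not one (`defect_eq_zero`). In rank one `⋀²` vanishes and the condition says nothing about
`A`. For (1), one implication is contained in (2). The other holds because zero bracket, zero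
differential and the two augmentations always form a strong differential Gerstenhaber algebra. -/

theorem RingPresheaf.exists_res_eq_of_germ_eq {V W : Opens X} {x : X} (hV : x ∈ V) (hW : x ∈ W)
    (s : P.Sec V) (t : P.Sec W) (h : P.germ x hV s = P.germ x hW t) :
    ∃ (Z : Opens X) (_ : x ∈ Z) (h₁ : Z ≤ V) (h₂ : Z ≤ W), P.res h₁ s = P.res h₂ t := by
  obtain ⟨Z, h₁, h₂, e⟩ := Quotient.exact h
  exact ⟨Z.1, Z.2, h₁, h₂, e⟩

end Presheaf


namespace TopRingedSpace

theorem ext_local {U : Opens X} {f g : 𝒪.Sec U}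
    (h : ∀ x ∈ U, ∃ (V : Opens X) (hV : V ≤ U), x ∈ V ∧ 𝒪.res hV f = 𝒪.res hV g) : f = g := by
  refine Subtype.ext (funext fun x => ?_)
  obtain ⟨V, hV, hx, e⟩ := h x.1 x.2
  exact congrArg (fun k => k.1 ⟨x.1, hx⟩) e

@[simp] theorem res_res {U V W : Opens X} (h : V ≤ U) (h' : W ≤ V) (f : 𝒪.Sec U) :
    𝒪.res h' (𝒪.res h f) = 𝒪.res (h'.trans h) f := rfl

@[simp] theorem res_rfl {U : Opens X} (f : 𝒪.Sec U) : 𝒪.res le_rfl f = f := rfl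

@[simp] theorem res_algebraMap {U V : Opens X} (h : V ≤ U) (c : K) :
    𝒪.res h (algebraMap K (𝒪.Sec U) c) = algebraMap K (𝒪.Sec V) c := rfl

end TopRingedSpace

namespace ModSheaf

variable (E : ModSheaf.{u, v, w} 𝒪)

theorem ext_local {U : Opens X} {s t : E.Sec U}
    (h : ∀ x ∈ U, ∃ (V : Opens X) (hV : V ≤ U), x ∈ V ∧ E.res hV s = E.res hV t) : s = t := by
  let 𝒰 : Set (Opens X) := {V | ∃ hV : V ≤ U, E.res hV s = E.res hV t}
  have h₁ : sSup 𝒰 ≤ U := sSup_le fun V hV => hV.1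
  have h₂ : U ≤ sSup 𝒰 := fun x hx => by
    obtain ⟨V, hV, hxV, e⟩ := h x hx
    exact Opens.mem_sSup.2 ⟨V, ⟨hV, e⟩, hxV⟩
  have key : E.res h₁ s = E.res h₁ t := by
    refine E.separated 𝒰 _ _ fun V => ?_
    rw [E.res_res, E.res_res]
    exact V.2.2
  have := congrArg (E.res h₂) key
  rwa [E.res_res, E.res_res, E.res_id, E.res_id] at this

/-- Gluing along a relation, so that no local section has to be chosen in advance. `compat` for two
sections over the same open set makes them equal, hence the glued section restricts to every related
section and not only to the chosen ones. -/
theorem exists_glue {U : Opens X} (Rel : ∀ V : Opens X, V ≤ U → E.Sec V → Prop)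
    (cover : ∀ x ∈ U, ∃ (V : Opens X) (hV : V ≤ U) (s : E.Sec V), x ∈ V ∧ Rel V hV s)
    (compat : ∀ (V W : Opens X) (hV : V ≤ U) (hW : W ≤ U) (s : E.Sec V) (t : E.Sec W),
      Rel V hV s → Rel W hW t →
      E.res (inf_le_left : V ⊓ W ≤ V) s = E.res (inf_le_right : V ⊓ W ≤ W) t) :
    ∃ s : E.Sec U, ∀ (V : Opens X) (hV : V ≤ U) (t : E.Sec V), Rel V hV t → E.res hV s = t := by
  let 𝒰 : Set (Opens X) := {V | ∃ (hV : V ≤ U) (s : E.Sec V), Rel V hV s}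
  have h₂ : U ≤ sSup 𝒰 := fun x hx => by
    obtain ⟨V, hV, s, hxV, e⟩ := cover x hx
    exact Opens.mem_sSup.2 ⟨V, ⟨hV, s, e⟩, hxV⟩
  have hch : ∀ V : 𝒰, ∃ s : E.Sec V.1, Rel V.1 V.2.1 s := fun V => V.2.2
  choose s hs using hch
  obtain ⟨t, ht⟩ := E.glue 𝒰 s fun V W => compat _ _ _ _ _ _ (hs V) (hs W)
  refine ⟨E.res h₂ t, fun V hV r hr => ?_⟩
  have hVm : V ∈ 𝒰 := ⟨hV, r, hr⟩
  rw [E.res_res]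
  refine (ht ⟨V, hVm⟩).trans ?_
  have := congrArg (E.res (le_inf le_rfl le_rfl : V ≤ V ⊓ V))
    (compat V V hV hV _ _ (hs ⟨V, hVm⟩) hr)
  rwa [E.res_res, E.res_res, E.res_id, E.res_id] at this

end ModSheaf

namespace Wedge

variable {E : ModSheaf.{u, v, w} 𝒪} {U V W : Opens X}

@[simp] theorem res_res (h : V ≤ U) (h' : W ≤ V) (a : Wedge E U) :
    res h' (res h a) = res (h'.trans h) a := rfl

@[simp] theorem res_rfl (a : Wedge E U) : res le_rfl a = a := rfl

theorem res_ofPre (h : V ≤ U) (t : ExtPre E U) :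
    res h (ofPre U t) = ofPre V (ExtPre.res E h t) :=
  Subtype.ext (funext fun y => ((extPresheaf E).germ_res h y.1 y.2 t).symm)

@[simp] theorem res_fn (h : V ≤ U) (f : 𝒪.Sec U) :
    res h (fn f : Wedge E U) = fn (𝒪.res h f) := by
  rw [fn, res_ofPre, ExtPre.res, extMap_algebraMap]; rfl

@[simp] theorem res_ι (h : V ≤ U) (D : E.Sec U) : res h (ι D) = ι (E.res h D) := by
  rw [ι, res_ofPre, ExtPre.res, extMap_ι]; rfl

theorem ext_local {a b : Wedge E U}
    (h : ∀ x ∈ U, ∃ (V : Opens X) (hV : V ≤ U), x ∈ V ∧ res hV a = res hV b) : a = b := by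
  refine Subtype.ext (funext fun x => ?_)
  obtain ⟨V, hV, hx, e⟩ := h x.1 x.2
  exact congrArg (fun k : Wedge E V => k.1 ⟨x.1, hx⟩) e

theorem exists_local (a : Wedge E U) {x : X} (hx : x ∈ U) :
    ∃ (V : Opens X) (h : V ≤ U) (t : ExtPre E V), x ∈ V ∧ res h a = ofPre V t := by
  obtain ⟨V, h, t, hxV, ht⟩ := a.2 ⟨x, hx⟩
  exact ⟨V, h, t, hxV, Subtype.ext (funext ht)⟩

theorem exists_res_eq_of_ofPre_eq {s t : ExtPre E U} (h : ofPre U s = ofPre U t) {x : X}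
    (hx : x ∈ U) : ∃ (V : Opens X) (hV : V ≤ U), x ∈ V ∧ ExtPre.res E hV s = ExtPre.res E hV t := by
  obtain ⟨Z, hxZ, h₁, _, e⟩ := (extPresheaf E).exists_res_eq_of_germ_eq hx hx s t
    (congrArg (fun k : Wedge E U => k.1 ⟨x, hx⟩) h)
  exact ⟨Z, h₁, hxZ, e⟩

/-- Agreement is only required near each point of the overlap: sections are families of germs, and
two presheaf representatives of one section agree only after shrinking. -/
theorem exists_glue (Rel : ∀ V : Opens X, V ≤ U → Wedge E V → Prop)
    (cover : ∀ x ∈ U, ∃ (V : Opens X) (hV : V ≤ U) (s : Wedge E V), x ∈ V ∧ Rel V hV s)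
    (compat : ∀ (V W : Opens X) (hV : V ≤ U) (hW : W ≤ U) (s : Wedge E V) (t : Wedge E W),
      Rel V hV s → Rel W hW t → ∀ x (_ : x ∈ V) (_ : x ∈ W), ∃ (Z : Opens X) (h₁ : Z ≤ V)
        (h₂ : Z ≤ W), x ∈ Z ∧ res h₁ s = res h₂ t) :
    ∃ s : Wedge E U, ∀ (V : Opens X) (hV : V ≤ U) (t : Wedge E V), Rel V hV t → res hV s = t := by
  choose C hC s hxC hs using cover
  have indep : ∀ (V : Opens X) (hV : V ≤ U) (t : Wedge E V), Rel V hV t → ∀ y : V,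
      (s y.1 (hV y.2)).1 ⟨y.1, hxC y.1 (hV y.2)⟩ = t.1 y := by
    intro V hV t ht y
    obtain ⟨Z, h₁, h₂, hy, e⟩ := compat _ _ _ _ _ _ (hs y.1 (hV y.2)) ht y.1
      (hxC y.1 (hV y.2)) y.2
    exact congrArg (fun k : Wedge E Z => k.1 ⟨y.1, hy⟩) e
  refine ⟨⟨fun x => (s x.1 x.2).1 ⟨x.1, hxC x.1 x.2⟩, fun x => ?_⟩, fun V hV t ht =>
    Subtype.ext (funext fun y => indep V hV t ht y)⟩
  obtain ⟨V, hV, t, hxV, ht⟩ := (s x.1 x.2).2 ⟨x.1, hxC x.1 x.2⟩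
  exact ⟨V, hV.trans (hC _ _), t, hxV, fun y =>
    (indep _ _ _ (hs x.1 x.2) ⟨y.1, hV y.2⟩).trans (ht y)⟩

/-! ### Structure maps -/

variable (E U) in
/-- `fn` as a ring homomorphism. -/
def fnHom : 𝒪.Sec U →+* Wedge E U := (ofPre U).comp (algebraMap (𝒪.Sec U) (ExtPre E U))

theorem fnHom_apply (f : 𝒪.Sec U) : fnHom E U f = fn f := rfl

@[simp] theorem fn_zero : (fn 0 : Wedge E U) = 0 := map_zero (fnHom E U)
@[simp] theorem fn_one : (fn 1 : Wedge E U) = 1 := map_one (fnHom E U)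
theorem fn_add (f g : 𝒪.Sec U) : (fn (f + g) : Wedge E U) = fn f + fn g := map_add (fnHom E U) _ _
theorem fn_sub (f g : 𝒪.Sec U) : (fn (f - g) : Wedge E U) = fn f - fn g := map_sub (fnHom E U) _ _
theorem fn_neg (f : 𝒪.Sec U) : (fn (-f) : Wedge E U) = -fn f := map_neg (fnHom E U) _
theorem fn_mul (f g : 𝒪.Sec U) : (fn (f * g) : Wedge E U) = fn f * fn g := map_mul (fnHom E U) _ _
theorem fn_sum {n : ℕ} (f : Fin n → 𝒪.Sec U) : (fn (∑ i, f i) : Wedge E U) = ∑ i, fn (f i) :=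
  map_sum (fnHom E U) _ _

@[simp] theorem ι_zero : (ι 0 : Wedge E U) = 0 := by rw [ι, map_zero, map_zero]
theorem ι_add (D D' : E.Sec U) : ι (D + D') = ι D + ι D' := by rw [ι, map_add, map_add]; rfl
theorem ι_sub (D D' : E.Sec U) : ι (D - D') = ι D - ι D' := by rw [ι, map_sub, map_sub]; rfl
theorem ι_neg (D : E.Sec U) : ι (-D) = -ι D := by rw [ι, map_neg, map_neg]; rfl
theorem ι_smul (f : 𝒪.Sec U) (D : E.Sec U) : ι (f • D) = fn f * ι D := by
  rw [ι, map_smul, Algebra.smul_def, map_mul]; rfl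

variable (E U) in
/-- `ι` as an additive homomorphism. -/
def ιHom : E.Sec U →+ Wedge E U := ⟨⟨ι, ι_zero⟩, ι_add⟩

theorem ι_sum {n : ℕ} (D : Fin n → E.Sec U) : ι (∑ i, D i) = ∑ i, ι (D i) :=
  map_sum (ιHom E U) _ _

theorem ι_mul_self (D : E.Sec U) : ι D * ι D = 0 := by
  rw [ι, ← map_mul, ExteriorAlgebra.ι_sq_zero, map_zero]

theorem ι_mul_swap (D D' : E.Sec U) : ι D * ι D' = -(ι D' * ι D) := by
  have := congrArg (ofPre U) (ExteriorAlgebra.ι_add_mul_swap (R := 𝒪.Sec U) D D')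
  rw [map_add, map_mul, map_mul, map_zero] at this
  exact eq_neg_of_add_eq_zero_left this

theorem fn_comm (f : 𝒪.Sec U) (a : Wedge E U) : a * fn f = fn f * a := by
  refine ext_local fun x hx => ?_
  obtain ⟨V, h, t, hxV, ht⟩ := exists_local a hx
  refine ⟨V, h, hxV, ?_⟩
  rw [map_mul, map_mul, ht, res_fn, fn, ← map_mul, ← map_mul, Algebra.commutes]

theorem fn_left_comm (f : 𝒪.Sec U) (a b : Wedge E U) : a * (fn f * b) = fn f * (a * b) := by
  rw [← mul_assoc, fn_comm, mul_assoc]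

/-- Lets identities between functions be proved inside `⋀ E`; `ι_injective` does the same for
sections of `E`. -/
theorem fn_injective : Function.Injective (fn : 𝒪.Sec U → Wedge E U) := by
  intro f g h
  refine TopRingedSpace.ext_local fun x hx => ?_
  obtain ⟨V, hV, hxV, e⟩ := exists_res_eq_of_ofPre_eq h hx
  rw [ExtPre.res, extMap_algebraMap, extMap_algebraMap] at e
  exact ⟨V, hV, hxV, (ExteriorAlgebra.algebraMap_inj _ _ _).1 e⟩

theorem ι_injective : Function.Injective (ι : E.Sec U → Wedge E U) := by
  intro f g h
  refine E.ext_local fun x hx => ?_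
  obtain ⟨V, hV, hxV, e⟩ := exists_res_eq_of_ofPre_eq h hx
  rw [ExtPre.res, extMap_ι, extMap_ι] at e
  exact ⟨V, hV, hxV, (ExteriorAlgebra.ι_inj _ _ _).1 e⟩

/-! ### Degrees -/

theorem hasDegree_iff {i : ℕ} {a : Wedge E U} : a.HasDegree i ↔ ∀ x ∈ U, ∃ (V : Opens X)
    (h : V ≤ U) (t : ExtPre E V), x ∈ V ∧ t ∈ ⋀[𝒪.Sec V]^i (E.Sec V) ∧ res h a = ofPre V t :=
  ⟨fun H x hx => by
    obtain ⟨V, h, t, hxV, ht, e⟩ := H ⟨x, hx⟩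
    exact ⟨V, h, t, hxV, ht, Subtype.ext (funext e)⟩, fun H x => by
    obtain ⟨V, h, t, hxV, ht, e⟩ := H x.1 x.2
    exact ⟨V, h, t, hxV, ht, fun y => congrArg (fun k : Wedge E V => k.1 y) e⟩⟩

theorem res_mem_extPower {i : ℕ} (h : V ≤ U) {t : ExtPre E U} (ht : t ∈ ⋀[𝒪.Sec U]^i (E.Sec U)) :
    ExtPre.res E h t ∈ ⋀[𝒪.Sec V]^i (E.Sec V) := by
  induction ht using Submodule.pow_induction_on_left' with
  | algebraMap r => rw [ExtPre.res, extMap_algebraMap, ExteriorAlgebra.exteriorPower, pow_zero]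
                    exact Submodule.algebraMap_mem _
  | add x y i hx hy ihx ihy => rw [map_add]; exact add_mem ihx ihy
  | mem_mul m hm i x hx ih =>
    obtain ⟨D, rfl⟩ := hm
    rw [map_mul, ExteriorAlgebra.exteriorPower, pow_succ', ExtPre.res, extMap_ι]
    exact Submodule.mul_mem_mul ⟨_, rfl⟩ ih

theorem hasDegree_ofPre {i : ℕ} {t : ExtPre E U} (ht : t ∈ ⋀[𝒪.Sec U]^i (E.Sec U)) :
    (ofPre U t).HasDegree i :=
  hasDegree_iff.2 fun _ hx => ⟨U, le_rfl, t, hx, ht, rfl⟩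

theorem HasDegree.res {i : ℕ} {a : Wedge E U} (ha : a.HasDegree i) (h : V ≤ U) :
    (res h a).HasDegree i := by
  rw [hasDegree_iff] at ha ⊢
  intro x hx
  obtain ⟨W, hW, t, hxW, ht, e⟩ := ha x (h hx)
  refine ⟨V ⊓ W, inf_le_left, ExtPre.res E inf_le_right t, ⟨hx, hxW⟩, res_mem_extPower _ ht, ?_⟩
  rw [← res_ofPre, ← e]; rfl

theorem hasDegree_local {i : ℕ} {a : Wedge E U} (H : ∀ x ∈ U, ∃ (V : Opens X) (h : V ≤ U),
    x ∈ V ∧ (Wedge.res h a).HasDegree i) : a.HasDegree i := by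
  rw [hasDegree_iff]
  intro x hx
  obtain ⟨V, h, hxV, hd⟩ := H x hx
  obtain ⟨W, hW, t, hxW, ht, e⟩ := hasDegree_iff.1 hd x hxV
  exact ⟨W, hW.trans h, t, hxW, ht, e⟩

theorem HasDegree.exists_local₂ {i j : ℕ} {a b : Wedge E U} (ha : a.HasDegree i)
    (hb : b.HasDegree j) {x : X} (hx : x ∈ U) : ∃ (V : Opens X) (h : V ≤ U) (s t : ExtPre E V),
    x ∈ V ∧ s ∈ ⋀[𝒪.Sec V]^i (E.Sec V) ∧ t ∈ ⋀[𝒪.Sec V]^j (E.Sec V) ∧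
    Wedge.res h a = ofPre V s ∧ Wedge.res h b = ofPre V t := by
  obtain ⟨V, h, s, hxV, hs, e⟩ := hasDegree_iff.1 ha x hx
  obtain ⟨W, h', t, hxW, ht, e'⟩ := hasDegree_iff.1 hb x hx
  refine ⟨V ⊓ W, inf_le_left.trans h, ExtPre.res E inf_le_left s, ExtPre.res E inf_le_right t,
    ⟨hxV, hxW⟩, res_mem_extPower _ hs, res_mem_extPower _ ht, ?_, ?_⟩
  · rw [← res_ofPre, ← e]; rfl
  · rw [← res_ofPre, ← e']; rfl

theorem HasDegree.add {i : ℕ} {a b : Wedge E U} (ha : a.HasDegree i) (hb : b.HasDegree i) :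
    (a + b).HasDegree i := by
  rw [hasDegree_iff]
  intro x hx
  obtain ⟨V, h, s, t, hxV, hs, ht, e, e'⟩ := ha.exists_local₂ hb hx
  exact ⟨V, h, s + t, hxV, add_mem hs ht, by rw [map_add, e, e', map_add]⟩

theorem HasDegree.mul {i j : ℕ} {a b : Wedge E U} (ha : a.HasDegree i) (hb : b.HasDegree j) :
    (a * b).HasDegree (i + j) := by
  rw [hasDegree_iff]
  intro x hx
  obtain ⟨V, h, s, t, hxV, hs, ht, e, e'⟩ := ha.exists_local₂ hb hx
  refine ⟨V, h, s * t, hxV, ?_, by rw [map_mul, e, e', map_mul]⟩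
  rw [ExteriorAlgebra.exteriorPower, pow_add]
  exact Submodule.mul_mem_mul hs ht

theorem hasDegree_zero (i : ℕ) : (0 : Wedge E U).HasDegree i := by
  rw [← map_zero (ofPre U)]
  exact hasDegree_ofPre (zero_mem _)

theorem hasDegree_fn (f : 𝒪.Sec U) : (fn f : Wedge E U).HasDegree 0 := by
  refine hasDegree_ofPre ?_
  rw [ExteriorAlgebra.exteriorPower, pow_zero]
  exact Submodule.algebraMap_mem _

theorem hasDegree_ι (D : E.Sec U) : (ι D).HasDegree 1 := by
  refine hasDegree_ofPre ?_
  rw [ExteriorAlgebra.exteriorPower, pow_one]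
  exact ⟨D, rfl⟩

theorem HasDegree.neg {i : ℕ} {a : Wedge E U} (ha : a.HasDegree i) : (-a).HasDegree i := by
  have := (hasDegree_fn (E := E) (-1 : 𝒪.Sec U)).mul ha
  rwa [fn_neg, fn_one, neg_one_mul, zero_add] at this

theorem HasDegree.sub {i : ℕ} {a b : Wedge E U} (ha : a.HasDegree i) (hb : b.HasDegree i) :
    (a - b).HasDegree i := sub_eq_add_neg a b ▸ ha.add hb.neg

theorem HasDegree.units_smul {i : ℕ} {a : Wedge E U} (ha : a.HasDegree i) (e : ℤˣ) :
    (e • a).HasDegree i := by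
  rcases Int.units_eq_one_or e with rfl | rfl
  · rwa [one_smul]
  · simpa [Units.smul_def] using ha.neg

theorem HasDegree.sum {i n : ℕ} {a : Fin n → Wedge E U} (ha : ∀ j, (a j).HasDegree i) :
    (∑ j, a j).HasDegree i :=
  Finset.sum_induction a (fun b => b.HasDegree i) (fun _ _ => HasDegree.add) (hasDegree_zero i)
    fun j _ => ha j

theorem HasDegree.fn_mul {i : ℕ} {a : Wedge E U} (ha : a.HasDegree i) (f : 𝒪.Sec U) :
    (fn f * a).HasDegree i := by simpa using (hasDegree_fn (E := E) f).mul ha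

/-- Induction on homogeneous sections of `⋀ E`. -/
theorem hom_induction {U : Opens X} {p : ∀ V : Opens X, V ≤ U → ℕ → Wedge E V → Prop}
    (loc : ∀ (V : Opens X) (hV : V ≤ U) (i : ℕ) (a : Wedge E V), a.HasDegree i →
      (∀ x ∈ V, ∃ (W : Opens X) (hW : W ≤ V), x ∈ W ∧ p W (hW.trans hV) i (Wedge.res hW a)) →
        p V hV i a)
    (hfn : ∀ (V : Opens X) (hV : V ≤ U) (f : 𝒪.Sec V), p V hV 0 (fn f))
    (hadd : ∀ (V : Opens X) (hV : V ≤ U) (i : ℕ) (a b : Wedge E V), a.HasDegree i →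
      b.HasDegree i → p V hV i a → p V hV i b → p V hV i (a + b))
    (hmul : ∀ (V : Opens X) (hV : V ≤ U) (i : ℕ) (D : E.Sec V) (a : Wedge E V), a.HasDegree i →
      p V hV i a → p V hV (i + 1) (ι D * a))
    (V : Opens X) (hV : V ≤ U) (i : ℕ) (a : Wedge E V) (ha : a.HasDegree i) : p V hV i a := by
  refine loc V hV i a ha fun x hx => ?_
  obtain ⟨W, hW, t, hxW, ht, e⟩ := hasDegree_iff.1 ha x hx
  refine ⟨W, hW, hxW, ?_⟩
  rw [e]
  generalize_proofs hWU
  clear e hxW ha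
  induction ht using Submodule.pow_induction_on_left' with
  | algebraMap r => exact hfn W _ r
  | add x y i hx hy ihx ihy =>
    rw [map_add]
    exact hadd W _ i _ _ (hasDegree_ofPre hx) (hasDegree_ofPre hy) ihx ihy
  | mem_mul m hm i x hx ih =>
    obtain ⟨D, rfl⟩ := hm
    rw [map_mul]
    exact hmul W _ i D _ (hasDegree_ofPre hx) ih

/-- Locally the section is a function; by `fn_injective` these functions agree on overlaps, and `𝒪`
is a sheaf. In degree one the same argument uses that `E` is a sheaf. -/
theorem HasDegree.exists_fn {a : Wedge E U} (ha : a.HasDegree 0) : ∃ f : 𝒪.Sec U, a = fn f := by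
  have key : ∀ x ∈ U, ∃ (V : Opens X) (_ : V ≤ U) (f : 𝒪.Sec V), x ∈ V ∧
      Wedge.res ‹V ≤ U› a = fn f := by
    intro x hx
    obtain ⟨V, hV, t, hxV, ht, e⟩ := hasDegree_iff.1 ha x hx
    rw [ExteriorAlgebra.exteriorPower, pow_zero] at ht
    obtain ⟨f, rfl⟩ := Submodule.mem_one.1 ht
    exact ⟨V, hV, f, hxV, e⟩
  choose C hC f hxC hf using key
  have indep : ∀ (x y : X) (hx : x ∈ U) (hy : y ∈ U) (z : X) (h₁ : z ∈ C x hx) (h₂ : z ∈ C y hy),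
      (f x hx).1 ⟨z, h₁⟩ = (f y hy).1 ⟨z, h₂⟩ := by
    intro x y hx hy z h₁ h₂
    have e₁ := congrArg (Wedge.res (inf_le_left : C x hx ⊓ C y hy ≤ _)) (hf x hx)
    have e₂ := congrArg (Wedge.res (inf_le_right : C x hx ⊓ C y hy ≤ _)) (hf y hy)
    rw [res_fn, res_res] at e₁ e₂
    exact congrArg (fun k => k.1 ⟨z, h₁, h₂⟩) (fn_injective (e₁.symm.trans e₂))
  refine ⟨⟨fun x => (f x.1 x.2).1 ⟨x.1, hxC x.1 x.2⟩, 𝒪.local_mem U _ fun x =>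
    ⟨C x.1 x.2, hxC _ _, hC _ _, ?_⟩⟩, ext_local fun x hx => ⟨C x hx, hC x hx, hxC x hx, ?_⟩⟩
  · have : (fun y : C x.1 x.2 => (f y.1 (hC _ _ y.2)).1 ⟨y.1, hxC _ _⟩) = (f x.1 x.2).1 :=
      funext fun y => indep _ _ _ _ _ _ _
    exact this ▸ Subtype.property _
  · refine (hf x hx).trans ((congrArg fn ?_).trans (res_fn _ _).symm)
    exact Subtype.ext (funext fun y => indep _ _ _ _ _ _ _)

theorem HasDegree.exists_ι {a : Wedge E U} (ha : a.HasDegree 1) : ∃ D : E.Sec U, a = ι D := by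
  obtain ⟨D, hD⟩ := E.exists_glue (U := U) (fun V hV s => Wedge.res hV a = ι s) (fun x hx => by
    obtain ⟨V, hV, t, hxV, ht, e⟩ := hasDegree_iff.1 ha x hx
    rw [ExteriorAlgebra.exteriorPower, pow_one] at ht
    obtain ⟨D, rfl⟩ := ht
    exact ⟨V, hV, D, hxV, e⟩) (fun V W hV hW s t hs ht => by
    refine ι_injective ?_
    rw [← res_ι, ← res_ι, ← hs, ← ht]; rfl)
  refine ⟨D, ext_local fun x hx => ?_⟩
  obtain ⟨V, hV, t, hxV, ht, e⟩ := hasDegree_iff.1 ha x hx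
  rw [ExteriorAlgebra.exteriorPower, pow_one] at ht
  obtain ⟨D', rfl⟩ := ht
  exact ⟨V, hV, hxV, by rw [res_ι, hD V hV D' e]; exact e⟩

end Wedge

end

section

/-! ## Semilinear lifts from the exterior algebra -/

/-- The universal property of the exterior algebra needs a target in which `R` is central, and `T`
need not be one. The images of `σ` and `g` lie in the centralizer of `σ(R)`, which is an
`R`-algebra. This generality is used below for triangular matrices over `⋀ E`. -/
theorem exists_extLift {R M T : Type*} [CommRing R] [AddCommGroup M] [Module R M] [Ring T]
    (σ : R →+* T) (g : M →+ T) (hsmul : ∀ r m, g (r • m) = σ r * g m)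
    (hcomm : ∀ r m, σ r * g m = g m * σ r) (hsq : ∀ m, g m * g m = 0) :
    ∃ Φ : ExteriorAlgebra R M →+* T, (∀ r, Φ (algebraMap R _ r) = σ r) ∧
      ∀ m, Φ (ExteriorAlgebra.ι R m) = g m := by
  let T' : Subring T := Subring.centralizer (Set.range σ)
  have hσ : ∀ r, σ r ∈ T' := by
    intro r
    rw [Subring.mem_centralizer_iff]
    rintro _ ⟨s, rfl⟩
    rw [← map_mul, mul_comm, map_mul]
  have hg : ∀ m, g m ∈ T' := by
    intro m
    rw [Subring.mem_centralizer_iff]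
    rintro _ ⟨s, rfl⟩
    exact hcomm s m
  let σ' : R →+* T' := σ.codRestrict T' hσ
  let : Algebra R T' := σ'.toAlgebra' fun r x => Subtype.ext
    (Subring.mem_centralizer_iff.1 x.2 _ ⟨r, rfl⟩)
  let g' : M →ₗ[R] T' :=
    { toFun := fun m => ⟨g m, hg m⟩
      map_add' := fun a b => Subtype.ext (map_add g a b)
      map_smul' := fun r m => Subtype.ext (hsmul r m) }
  let Φ := ExteriorAlgebra.lift R (A := T') ⟨g', fun m => Subtype.ext (hsq m)⟩
  refine ⟨T'.subtype.comp Φ.toRingHom, fun r => ?_, fun m => ?_⟩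
  · exact congrArg Subtype.val (Φ.commutes r)
  · exact congrArg Subtype.val (ExteriorAlgebra.lift_ι_apply R (A := T') g' _ m)


/-! ## Operators between exterior algebra sheaves -/

/-- Additive morphisms of sheaves `(⋀ E)|U → (⋀ G)|U`. -/
@[ext] structure WOp (E : ModSheaf.{u, v, w} 𝒪) (G : ModSheaf.{u, v, w'} 𝒪) (U : Opens X) where
  app : ∀ V : Opens X, V ≤ U → (Wedge E V →+ Wedge G V)
  nat : ∀ (V W : Opens X) (hV : V ≤ U) (hW : W ≤ V) (a : Wedge E V),
    Wedge.res hW (app V hV a) = app W (hW.trans hV) (Wedge.res hW a)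

namespace WOp

variable {E : ModSheaf.{u, v, w} 𝒪} {G : ModSheaf.{u, v, w'} 𝒪} {H : ModSheaf.{u, v, w''} 𝒪}
  {U V W : Opens X}

instance : Zero (WOp E G U) := ⟨⟨fun _ _ => 0, by intros; simp⟩⟩
instance : Add (WOp E G U) :=
  ⟨fun S T => ⟨fun V h => S.app V h + T.app V h, by intros; simp [S.nat, T.nat]⟩⟩
instance : Neg (WOp E G U) :=
  ⟨fun S => ⟨fun V h => -S.app V h, by intros; simp [S.nat]⟩⟩
instance : Sub (WOp E G U) :=
  ⟨fun S T => ⟨fun V h => S.app V h - T.app V h, by intros; simp [S.nat, T.nat]⟩⟩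

@[simp] theorem zero_app (V : Opens X) (h : V ≤ U) (a : Wedge E V) :
    (0 : WOp E G U).app V h a = 0 := rfl
@[simp] theorem add_app (S T : WOp E G U) (V : Opens X) (h : V ≤ U) (a : Wedge E V) :
    (S + T).app V h a = S.app V h a + T.app V h a := rfl
@[simp] theorem neg_app (S : WOp E G U) (V : Opens X) (h : V ≤ U) (a : Wedge E V) :
    (-S).app V h a = -S.app V h a := rfl

theorem ext_app {S T : WOp E G U}
    (h : ∀ (V : Opens X) (hV : V ≤ U) (a : Wedge E V), S.app V hV a = T.app V hV a) : S = T := by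
  ext1
  funext V hV
  exact AddMonoidHom.ext (h V hV)

instance : AddCommGroup (WOp E G U) where
  add_assoc a b c := ext_app fun V h x => by simp [add_assoc]
  zero_add a := ext_app fun V h x => by simp
  add_zero a := ext_app fun V h x => by simp
  nsmul := nsmulRec
  zsmul := zsmulRec
  neg_add_cancel a := ext_app fun V h x => by simp
  sub_eq_add_neg a b := ext_app fun V h x => sub_eq_add_neg (a.app V h x) (b.app V h x)
  add_comm a b := ext_app fun V h x => by simp [add_comm]

@[simp] theorem sub_app (S T : WOp E G U) (V : Opens X) (h : V ≤ U) (a : Wedge E V) :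
    (S - T).app V h a = S.app V h a - T.app V h a := rfl

/-- Composition. -/
def comp (S : WOp G H U) (T : WOp E G U) : WOp E H U where
  app V h := (S.app V h).comp (T.app V h)
  nat V W hV hW a := by simp [S.nat, T.nat]

@[simp] theorem comp_app (S : WOp G H U) (T : WOp E G U) (V : Opens X) (h : V ≤ U)
    (a : Wedge E V) : (S.comp T).app V h a = S.app V h (T.app V h a) := rfl

instance : Mul (WOp E E U) := ⟨comp⟩
instance : One (WOp E E U) := ⟨⟨fun _ _ => AddMonoidHom.id _, by intros; rfl⟩⟩

@[simp] theorem mul_app (S T : WOp E E U) (V : Opens X) (h : V ≤ U)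
    (a : Wedge E V) : (S * T).app V h a = S.app V h (T.app V h a) := rfl
@[simp] theorem one_app (V : Opens X) (h : V ≤ U) (a : Wedge E V) :
    (1 : WOp E E U).app V h a = a := rfl

instance : Ring (WOp E E U) :=
  { (inferInstance : AddCommGroup (WOp E E U)) with
    mul_assoc := fun _ _ _ => rfl
    one_mul := fun _ => rfl
    mul_one := fun _ => rfl
    left_distrib := fun a b c => ext_app fun V h x => by simp
    right_distrib := fun a b c => ext_app fun V h x => by simp
    zero_mul := fun a => ext_app fun V h x => by simp
    mul_zero := fun a => ext_app fun V h x => by simp }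

/-- Restriction to a smaller open set. -/
def restr (T : WOp E G U) (h : V ≤ U) : WOp E G V :=
  ⟨fun W hW => T.app W (hW.trans h), fun W W' _ hW' a => T.nat W W' _ hW' a⟩

@[simp] theorem restr_app (T : WOp E G U) (h : V ≤ U) (W : Opens X) (hW : W ≤ V)
    (a : Wedge E W) : (T.restr h).app W hW a = T.app W (hW.trans h) a := rfl

/-- Left multiplication. -/
def lmul (x : Wedge E U) : WOp E E U :=
  ⟨fun _ h => AddMonoidHom.mulLeft (Wedge.res h x), fun V W hV hW a => by
    simp⟩

/-- Right multiplication. -/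
def rmul (x : Wedge E U) : WOp E E U :=
  ⟨fun _ h => AddMonoidHom.mulRight (Wedge.res h x), fun V W hV hW a => by
    simp⟩

@[simp] theorem lmul_app (x : Wedge E U) (V : Opens X) (h : V ≤ U) (a : Wedge E V) :
    (lmul x).app V h a = Wedge.res h x * a := rfl
@[simp] theorem rmul_app (x : Wedge E U) (V : Opens X) (h : V ≤ U) (a : Wedge E V) :
    (rmul x).app V h a = a * Wedge.res h x := rfl

theorem ext_pre {S T : WOp E G U} (h : ∀ (V : Opens X) (hV : V ≤ U) (t : ExtPre E V),
    S.app V hV (Wedge.ofPre V t) = T.app V hV (Wedge.ofPre V t)) : S = T := by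
  refine ext_app fun V hV a => Wedge.ext_local fun x hx => ?_
  obtain ⟨W, hW, t, hxW, e⟩ := a.exists_local hx
  exact ⟨W, hW, hxW, by rw [S.nat, T.nat, e, h]⟩

/-- Two operators agree if they agree on functions and if equality on `a` implies equality on
`D ∧ a`. -/
theorem ext_gen {S T : WOp E G U}
    (h₀ : ∀ (V : Opens X) (hV : V ≤ U) (f : 𝒪.Sec V),
      S.app V hV (Wedge.fn f) = T.app V hV (Wedge.fn f))
    (h₁ : ∀ (V : Opens X) (hV : V ≤ U) (D : E.Sec V) (a : Wedge E V),
      S.app V hV a = T.app V hV a → S.app V hV (Wedge.ι D * a) = T.app V hV (Wedge.ι D * a)) :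
    S = T := by
  refine ext_pre fun V hV t => ?_
  induction t using CliffordAlgebra.left_induction with
  | algebraMap r => exact h₀ V hV r
  | add x y hx hy => rw [map_add, map_add, map_add, hx, hy]
  | ι_mul x m hx => rw [map_mul]; exact h₁ V hV m _ hx

/-- Two operators agree if they agree on homogeneous sections. -/
theorem ext_hom {S T : WOp E G U}
    (h : ∀ (V : Opens X) (hV : V ≤ U) (i : ℕ) (a : Wedge E V), a.HasDegree i →
      S.app V hV a = T.app V hV a) : S = T := by
  refine ext_pre fun V hV t => ?_
  induction t using DirectSum.Decomposition.inductionOn (fun n => ⋀[𝒪.Sec V]^n (E.Sec V)) with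
  | zero => simp
  | homogeneous m => exact h V hV _ _ (Wedge.hasDegree_ofPre m.2)
  | add m m' hm hm' => rw [map_add, map_add, map_add, hm, hm']

/-- Universal property of sheafification for additive maps, the source being the exterior algebra
presheaf. -/
theorem exists_of_pre (h : ∀ V : Opens X, V ≤ U → (ExtPre E V →+ Wedge G V))
    (nat : ∀ (V W : Opens X) (hV : V ≤ U) (hW : W ≤ V) (t : ExtPre E V),
      Wedge.res hW (h V hV t) = h W (hW.trans hV) (ExtPre.res E hW t)) :
    ∃ T : WOp E G U, ∀ (V : Opens X) (hV : V ≤ U) (t : ExtPre E V),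
      T.app V hV (Wedge.ofPre V t) = h V hV t := by
  -- The value on `a` is characterised by all local representatives of `a` at once; additivity and
  -- naturality then follow whichever representatives are used.
  have key : ∀ (V : Opens X) (hV : V ≤ U) (a : Wedge E V), ∃ b : Wedge G V,
      ∀ (W : Opens X) (hW : W ≤ V) (t : ExtPre E W), Wedge.res hW a = Wedge.ofPre W t →
        Wedge.res hW b = h W (hW.trans hV) t := by
    intro V hV a
    obtain ⟨b, hb⟩ := Wedge.exists_glue (E := G) (U := V)
      (fun W hW s => ∃ t : ExtPre E W, Wedge.res hW a = Wedge.ofPre W t ∧ s = h W (hW.trans hV) t)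
      (fun x hx => by
        obtain ⟨W, hW, t, hxW, e⟩ := a.exists_local hx
        exact ⟨W, hW, _, hxW, t, e, rfl⟩)
      (by
        rintro W W' hW hW' _ _ ⟨t, ht, rfl⟩ ⟨t', ht', rfl⟩ x hx hx'
        have e : Wedge.ofPre (W ⊓ W') (ExtPre.res E inf_le_left t) =
            Wedge.ofPre (W ⊓ W') (ExtPre.res E inf_le_right t') := by
          rw [← Wedge.res_ofPre, ← Wedge.res_ofPre, ← ht, ← ht']; rfl
        obtain ⟨Z, hZ, hxZ, e'⟩ := Wedge.exists_res_eq_of_ofPre_eq e ⟨hx, hx'⟩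
        refine ⟨Z, hZ.trans inf_le_left, hZ.trans inf_le_right, hxZ, ?_⟩
        rw [ExtPre.res_res, ExtPre.res_res] at e'
        rw [nat, nat, e'])
    exact ⟨b, fun W hW t ht => hb W hW _ ⟨t, ht, rfl⟩⟩
  choose F hF using key
  refine ⟨⟨fun V hV => ⟨⟨F V hV, ?_⟩, ?_⟩, ?_⟩, fun V hV t => hF V hV _ V le_rfl t rfl⟩
  · refine Wedge.ext_local fun x hx => ⟨V, le_rfl, hx, ?_⟩
    rw [hF V hV 0 V le_rfl 0 (by simp), map_zero, map_zero]
  · intro a b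
    refine Wedge.ext_local fun x hx => ?_
    obtain ⟨W, hW, t, hxW, e⟩ := a.exists_local hx
    obtain ⟨W', hW', t', hxW', e'⟩ := b.exists_local hx
    have e₁ : Wedge.res (inf_le_left.trans hW : W ⊓ W' ≤ V) a =
      Wedge.ofPre _ (ExtPre.res E inf_le_left t) := by rw [← Wedge.res_ofPre, ← e]; rfl
    have e₂ : Wedge.res (inf_le_left.trans hW : W ⊓ W' ≤ V) b =
      Wedge.ofPre _ (ExtPre.res E inf_le_right t') := by rw [← Wedge.res_ofPre, ← e']; rfl
    refine ⟨W ⊓ W', inf_le_left.trans hW, ⟨hxW, hxW'⟩, ?_⟩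
    change Wedge.res _ (F V hV (a + b)) = Wedge.res _ (F V hV a + F V hV b)
    rw [map_add, hF V hV _ _ _ _ e₁, hF V hV _ _ _ _ e₂,
      hF V hV _ _ _ _ (by rw [map_add, e₁, e₂, ← map_add]), map_add]
  · intro V W hV hW a
    change Wedge.res hW (F V hV a) = F W (hW.trans hV) (Wedge.res hW a)
    refine Wedge.ext_local fun x hx => ?_
    obtain ⟨Z, hZ, t, hxZ, e⟩ := (Wedge.res hW a).exists_local hx
    refine ⟨Z, hZ, hxZ, ?_⟩
    rw [hF W _ _ Z hZ t e]
    exact hF V hV a Z (hZ.trans hW) t e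

end WOp

/-- The operator defined by a homomorphism of graded algebras. -/
def GradedAlgHom.toWOp {E : ModSheaf.{u, v, w} 𝒪} {G : ModSheaf.{u, v, w'} 𝒪}
    (Φ : GradedAlgHom E G) (U : Opens X) : WOp E G U :=
  ⟨fun _ _ => Φ.map.toAddMonoidHom, fun _ _ _ hW a => Φ.map_res hW a⟩

@[simp] theorem GradedAlgHom.toWOp_app {E : ModSheaf.{u, v, w} 𝒪} {G : ModSheaf.{u, v, w'} 𝒪}
    (Φ : GradedAlgHom E G) (U V : Opens X) (hV : V ≤ U) (a : Wedge E V) :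
    (Φ.toWOp U).app V hV a = Φ.map a := rfl

/-- The operator over `U` defined by an endomorphism of degree one. -/
def DegOneOp.toWOp {E : ModSheaf.{u, v, w} 𝒪} (δ : DegOneOp E) (U : Opens X) : WOp E E U :=
  ⟨fun _ _ => AddMonoidHom.mk' δ.d δ.d_add, fun _ _ _ hW a => δ.d_res hW a⟩

@[simp] theorem DegOneOp.toWOp_app {E : ModSheaf.{u, v, w} 𝒪} (δ : DegOneOp E)
    (U V : Opens X) (hV : V ≤ U) (a : Wedge E V) : (δ.toWOp U).app V hV a = δ.d a := rfl

/-! ## The exterior algebra functor -/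

section Functor

variable {E : ModSheaf.{u, v, w} 𝒪} {G : ModSheaf.{u, v, w'} 𝒪}

theorem GradedAlgHom.ext_ι {Φ Ψ : GradedAlgHom E G}
    (h : ∀ (U : Opens X) (D : E.Sec U), Φ.map (Wedge.ι D) = Ψ.map (Wedge.ι D)) : Φ = Ψ := by
  have : Φ.toWOp ⊤ = Ψ.toWOp ⊤ := WOp.ext_gen (fun V hV f => by simp [Φ.map_fn, Ψ.map_fn])
    fun V hV D a e => by
      simp only [GradedAlgHom.toWOp_app] at e ⊢
      rw [map_mul, map_mul, e, h]
  refine GradedAlgHom.ext ?_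
  funext U
  exact RingHom.ext fun a => congrArg (fun T : WOp E G ⊤ => T.app U le_top a) this

/-- A morphism of sheaves of modules extends to the exterior algebra sheaves. -/
theorem exists_gradedAlgHom (φ : ∀ {U : Opens X}, E.Sec U →ₗ[𝒪.Sec U] G.Sec U)
    (hφ : ∀ {U V : Opens X} (h : V ≤ U) (D : E.Sec U), G.res h (φ D) = φ (E.res h D)) :
    ∃ Φ : GradedAlgHom E G, ∀ (U : Opens X) (D : E.Sec U),
      Φ.map (Wedge.ι D) = Wedge.ι (φ D) := by
  have key : ∀ V : Opens X, ∃ Φ : ExtPre E V →+* Wedge G V,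
      (∀ r, Φ (algebraMap _ _ r) = Wedge.fn r) ∧
        ∀ m, Φ (ExteriorAlgebra.ι _ m) = Wedge.ι (φ m) := fun V =>
    exists_extLift (Wedge.fnHom G V) ((Wedge.ιHom G V).comp φ.toAddMonoidHom)
      (fun r m => by
        change Wedge.ι (φ (r • m)) = Wedge.fn r * Wedge.ι (φ m)
        rw [map_smul, Wedge.ι_smul])
      (fun r m => (Wedge.fn_comm r _).symm) (fun m => Wedge.ι_mul_self _)
  choose Φ hΦ₀ hΦ₁ using key
  obtain ⟨T, hT⟩ := WOp.exists_of_pre (U := ⊤) (fun V _ => (Φ V).toAddMonoidHom) (by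
    intro V W hV hW t
    change Wedge.res hW (Φ V t) = Φ W (ExtPre.res E hW t)
    induction t using ExteriorAlgebra.induction with
    | algebraMap r =>
      rw [hΦ₀, ExtPre.res, extMap_algebraMap, hΦ₀, Wedge.res_fn]
    | ι x => rw [hΦ₁, ExtPre.res, extMap_ι, hΦ₁, Wedge.res_ι, hφ]
    | mul a b ha hb => simp only [map_mul, ha, hb]
    | add a b ha hb => simp only [map_add, ha, hb])
  replace hT : ∀ (V : Opens X) (t : ExtPre E V), T.app V le_top (Wedge.ofPre V t) = Φ V t :=
    fun V t => hT V le_top t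
  have hfn : ∀ (V : Opens X) (f : 𝒪.Sec V), T.app V le_top (Wedge.fn f) = Wedge.fn f :=
    fun V f => (hT V _).trans (hΦ₀ V f)
  have hι : ∀ (V : Opens X) (D : E.Sec V), T.app V le_top (Wedge.ι D) = Wedge.ι (φ D) :=
    fun V f => (hT V _).trans (hΦ₁ V f)
  -- Multiplicativity is local, so both factors may be taken from the presheaf over a common open
  -- set.
  have hmul : ∀ (V : Opens X) (a b : Wedge E V),
      T.app V le_top (a * b) = T.app V le_top a * T.app V le_top b := by
    intro V a b
    refine Wedge.ext_local fun x hx => ?_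
    obtain ⟨W, hW, t, hxW, e⟩ := a.exists_local hx
    obtain ⟨W', hW', t', hxW', e'⟩ := b.exists_local hx
    have e₁ : Wedge.res (inf_le_left.trans hW : W ⊓ W' ≤ V) a =
      Wedge.ofPre _ (ExtPre.res E inf_le_left t) := by rw [← Wedge.res_ofPre, ← e]; rfl
    have e₂ : Wedge.res (inf_le_left.trans hW : W ⊓ W' ≤ V) b =
      Wedge.ofPre _ (ExtPre.res E inf_le_right t') := by rw [← Wedge.res_ofPre, ← e']; rfl
    refine ⟨W ⊓ W', inf_le_left.trans hW, ⟨hxW, hxW'⟩, ?_⟩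
    rw [T.nat, map_mul (Wedge.res _) a b, map_mul (Wedge.res _) (T.app V le_top a), T.nat, T.nat,
      e₁, e₂, ← map_mul, hT, hT, hT, map_mul]
  refine ⟨⟨fun {U} => ⟨⟨⟨T.app U le_top, ?_⟩, hmul U⟩, map_zero _, map_add _⟩, fun h a =>
    T.nat _ _ le_top h a, fun f => hfn _ f, ?_⟩, fun U D => hι U D⟩
  · simpa using hfn U 1
  · intro U i a ha
    refine Wedge.hom_induction (U := U) (p := fun V _ i a => (T.app V le_top a).HasDegree i)
      ?_ ?_ ?_ ?_ U le_rfl i a ha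
    · intro V hV i a _ h
      refine Wedge.hasDegree_local fun x hx => ?_
      obtain ⟨W, hW, hxW, hd⟩ := h x hx
      exact ⟨W, hW, hxW, by rwa [T.nat]⟩
    · intro V hV f
      rw [hfn]; exact Wedge.hasDegree_fn f
    · intro V hV i a b _ _ h h'
      rw [map_add]; exact h.add h'
    · intro V hV i D a _ h
      rw [hmul, hι, add_comm]
      exact (Wedge.hasDegree_ι _).mul h

/-- The homomorphism of graded algebras extending a morphism of sheaves of modules. -/
def extHom (φ : ∀ {U : Opens X}, E.Sec U →ₗ[𝒪.Sec U] G.Sec U)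
    (hφ : ∀ {U V : Opens X} (h : V ≤ U) (D : E.Sec U), G.res h (φ D) = φ (E.res h D)) :
    GradedAlgHom E G := (exists_gradedAlgHom φ hφ).choose

theorem extHom_ι (φ : ∀ {U : Opens X}, E.Sec U →ₗ[𝒪.Sec U] G.Sec U)
    (hφ : ∀ {U V : Opens X} (h : V ≤ U) (D : E.Sec U), G.res h (φ D) = φ (E.res h D))
    {U : Opens X} (D : E.Sec U) : (extHom φ hφ).map (Wedge.ι D) = Wedge.ι (φ D) :=
  (exists_gradedAlgHom φ hφ).choose_spec U D

end Functor

end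

section

/-! ## Parity and graded derivations -/

namespace Wedge

variable {E : ModSheaf.{u, v, w} 𝒪} {U V : Opens X}

variable (E) in
/-- The grading automorphism of `⋀ E`, which is `(-1)ⁱ` on `⋀ⁱ E`. -/
def involHom : GradedAlgHom E E := extHom (fun {_} => -LinearMap.id) (by intros; simp)

/-- The grading automorphism of the ring of sections of `⋀ E`. -/
def invol : Wedge E U →+* Wedge E U := (involHom E).map

@[simp] theorem invol_fn (f : 𝒪.Sec U) : invol (fn f : Wedge E U) = fn f := (involHom E).map_fn f

@[simp] theorem invol_ι (D : E.Sec U) : invol (ι D) = -ι D := by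
  refine (extHom_ι (fun {_} => -LinearMap.id) (by intros; simp) D).trans ?_
  rw [← ι_neg]; rfl

theorem res_invol (h : V ≤ U) (a : Wedge E U) : res h (invol a) = invol (res h a) :=
  (involHom E).map_res h a

@[simp] theorem invol_invol (a : Wedge E U) : invol (invol a) = a := by
  have : (involHom E).toWOp U * (involHom E).toWOp U = 1 := WOp.ext_gen
    (fun V hV f => by change invol (invol _) = _; simp)
    fun V hV D a e => by
      change invol (invol _) = _ at e
      change invol (invol _) = _
      simp only [WOp.one_app] at e
      simp [e]
  exact congrArg (fun T : WOp E E U => T.app U le_rfl a) this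

/-- The grading automorphism for the sign `-1`, the identity for the sign `1`. -/
def tw (ε : ℤˣ) : Wedge E U →+* Wedge E U := if ε = 1 then RingHom.id _ else invol

@[simp] theorem tw_one (a : Wedge E U) : tw 1 a = a := rfl
@[simp] theorem tw_neg_one (a : Wedge E U) : tw (-1) a = invol a := rfl

@[simp] theorem tw_fn (ε : ℤˣ) (f : 𝒪.Sec U) : tw ε (fn f : Wedge E U) = fn f := by
  rcases Int.units_eq_one_or ε with rfl | rfl <;> simp

@[simp] theorem tw_ι (ε : ℤˣ) (D : E.Sec U) : tw ε (ι D) = ε • ι D := by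
  rcases Int.units_eq_one_or ε with rfl | rfl <;> simp [Units.smul_def]

theorem res_tw (ε : ℤˣ) (h : V ≤ U) (a : Wedge E U) : res h (tw ε a) = tw ε (res h a) := by
  rcases Int.units_eq_one_or ε with rfl | rfl <;> simp [res_invol]

theorem map_units_smul {A B F : Type*} [AddCommGroup A] [AddCommGroup B] [FunLike F A B]
    [AddMonoidHomClass F A B] (g : F) (ε : ℤˣ) (a : A) : g (ε • a) = ε • g a := by
  rw [Units.smul_def, map_zsmul, Units.smul_def]

theorem HasDegree.invol {i : ℕ} {a : Wedge E U} (ha : a.HasDegree i) :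
    invol a = ((-1 : ℤˣ) ^ i) • a := by
  refine hom_induction (U := U) (p := fun V _ i a => Wedge.invol a = ((-1 : ℤˣ) ^ i) • a)
    ?_ ?_ ?_ ?_ U le_rfl i a ha
  · intro V hV i a _ h
    refine ext_local fun x hx => ?_
    obtain ⟨W, hW, hxW, e⟩ := h x hx
    exact ⟨W, hW, hxW, by rw [res_invol, e, map_units_smul]⟩
  · intro V hV f; simp
  · intro V hV i a b _ _ h h'
    rw [map_add, h, h', smul_add]
  · intro V hV i D a _ h
    rw [map_mul, invol_ι, h, pow_succ, mul_neg, mul_one, neg_mul, Units.neg_smul, mul_smul_comm]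

variable (E U) in
/-- `tw` as an operator. -/
def twOp (ε : ℤˣ) : WOp E E U :=
  ⟨fun _ _ => (tw ε).toAddMonoidHom, fun _ _ _ hW a => res_tw ε hW a⟩

@[simp] theorem twOp_app (ε : ℤˣ) (hV : V ≤ U) (a : Wedge E V) :
    (twOp E U ε).app V hV a = tw ε a := rfl

/-- Graded commutativity. -/
theorem comm_of_invol_eq {e : ℤˣ} {x : Wedge E U} (hx : invol x = e • x) (a : Wedge E U) :
    a * x = x * tw e a := by
  -- First the case of a section `D`, as an identity between operators in `a`; it is then used to
  -- move the generators of `a` past a general `x`.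
  have h₁ : ∀ (V : Opens X) (hV : V ≤ U) (D : E.Sec V) (a : Wedge E V), a * ι D = ι D * invol a := by
    intro V hV D a
    have : WOp.rmul (ι D) = WOp.lmul (ι D) * twOp E V (-1) := WOp.ext_gen
      (fun W hW f => by simp [fn_comm])
      fun W hW D' a e => by
        simp only [WOp.rmul_app, WOp.mul_app, WOp.lmul_app, twOp_app, res_ι, tw_neg_one] at e ⊢
        rw [mul_assoc, e, map_mul, ← mul_assoc, ← mul_assoc, invol_ι, ι_mul_swap, mul_neg]
    exact congrArg (fun T : WOp E E V => T.app V le_rfl a) this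
  have : WOp.rmul x = WOp.lmul x * twOp E U e := WOp.ext_gen
    (fun W hW f => by simp [fn_comm])
    fun W hW D' a h => by
      simp only [WOp.rmul_app, WOp.mul_app, WOp.lmul_app, twOp_app] at h ⊢
      have h₂ : ι D' * res hW x = e • (res hW x * ι D') := by
        rw [h₁ W hW D' (res hW x), ← res_invol, hx, map_units_smul, mul_smul_comm, smul_smul,
          Int.units_mul_self, one_smul]
      rw [mul_assoc, h, map_mul, tw_ι, ← mul_assoc, ← mul_assoc, h₂, mul_smul_comm]
  exact congrArg (fun T : WOp E E U => T.app U le_rfl a) this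

theorem mul_ι_eq (a : Wedge E U) (D : E.Sec U) : a * ι D = ι D * invol a :=
  comm_of_invol_eq (e := -1) (by simp [Units.smul_def]) a

theorem ι_mul_eq (a : Wedge E U) (D : E.Sec U) : ι D * a = invol a * ι D := by
  rw [mul_ι_eq, invol_invol]

end Wedge

namespace WOp

open Wedge

variable {E : ModSheaf.{u, v, w} 𝒪} {U V : Opens X}

/-- Graded derivations of `⋀ E` over `U`, of even (`ε = 1`) or odd (`ε = -1`) parity. -/
def IsDer (ε : ℤˣ) (T : WOp E E U) : Prop :=
  ∀ (V : Opens X) (hV : V ≤ U) (a b : Wedge E V),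
    T.app V hV (a * b) = T.app V hV a * b + tw ε a * T.app V hV b

/-- Operators of parity `ε`. -/
def HasParity (ε : ℤˣ) (T : WOp E E U) : Prop :=
  ∀ (V : Opens X) (hV : V ≤ U) (a : Wedge E V),
    invol (T.app V hV a) = ε • T.app V hV (invol a)

theorem IsDer.restr {ε : ℤˣ} {T : WOp E E U} (hT : T.IsDer ε) (h : V ≤ U) : (T.restr h).IsDer ε :=
  fun W hW a b => hT W (hW.trans h) a b

theorem IsDer.fn_mul {ε : ℤˣ} {T : WOp E E U} (hT : T.IsDer ε) (hV : V ≤ U) (f : 𝒪.Sec V)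
    (a : Wedge E V) :
    T.app V hV (fn f * a) = T.app V hV (fn f) * a + fn f * T.app V hV a := by
  rw [hT, tw_fn]

theorem IsDer.ι_mul {ε : ℤˣ} {T : WOp E E U} (hT : T.IsDer ε) (hV : V ≤ U) (D : E.Sec V)
    (a : Wedge E V) :
    T.app V hV (ι D * a) = T.app V hV (ι D) * a + ε • (ι D * T.app V hV a) := by
  rw [hT, tw_ι, smul_mul_assoc]

/-- Only the first factor of the Leibniz rule has to be a generator. -/
theorem IsDer.of_gen {ε : ℤˣ} {T : WOp E E U}
    (h₀ : ∀ (V : Opens X) (hV : V ≤ U) (f : 𝒪.Sec V) (a : Wedge E V),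
      T.app V hV (fn f * a) = T.app V hV (fn f) * a + fn f * T.app V hV a)
    (h₁ : ∀ (V : Opens X) (hV : V ≤ U) (D : E.Sec V) (a : Wedge E V),
      T.app V hV (ι D * a) = T.app V hV (ι D) * a + ε • (ι D * T.app V hV a)) : T.IsDer ε := by
  intro V hV a b
  -- For fixed `b` both sides of the Leibniz rule are operators in `a`, so they can be compared by
  -- `ext_gen`.
  have : T.restr hV * rmul b =
      rmul b * T.restr hV + rmul (T.app V hV b) * twOp E V ε := by
    refine ext_gen (fun W hW f => ?_) fun W hW D a e => ?_
    · simp [h₀, T.nat]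
    · simp only [mul_app, restr_app, rmul_app, add_app, twOp_app, T.nat] at e ⊢
      rw [mul_assoc, h₁, h₁, e, map_mul, tw_ι]
      rcases Int.units_eq_one_or ε with rfl | rfl
      · simp only [one_smul]; noncomm_ring
      · simp only [Units.neg_smul, one_smul]; noncomm_ring
  exact congrArg (fun T : WOp E E V => T.app V le_rfl a) this

theorem IsDer.ext {ε : ℤˣ} {S T : WOp E E U} (hS : S.IsDer ε) (hT : T.IsDer ε)
    (h₀ : ∀ (V : Opens X) (hV : V ≤ U) (f : 𝒪.Sec V), S.app V hV (fn f) = T.app V hV (fn f))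
    (h₁ : ∀ (V : Opens X) (hV : V ≤ U) (D : E.Sec V), S.app V hV (ι D) = T.app V hV (ι D)) :
    S = T :=
  ext_gen h₀ fun V hV D a e => by rw [hS.ι_mul, hT.ι_mul, e, h₁]

/-- A derivation of parity `ε` sends functions, which are even, to parity `ε`, and sections, which
are odd, to parity `-ε`. The Leibniz rule propagates this from generators. -/
theorem IsDer.hasParity {ε : ℤˣ} {T : WOp E E U} (hT : T.IsDer ε)
    (h₀ : ∀ (V : Opens X) (hV : V ≤ U) (f : 𝒪.Sec V),
      invol (T.app V hV (fn f)) = ε • T.app V hV (fn f))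
    (h₁ : ∀ (V : Opens X) (hV : V ≤ U) (D : E.Sec V),
      invol (T.app V hV (ι D)) = (-ε) • T.app V hV (ι D)) : T.HasParity ε := by
  have : twOp E U (-1) * T = (if ε = 1 then T * twOp E U (-1) else -(T * twOp E U (-1))) := by
    rcases Int.units_eq_one_or ε with rfl | rfl
    · refine ext_gen (fun V hV f => ?_) fun V hV D a e => ?_
      · simpa using h₀ V hV f
      · simp only [if_true, mul_app, twOp_app, tw_neg_one] at e ⊢
        rw [hT.ι_mul, map_add, map_mul, h₁, one_smul, map_mul, map_mul, e, invol_ι,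
          neg_mul, neg_mul, map_neg, hT.ι_mul, Units.neg_smul, one_smul, one_smul, neg_add, neg_mul]
    · refine ext_gen (fun V hV f => ?_) fun V hV D a e => ?_
      · simpa [Units.smul_def] using h₀ V hV f
      · rw [if_neg (by decide)] at e ⊢
        simp only [mul_app, twOp_app, tw_neg_one, neg_app] at e ⊢
        rw [hT.ι_mul, map_add, map_mul, h₁, map_units_smul, map_mul, map_mul, e, invol_ι,
          neg_mul, neg_mul, map_neg, hT.ι_mul, neg_neg, one_smul, Units.neg_smul, Units.neg_smul,
          one_smul, one_smul]
        noncomm_ring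
  intro V hV a
  have := congrArg (fun T : WOp E E U => T.app V hV a) this
  rcases Int.units_eq_one_or ε with rfl | rfl
  · simpa using this
  · rw [if_neg (by decide)] at this
    simpa [Units.smul_def] using this

theorem IsDer.add {ε : ℤˣ} {S T : WOp E E U} (hS : S.IsDer ε) (hT : T.IsDer ε) :
    (S + T).IsDer ε := fun V hV a b => by
  simp only [add_app, hS V hV, hT V hV]; noncomm_ring

theorem IsDer.neg {ε : ℤˣ} {S : WOp E E U} (hS : S.IsDer ε) :
    (-S).IsDer ε := fun V hV a b => by
  simp only [neg_app, hS V hV]; noncomm_ring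

theorem IsDer.sub {ε : ℤˣ} {S T : WOp E E U} (hS : S.IsDer ε) (hT : T.IsDer ε) :
    (S - T).IsDer ε := sub_eq_add_neg S T ▸ hS.add hT.neg

theorem isDer_zero (ε : ℤˣ) : (0 : WOp E E U).IsDer ε := fun V hV a b => by simp

/-- Moving `x` past `tw ε a` in the second Leibniz term costs the sign by which `tw ε` and `tw (e *
ε)` differ. -/
theorem IsDer.lmul_mul {ε e : ℤˣ} {x : Wedge E U} (hx : invol x = e • x) {T : WOp E E U}
    (hT : T.IsDer ε) : (lmul x * T).IsDer (e * ε) := fun V hV a b => by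
  have hx' : invol (res hV x) = e • res hV x := by rw [← res_invol, hx, map_units_smul]
  have key : res hV x * tw ε a = tw (e * ε) a * res hV x := by
    rw [comm_of_invol_eq hx' (tw (e * ε) a)]
    rcases Int.units_eq_one_or e with rfl | rfl <;> rcases Int.units_eq_one_or ε with rfl | rfl <;>
      simp
  simp only [mul_app, lmul_app, hT V hV, mul_add, ← mul_assoc, key]

/-- The sign `(-1)^{|S||T|}`. -/
def sgn (ε ε' : ℤˣ) : ℤˣ := if ε = 1 then 1 else ε'

@[simp] theorem sgn_one_left (ε : ℤˣ) : sgn 1 ε = 1 := rfl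
@[simp] theorem sgn_neg_one_left (ε : ℤˣ) : sgn (-1) ε = ε := rfl

@[simp] theorem units_smul_app (e : ℤˣ) (T : WOp E E U) (V : Opens X) (h : V ≤ U)
    (a : Wedge E V) : (e • T).app V h a = e • T.app V h a := by
  rcases Int.units_eq_one_or e with rfl | rfl
  · rw [one_smul, one_smul]
  · rw [Units.neg_smul, neg_app, Units.neg_smul, one_smul, one_smul]

/-- The graded commutator of two graded derivations is a graded derivation. -/
theorem IsDer.commutator {ε ε' : ℤˣ} {S T : WOp E E U} (hS : S.IsDer ε) (hT : T.IsDer ε')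
    (pS : S.HasParity ε) (pT : T.HasParity ε') :
    (S * T - sgn ε ε' • (T * S)).IsDer (ε * ε') := fun V hV a b => by
  have hS' := hS V hV
  have hT' := hT V hV
  have pS' := pS V hV a
  have pT' := pT V hV a
  have pS'' := pS V hV (invol a)
  have pT'' := pT V hV (invol a)
  rw [invol_invol] at pS'' pT''
  rcases Int.units_eq_one_or ε with rfl | rfl <;> rcases Int.units_eq_one_or ε' with rfl | rfl
  · simp only [sub_app, mul_app, sgn_one_left, one_smul, hS', hT', map_add, tw_one, mul_one,
      sub_mul, mul_sub]
    abel
  · simp only [sub_app, mul_app, sgn_one_left, one_smul, hS', hT', map_add, tw_one, tw_neg_one,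
      one_mul, sub_mul, mul_sub, pS']
    abel
  · simp only [sub_app, mul_app, sgn_neg_one_left, one_smul, hS', hT', map_add, tw_one, tw_neg_one,
      mul_one, sub_mul, mul_sub, pT']
    abel
  · simp only [mul_app, sgn_neg_one_left, Units.neg_smul, one_smul, hS', hT', map_add,
      tw_one, tw_neg_one, neg_mul, mul_neg, neg_neg, mul_one, pT', pS', sub_neg_eq_add,
      add_app, invol_invol, add_mul, mul_add]
    abel

theorem HasParity.commutator {ε ε' : ℤˣ} {S T : WOp E E U} 
    (pS : S.HasParity ε) (pT : T.HasParity ε') :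
    (S * T - sgn ε ε' • (T * S)).HasParity (ε * ε') := fun V hV a => by
  simp only [sub_app, mul_app, units_smul_app, map_sub, pS V hV, pT V hV, map_units_smul, smul_sub,
    smul_smul]
  congr 2
  rw [mul_comm, mul_comm ε]

end WOp

end

section

/-! ## Parity and graded derivations -/

namespace WOp

open Wedge

variable {E : ModSheaf.{u, v, w} 𝒪} {U V : Opens X}

theorem IsDer.of_pre {ε : ℤˣ} {T : WOp E E U}
    (h₀ : ∀ (V : Opens X) (hV : V ≤ U) (f : 𝒪.Sec V) (t : ExtPre E V),
      T.app V hV (fn f * ofPre V t) =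
        T.app V hV (fn f) * ofPre V t + fn f * T.app V hV (ofPre V t))
    (h₁ : ∀ (V : Opens X) (hV : V ≤ U) (D : E.Sec V) (t : ExtPre E V),
      T.app V hV (ι D * ofPre V t) =
        T.app V hV (ι D) * ofPre V t + ε • (ι D * T.app V hV (ofPre V t))) : T.IsDer ε := by
  refine IsDer.of_gen (fun V hV f a => ?_) (fun V hV D a => ?_)
  · have : T.restr hV * lmul (fn f) = lmul (T.app V hV (fn f)) + lmul (fn f) * T.restr hV :=
      ext_pre fun W hW t => by
        simp only [mul_app, restr_app, lmul_app, add_app, T.nat, res_fn]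
        exact h₀ W _ _ t
    exact congrArg (fun T : WOp E E V => T.app V le_rfl a) this
  · have : T.restr hV * lmul (ι D) =
        lmul (T.app V hV (ι D)) + ε • (lmul (ι D) * T.restr hV) :=
      ext_pre fun W hW t => by
        simp only [mul_app, restr_app, lmul_app, add_app, T.nat, res_ι, units_smul_app]
        exact h₁ W _ _ t
    have := congrArg (fun T : WOp E E V => T.app V le_rfl a) this
    simpa only [mul_app, restr_app, lmul_app, add_app, units_smul_app, res_rfl] using this

set_option maxHeartbeats 1000000 in
/-- A graded derivation of `⋀ E` is given by its values on functions and on sections of `E`. -/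
theorem exists_der (ε : ℤˣ) (δ₀ : ∀ V : Opens X, V ≤ U → (𝒪.Sec V →+ Wedge E V))
    (δ₁ : ∀ V : Opens X, V ≤ U → (E.Sec V →+ Wedge E V))
    (nat₀ : ∀ (V W : Opens X) (hV : V ≤ U) (hW : W ≤ V) (f : 𝒪.Sec V),
      res hW (δ₀ V hV f) = δ₀ W (hW.trans hV) (𝒪.res hW f))
    (nat₁ : ∀ (V W : Opens X) (hV : V ≤ U) (hW : W ≤ V) (D : E.Sec V),
      res hW (δ₁ V hV D) = δ₁ W (hW.trans hV) (E.res hW D))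
    (h₁ : ∀ (V : Opens X) (hV : V ≤ U) (f g : 𝒪.Sec V),
      δ₀ V hV (f * g) = fn f * δ₀ V hV g + fn g * δ₀ V hV f)
    (h₂ : ∀ (V : Opens X) (hV : V ≤ U) (f : 𝒪.Sec V) (D : E.Sec V),
      δ₁ V hV (f • D) = fn f * δ₁ V hV D + δ₀ V hV f * ι D)
    (h₃ : ∀ (V : Opens X) (hV : V ≤ U) (f : 𝒪.Sec V),
      invol (δ₀ V hV f) = ε • δ₀ V hV f)
    (h₄ : ∀ (V : Opens X) (hV : V ≤ U) (D : E.Sec V),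
      invol (δ₁ V hV D) = (-ε) • δ₁ V hV D) :
    ∃ T : WOp E E U, T.IsDer ε ∧ T.HasParity ε ∧
      (∀ (V : Opens X) (hV : V ≤ U) (f : 𝒪.Sec V), T.app V hV (fn f) = δ₀ V hV f) ∧
      ∀ (V : Opens X) (hV : V ≤ U) (D : E.Sec V), T.app V hV (ι D) = δ₁ V hV D := by
  -- The construction rests on this: `T` is a derivation of parity `ε` exactly when `t ↦ !![tw ε t,
  -- T t; 0, t]` is multiplicative. The assumptions on `δ₀` and `δ₁` say that the matrices assigned
  -- to generators satisfy the relations of the exterior algebra, so a ring homomorphism `Φ` exists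
  -- and `T` is its upper right entry.
  have mm : ∀ (V : Opens X) (a b d a' b' d' : Wedge E V), !![a, b; 0, d] * !![a', b'; 0, d'] =
      !![a * a', a * b' + b * d'; 0, d * d'] := by
    intro V a b d a' b' d'
    simp
  have key : ∀ (V : Opens X) (hV : V ≤ U), ∃ Φ : ExtPre E V →+* Matrix (Fin 2) (Fin 2) (Wedge E V),
      (∀ r, Φ (algebraMap _ _ r) = !![fn r, δ₀ V hV r; 0, fn r]) ∧
        ∀ m, Φ (ExteriorAlgebra.ι _ m) = !![ε • ι m, δ₁ V hV m; 0, ι m] := fun V hV =>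
    exists_extLift
      { toFun := fun r => !![fn r, δ₀ V hV r; 0, fn r]
        map_one' := by
          have := h₁ V hV 1 1
          simp only [mul_one, fn_one, one_mul, left_eq_add] at this
          rw [this, fn_one, Matrix.one_fin_two]
        map_zero' := by
          rw [map_zero, fn_zero]; exact (Matrix.eta_fin_two 0).symm
        map_add' := fun a b => by simp [fn_add]
        map_mul' := fun a b => by
          rw [mm, h₁, fn_mul, fn_comm b (δ₀ V hV a)] }
      { toFun := fun m => !![ε • ι m, δ₁ V hV m; 0, ι m]
        map_zero' := by
          rw [map_zero, ι_zero, smul_zero]; exact (Matrix.eta_fin_two 0).symm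
        map_add' := fun a b => by simp [ι_add] }
      (fun r m => by
        change !![ε • ι (r • m), δ₁ V hV (r • m); 0, ι (r • m)] =
          !![fn r, δ₀ V hV r; 0, fn r] * !![ε • ι m, δ₁ V hV m; 0, ι m]
        rw [mm, h₂, ι_smul, mul_smul_comm])
      (fun r m => by
        change !![fn r, δ₀ V hV r; 0, fn r] * !![ε • ι m, δ₁ V hV m; 0, ι m] =
          !![ε • ι m, δ₁ V hV m; 0, ι m] * !![fn r, δ₀ V hV r; 0, fn r]
        -- The parity of `δ₀` makes the matrix of a function commute with that of a section; the
        -- parity of `δ₁` makes the matrix of a section square to zero.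
        have : δ₀ V hV r * ι m = ε • ι m * δ₀ V hV r := by
          rw [mul_ι_eq, h₃, mul_smul_comm, smul_mul_assoc]
        rw [mm, mm, this, fn_comm, fn_comm, fn_comm, add_comm])
      (fun m => by
        change !![ε • ι m, δ₁ V hV m; 0, ι m] * !![ε • ι m, δ₁ V hV m; 0, ι m] = 0
        have : δ₁ V hV m * ι m = -(ε • ι m * δ₁ V hV m) := by
          rw [mul_ι_eq, h₄, mul_smul_comm, smul_mul_assoc, Units.neg_smul]
        rw [mm, this, add_neg_cancel, ι_mul_self, smul_mul_assoc, mul_smul_comm, ι_mul_self,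
          smul_zero, smul_zero]
        exact (Matrix.eta_fin_two 0).symm)
  choose Φ hΦ₀ hΦ₁ using key
  have nat : ∀ (V W : Opens X) (hV : V ≤ U) (hW : W ≤ V) (t : ExtPre E V),
      (res hW).mapMatrix (Φ V hV t) = Φ W (hW.trans hV) (ExtPre.res E hW t) := by
    intro V W hV hW t
    induction t using ExteriorAlgebra.induction with
    | algebraMap r =>
      rw [hΦ₀, ExtPre.res, extMap_algebraMap, hΦ₀]
      ext i j; fin_cases i <;> fin_cases j <;> simp [nat₀]
    | ι x =>
      rw [hΦ₁, ExtPre.res, extMap_ι, hΦ₁]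
      ext i j; fin_cases i <;> fin_cases j <;> simp [nat₁]
    | mul a b ha hb => rw [map_mul, map_mul, map_mul, map_mul, ha, hb]
    | add a b ha hb => rw [map_add, map_add, map_add, map_add, ha, hb]
  -- The lower row is `(0, t)`, so multiplicativity of `Φ` yields the Leibniz rule for the upper
  -- right entry.
  have h11 : ∀ (V : Opens X) (hV : V ≤ U) (t : ExtPre E V),
      Φ V hV t 1 0 = 0 ∧ Φ V hV t 1 1 = ofPre V t := by
    intro V hV t
    induction t using ExteriorAlgebra.induction with
    | algebraMap r => rw [hΦ₀]; exact ⟨rfl, rfl⟩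
    | ι x => rw [hΦ₁]; exact ⟨rfl, rfl⟩
    | mul a b ha hb =>
      simp [map_mul, Matrix.mul_apply, ha, hb]
    | add a b ha hb => simp [map_add, ha, hb]
  obtain ⟨T, hT⟩ := exists_of_pre (U := U) (G := E)
    (fun V hV => AddMonoidHom.mk' (fun t => Φ V hV t 0 1) fun a b => by simp)
    (fun V W hV hW t => congrFun (congrFun (nat V W hV hW t) 0) 1)
  replace hT : ∀ (V : Opens X) (hV : V ≤ U) (t : ExtPre E V),
    T.app V hV (ofPre V t) = Φ V hV t 0 1 := hT
  have hfn : ∀ (V : Opens X) (hV : V ≤ U) (f : 𝒪.Sec V), T.app V hV (fn f) = δ₀ V hV f :=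
    fun V hV f => by rw [fn, hT, hΦ₀]; rfl
  have hι : ∀ (V : Opens X) (hV : V ≤ U) (D : E.Sec V), T.app V hV (ι D) = δ₁ V hV D :=
    fun V hV f => by rw [ι, hT, hΦ₁]; rfl
  have der₀ : ∀ (V : Opens X) (hV : V ≤ U) (f : 𝒪.Sec V) (t : ExtPre E V),
      T.app V hV (fn f * ofPre V t) =
        T.app V hV (fn f) * ofPre V t + fn f * T.app V hV (ofPre V t) := by
    intro V hV f t
    rw [hfn, fn, ← map_mul (ofPre V), hT, hT, map_mul, Matrix.mul_apply, Fin.sum_univ_two, hΦ₀,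
      (h11 V _ t).2, add_comm]
    rfl
  have der₁ : ∀ (V : Opens X) (hV : V ≤ U) (D : E.Sec V) (t : ExtPre E V),
      T.app V hV (ι D * ofPre V t) =
        T.app V hV (ι D) * ofPre V t + ε • (ι D * T.app V hV (ofPre V t)) := by
    intro V hV f t
    rw [hι, ι, ← map_mul (ofPre V), hT, hT, map_mul, Matrix.mul_apply, Fin.sum_univ_two, hΦ₁,
      (h11 V _ t).2, add_comm, ← smul_mul_assoc]
    rfl
  have der : T.IsDer ε := IsDer.of_pre der₀ der₁
  exact ⟨T, der, der.hasParity (fun V hV f => by rw [hfn, h₃]) fun V hV D => by rw [hι, h₄],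
    hfn, hι⟩

end WOp

end

section

open Wedge WOp

theorem WOp.congr_app {E : ModSheaf.{u, v, w} 𝒪} {G : ModSheaf.{u, v, w'} 𝒪} {U : Opens X}
    {S T : WOp E G U} (h : S = T) (a : Wedge E U) : S.app U le_rfl a = T.app U le_rfl a := by
  rw [h]

/-! ## The Schouten bracket -/

namespace LieAlgebroid

variable {F : ModSheaf.{u, v, w} 𝒪} (𝓕 : LieAlgebroid F) {U V : Opens X}

theorem lie_swap (D D' : F.Sec U) : 𝓕.lie D D' = -𝓕.lie D' D := by
  have := 𝓕.lie_self (D + D')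
  rw [𝓕.add_lie, 𝓕.lie_add, 𝓕.lie_add, 𝓕.lie_self, 𝓕.lie_self, zero_add, add_zero] at this
  exact eq_neg_of_add_eq_zero_left this

/-- The value on `D` is dictated by antisymmetry, `[f, D] = -[D, f]`. -/
theorem exists_brFn (f : 𝒪.Sec U) : ∃ T : WOp F F U, T.IsDer (-1) ∧ T.HasParity (-1) ∧
    (∀ (V : Opens X) (hV : V ≤ U) (g : 𝒪.Sec V), T.app V hV (fn g) = 0) ∧
    ∀ (V : Opens X) (hV : V ≤ U) (D : F.Sec V),
      T.app V hV (ι D) = -fn (𝓕.anchor D (𝒪.res hV f)) :=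
  exists_der (-1) (fun _ _ => 0)
    (fun V hV => AddMonoidHom.mk' (fun D => -fn (𝓕.anchor D (𝒪.res hV f))) fun a b => by
      simp [fn_add, add_comm])
    (by intros; simp)
    (by
      intro V W hV hW D
      simp [𝓕.anchor_res])
    (by intros; simp)
    (by
      intro V hV g D
      simp [Wedge.fn_mul])
    (by intros; simp)
    (by
      intro V hV D
      simp)

/-- The operator `[f, ·]` for a function `f`. -/
def opFn (f : 𝒪.Sec U) : WOp F F U := (𝓕.exists_brFn f).choose

theorem opFn_isDer (f : 𝒪.Sec U) : (𝓕.opFn f).IsDer (-1) := (𝓕.exists_brFn f).choose_spec.1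
theorem opFn_hasParity (f : 𝒪.Sec U) : (𝓕.opFn f).HasParity (-1) :=
  (𝓕.exists_brFn f).choose_spec.2.1
theorem opFn_fn (f : 𝒪.Sec U) (hV : V ≤ U) (g : 𝒪.Sec V) : (𝓕.opFn f).app V hV (fn g) = 0 :=
  (𝓕.exists_brFn f).choose_spec.2.2.1 V hV g
theorem opFn_ι (f : 𝒪.Sec U) (hV : V ≤ U) (D : F.Sec V) :
    (𝓕.opFn f).app V hV (ι D) = -fn (𝓕.anchor D (𝒪.res hV f)) :=
  (𝓕.exists_brFn f).choose_spec.2.2.2 V hV D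

theorem exists_lieDer (D : F.Sec U) : ∃ T : WOp F F U, T.IsDer 1 ∧ T.HasParity 1 ∧
    (∀ (V : Opens X) (hV : V ≤ U) (g : 𝒪.Sec V),
      T.app V hV (fn g) = fn (𝓕.anchor (F.res hV D) g)) ∧
    ∀ (V : Opens X) (hV : V ≤ U) (D' : F.Sec V),
      T.app V hV (ι D') = ι (𝓕.lie (F.res hV D) D') :=
  exists_der 1
    (fun V hV => AddMonoidHom.mk' (fun f => fn (𝓕.anchor (F.res hV D) f)) fun a b => by
      simp [fn_add])
    (fun V hV => AddMonoidHom.mk' (fun D' => ι (𝓕.lie (F.res hV D) D')) fun a b => by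
      simp [ι_add, 𝓕.lie_add])
    (by
      intro V W hV hW f
      simp [𝓕.anchor_res, F.res_res])
    (by
      intro V W hV hW D
      simp [𝓕.lie_res, F.res_res])
    (by intros; simp [fn_add, Wedge.fn_mul])
    (by
      intro V hV g D
      simp [𝓕.leibniz, ι_add, ι_smul])
    (by intros; simp)
    (by
      intro V hV D
      simp [Units.neg_smul])

/-- The operator `[D, ·]` for a section `D`, the Lie derivative. -/
def opSec (D : F.Sec U) : WOp F F U := (𝓕.exists_lieDer D).choose

theorem opSec_isDer (D : F.Sec U) : (𝓕.opSec D).IsDer 1 := (𝓕.exists_lieDer D).choose_spec.1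
theorem opSec_hasParity (D : F.Sec U) : (𝓕.opSec D).HasParity 1 :=
  (𝓕.exists_lieDer D).choose_spec.2.1
theorem opSec_fn (D : F.Sec U) (hV : V ≤ U) (g : 𝒪.Sec V) :
    (𝓕.opSec D).app V hV (fn g) = fn (𝓕.anchor (F.res hV D) g) :=
  (𝓕.exists_lieDer D).choose_spec.2.2.1 V hV g
theorem opSec_ι (D : F.Sec U) (hV : V ≤ U) (D' : F.Sec V) :
    (𝓕.opSec D).app V hV (ι D') = ι (𝓕.lie (F.res hV D) D') :=
  (𝓕.exists_lieDer D).choose_spec.2.2.2 V hV D'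

theorem opFn_restr (f : 𝒪.Sec U) (h : V ≤ U) : (𝓕.opFn f).restr h = 𝓕.opFn (𝒪.res h f) :=
  ((𝓕.opFn_isDer f).restr h).ext (𝓕.opFn_isDer _)
    (fun W hW g => by rw [restr_app, opFn_fn, opFn_fn])
    (fun W hW D => by rw [restr_app, opFn_ι, opFn_ι]; rfl)

theorem opSec_restr (D : F.Sec U) (h : V ≤ U) : (𝓕.opSec D).restr h = 𝓕.opSec (F.res h D) :=
  ((𝓕.opSec_isDer D).restr h).ext (𝓕.opSec_isDer _)
    (fun W hW g => by rw [restr_app, opSec_fn, opSec_fn, F.res_res])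
    (fun W hW D => by rw [restr_app, opSec_ι, opSec_ι, F.res_res])

/-- `[f, a]`. -/
def brFn (f : 𝒪.Sec U) : Wedge F U →+ Wedge F U := (𝓕.opFn f).app U le_rfl

/-- `[D, a]`. -/
def brSec (D : F.Sec U) : Wedge F U →+ Wedge F U := (𝓕.opSec D).app U le_rfl

theorem opFn_app (f : 𝒪.Sec U) (h : V ≤ U) (a : Wedge F V) :
    (𝓕.opFn f).app V h a = 𝓕.brFn (𝒪.res h f) a := by
  rw [brFn, ← opFn_restr]; rfl

theorem opSec_app (D : F.Sec U) (h : V ≤ U) (a : Wedge F V) :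
    (𝓕.opSec D).app V h a = 𝓕.brSec (F.res h D) a := by
  rw [brSec, ← opSec_restr]; rfl

theorem res_brFn (f : 𝒪.Sec U) (h : V ≤ U) (a : Wedge F U) :
    res h (𝓕.brFn f a) = 𝓕.brFn (𝒪.res h f) (res h a) := by
  rw [← opFn_app]; exact (𝓕.opFn f).nat U V le_rfl h a

theorem res_brSec (D : F.Sec U) (h : V ≤ U) (a : Wedge F U) :
    res h (𝓕.brSec D a) = 𝓕.brSec (F.res h D) (res h a) := by
  rw [← opSec_app]; exact (𝓕.opSec D).nat U V le_rfl h a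

@[simp] theorem brFn_fn (f g : 𝒪.Sec U) : 𝓕.brFn f (fn g) = 0 := 𝓕.opFn_fn f le_rfl g
@[simp] theorem brFn_ι (f : 𝒪.Sec U) (D : F.Sec U) : 𝓕.brFn f (ι D) = -fn (𝓕.anchor D f) :=
  𝓕.opFn_ι f le_rfl D
@[simp] theorem brSec_fn (D : F.Sec U) (f : 𝒪.Sec U) :
    𝓕.brSec D (fn f) = fn (𝓕.anchor D f) := by
  have := 𝓕.opSec_fn D le_rfl f
  rwa [F.res_id] at this
@[simp] theorem brSec_ι (D D' : F.Sec U) : 𝓕.brSec D (ι D') = ι (𝓕.lie D D') := by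
  have := 𝓕.opSec_ι D le_rfl D'
  rwa [F.res_id] at this

theorem brFn_mul (f : 𝒪.Sec U) (a b : Wedge F U) :
    𝓕.brFn f (a * b) = 𝓕.brFn f a * b + invol a * 𝓕.brFn f b := 𝓕.opFn_isDer f U le_rfl a b
theorem brSec_mul (D : F.Sec U) (a b : Wedge F U) :
    𝓕.brSec D (a * b) = 𝓕.brSec D a * b + a * 𝓕.brSec D b := 𝓕.opSec_isDer D U le_rfl a b

theorem invol_brFn (f : 𝒪.Sec U) (a : Wedge F U) :
    invol (𝓕.brFn f a) = -𝓕.brFn f (invol a) := by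
  rw [brFn, 𝓕.opFn_hasParity f U le_rfl a, Units.neg_smul, one_smul]
theorem invol_brSec (D : F.Sec U) (a : Wedge F U) :
    invol (𝓕.brSec D a) = 𝓕.brSec D (invol a) := by
  rw [brSec, 𝓕.opSec_hasParity D U le_rfl a, one_smul]

theorem brFn_add_left (f g : 𝒪.Sec U) (a : Wedge F U) :
    𝓕.brFn (f + g) a = 𝓕.brFn f a + 𝓕.brFn g a :=
  congr_app (S := 𝓕.opFn (f + g)) (T := 𝓕.opFn f + 𝓕.opFn g)
    (((𝓕.opFn_isDer _).ext ((𝓕.opFn_isDer _).add (𝓕.opFn_isDer _))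
      (fun V hV h => by simp [opFn_fn])) fun V hV D => by simp [opFn_ι, fn_add, add_comm]) a

theorem brSec_add_left (D D' : F.Sec U) (a : Wedge F U) :
    𝓕.brSec (D + D') a = 𝓕.brSec D a + 𝓕.brSec D' a :=
  congr_app (S := 𝓕.opSec (D + D')) (T := 𝓕.opSec D + 𝓕.opSec D')
    (((𝓕.opSec_isDer _).ext ((𝓕.opSec_isDer _).add (𝓕.opSec_isDer _))
      (fun V hV h => by simp [opSec_fn, fn_add])) fun V hV D => by
        simp [opSec_ι, ι_add, 𝓕.add_lie]) a

theorem brFn_mul_left (f g : 𝒪.Sec U) (a : Wedge F U) :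
    𝓕.brFn (f * g) a = fn f * 𝓕.brFn g a + fn g * 𝓕.brFn f a :=
  congr_app (S := 𝓕.opFn (f * g)) (T := lmul (fn f) * 𝓕.opFn g + lmul (fn g) * 𝓕.opFn f)
    ((𝓕.opFn_isDer _).ext (((𝓕.opFn_isDer g).lmul_mul (e := 1) (by simp)).add
      ((𝓕.opFn_isDer f).lmul_mul (e := 1) (by simp)))
      (fun V hV h => by simp [opFn_fn]) fun V hV D => by
        simp [opFn_ι, fn_add, Wedge.fn_mul, add_comm]) a

/-- In the correction term the grading automorphism cancels two signs, that of the odd derivation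
`[f, ·]` and that of moving `D` across a factor. The term is thus an even derivation in `a`, and
both sides may be compared on generators. -/
theorem brSec_smul_left (f : 𝒪.Sec U) (D : F.Sec U) (a : Wedge F U) :
    𝓕.brSec (f • D) a = fn f * 𝓕.brSec D a - 𝓕.brFn f (invol a) * ι D :=
  congr_app (S := 𝓕.opSec (f • D))
    (T := lmul (fn f) * 𝓕.opSec D - rmul (ι D) * 𝓕.opFn f * twOp F U (-1))
    ((𝓕.opSec_isDer _).ext (ε := 1) (((𝓕.opSec_isDer D).lmul_mul (e := 1) (by simp)).sub (by
      intro V hV a b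
      simp only [mul_app, twOp_app, tw_neg_one, rmul_app, res_ι, map_mul, opFn_app, brFn_mul,
        invol_invol, one_mul, tw_one, add_mul]
      rw [mul_assoc _ (invol b), mul_assoc a, ← ι_mul_eq, mul_assoc]))
      (fun V hV h => by simp [opSec_fn, opFn_fn, Wedge.fn_mul]) fun V hV D' => by
        simp only [opSec_ι, map_smulₛₗ, sub_app, mul_app, twOp_app, lmul_app, rmul_app, tw_neg_one,
          invol_ι, map_neg, opFn_ι, neg_neg, res_fn, res_ι, ← ι_smul, ← ι_sub]
        congr 1
        rw [𝓕.lie_swap, 𝓕.leibniz, 𝓕.lie_swap D', smul_neg]; abel) a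

/-- This and the next two statements are the Jacobi identity with two entries of degree at most one.
The left side is a graded commutator of derivations, hence determined on generators, where
compatibility of the anchor with brackets and the Jacobi identity of `𝓕` decide. -/
theorem brSec_brFn (D : F.Sec U) (f : 𝒪.Sec U) (a : Wedge F U) :
    𝓕.brSec D (𝓕.brFn f a) - 𝓕.brFn f (𝓕.brSec D a) = 𝓕.brFn (𝓕.anchor D f) a := by
  have h := (𝓕.opSec_isDer D).commutator (𝓕.opFn_isDer f) (𝓕.opSec_hasParity D)
    (𝓕.opFn_hasParity f)
  rw [sgn_one_left, one_smul, one_mul] at h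
  refine congr_app (h.ext (𝓕.opFn_isDer (𝓕.anchor D f)) (fun V hV g => ?_) fun V hV D' => ?_) a
  · simp [opSec_app, opFn_app]
  · simp only [sub_app, mul_app, opSec_app, opFn_app, brFn_ι, brSec_ι, map_neg, brSec_fn,
      𝓕.anchor_lie, 𝓕.anchor_res, Derivation.commutator_apply, fn_sub]
    abel

theorem brSec_brSec (D D' : F.Sec U) (a : Wedge F U) :
    𝓕.brSec D (𝓕.brSec D' a) - 𝓕.brSec D' (𝓕.brSec D a) = 𝓕.brSec (𝓕.lie D D') a := by
  have h := (𝓕.opSec_isDer D).commutator (𝓕.opSec_isDer D') (𝓕.opSec_hasParity D)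
    (𝓕.opSec_hasParity D')
  rw [sgn_one_left, one_smul, one_mul] at h
  refine congr_app (h.ext (𝓕.opSec_isDer (𝓕.lie D D')) (fun V hV g => ?_) fun V hV D'' => ?_) a
  · simp only [sub_app, mul_app, opSec_app, brSec_fn, 𝓕.lie_res, 𝓕.anchor_lie,
      Derivation.commutator_apply, fn_sub]
  · simp only [sub_app, mul_app, opSec_app, brSec_ι, 𝓕.lie_res, ← ι_sub]
    rw [𝓕.jacobi]; congr 1; abel

theorem brFn_brFn (f g : 𝒪.Sec U) (a : Wedge F U) :
    𝓕.brFn f (𝓕.brFn g a) + 𝓕.brFn g (𝓕.brFn f a) = 0 := by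
  have h := (𝓕.opFn_isDer f).commutator (𝓕.opFn_isDer g) (𝓕.opFn_hasParity f)
    (𝓕.opFn_hasParity g)
  rw [sgn_neg_one_left, Units.neg_smul, one_smul, sub_neg_eq_add] at h
  refine congr_app (h.ext (isDer_zero _) (fun V hV g => ?_) fun V hV D'' => ?_) a
  · simp [opFn_app]
  · simp [opFn_app]

/-- The values on generators are forced by graded antisymmetry from `[g, c]` and `[D, c]`, which are
already defined. The Leibniz rules required for the extension are `brFn_mul_left` and
`brSec_smul_left`. -/
theorem exists_ad {e : ℤˣ} {c : Wedge F U} (hc : invol c = e • c) : ∃ T : WOp F F U,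
    T.IsDer (-e) ∧ T.HasParity (-e) ∧
    (∀ (V : Opens X) (hV : V ≤ U) (g : 𝒪.Sec V),
      T.app V hV (fn g) = e • 𝓕.brFn g (res hV c)) ∧
    ∀ (V : Opens X) (hV : V ≤ U) (D : F.Sec V),
      T.app V hV (ι D) = -𝓕.brSec D (res hV c) := by
  have hc' : ∀ (V : Opens X) (hV : V ≤ U), invol (res hV c) = e • res hV c := fun V hV => by
    rw [← res_invol, hc, map_units_smul]
  exact exists_der (-e)
    (fun V hV => AddMonoidHom.mk' (fun f => e • 𝓕.brFn f (res hV c)) fun a b => by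
      rw [brFn_add_left, smul_add])
    (fun V hV => AddMonoidHom.mk' (fun D => -𝓕.brSec D (res hV c)) fun a b => by
      rw [brSec_add_left, neg_add])
    (fun V W hV hW f => by
      change res hW (e • _) = e • _
      rw [map_units_smul, res_brFn]; rfl)
    (fun V W hV hW D => by
      change res hW (- _) = - _
      rw [map_neg, res_brSec]; rfl)
    (fun V hV f g => by
      change e • 𝓕.brFn (f * g) _ = fn f * (e • _) + fn g * (e • _)
      rw [brFn_mul_left, smul_add, mul_smul_comm, mul_smul_comm])
    (fun V hV f D => by
      change -𝓕.brSec (f • D) _ = fn f * (-_) + e • _ * ι D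
      rw [brSec_smul_left, hc', map_units_smul, smul_mul_assoc, mul_neg]; abel)
    (fun V hV f => by
      change invol (e • 𝓕.brFn f _) = (-e) • e • _
      rw [map_units_smul, invol_brFn, hc', map_units_smul, Units.neg_smul, smul_neg])
    (fun V hV D => by
      change invol (-𝓕.brSec D _) = (- -e) • (-_)
      rw [map_neg, invol_brSec, hc', map_units_smul, neg_neg, smul_neg])

end LieAlgebroid

/-! ### Even and odd parts -/

section Parity

variable {E : ModSheaf.{u, v, w} 𝒪} {U V : Opens X}

theorem Wedge.half_add_half [CharZero K] (a : Wedge E U) :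
    fn (algebraMap K (𝒪.Sec U) (1 / 2)) * (a + a) = a := by
  rw [mul_add, ← add_mul, ← fn_add, ← map_add, add_halves, map_one, fn_one, one_mul]

/-- The even part (`e = 1`) or the odd part (`e = -1`) of a section of `⋀ E`. -/
def Wedge.part (e : ℤˣ) (a : Wedge E U) : Wedge E U :=
  fn (algebraMap K (𝒪.Sec U) (1 / 2)) * (a + e • invol a)

theorem Wedge.invol_part (e : ℤˣ) (a : Wedge E U) : invol (part e a) = e • part e a := by
  rw [part, map_mul, invol_fn, map_add, map_units_smul, invol_invol, ← mul_smul_comm, smul_add,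
    smul_smul, Int.units_mul_self, one_smul, add_comm]

theorem Wedge.part_neg_eq {e : ℤˣ} {a : Wedge E U} (ha : invol a = e • a) : part (-e) a = 0 := by
  rw [part, ha, smul_smul, neg_mul, Int.units_mul_self, Units.neg_smul, one_smul, add_neg_cancel,
    mul_zero]

theorem Wedge.part_add (e : ℤˣ) (a b : Wedge E U) : part e (a + b) = part e a + part e b := by
  rw [part, part, part, map_add, smul_add, ← mul_add]; congr 1; abel

theorem Wedge.res_part (h : V ≤ U) (e : ℤˣ) (a : Wedge E U) :
    res h (part e a) = part e (res h a) := by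
  rw [part, part, map_mul, map_add, map_units_smul, res_invol, res_fn]; rfl

theorem Wedge.part_one_add [CharZero K] (a : Wedge E U) : part 1 a + part (-1) a = a := by
  rw [part, part, ← mul_add, Units.neg_smul, one_smul, add_add_add_comm, add_neg_cancel, add_zero,
    half_add_half]

end Parity

end

/-! ### The Schouten bracket of arbitrary sections: degrees, antisymmetry, Jacobi identity -/

section

open Wedge WOp

/-- The derivation has degree `p - 1`. Shifting by one keeps degrees in `ℕ` while allowing `-1`; for
`p = 0` functions must be killed, their image having degree `-1`. -/
theorem WOp.IsDer.hasDegree {E : ModSheaf.{u, v, w} 𝒪} {U : Opens X} {ε : ℤˣ} {T : WOp E E U}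
    (hT : T.IsDer ε) (p : ℕ)
    (h₀ : ∀ (V : Opens X) (hV : V ≤ U) (f : 𝒪.Sec V) (k : ℕ), p = k + 1 →
      (T.app V hV (fn f)).HasDegree k)
    (h₀' : ∀ (V : Opens X) (hV : V ≤ U) (f : 𝒪.Sec V), p = 0 → T.app V hV (fn f) = 0)
    (h₁ : ∀ (V : Opens X) (hV : V ≤ U) (D : E.Sec V), (T.app V hV (ι D)).HasDegree p)
    {j : ℕ} {V : Opens X} (hV : V ≤ U) (a : Wedge E V) (ha : a.HasDegree j) {k : ℕ}
    (hk : p + j = k + 1) : (T.app V hV a).HasDegree k := by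
  refine hom_induction (U := U) (p := fun V hV j a => ∀ k, p + j = k + 1 →
    (T.app V hV a).HasDegree k) ?_ ?_ ?_ ?_ V hV j a ha k hk
  · intro V hV i a _ h k hk
    refine hasDegree_local fun x hx => ?_
    obtain ⟨W, hW, hxW, hd⟩ := h x hx
    exact ⟨W, hW, hxW, by rw [T.nat]; exact hd k hk⟩
  · intro V hV f k hk
    exact h₀ V hV f k hk
  · intro V hV i a b _ _ h h' k hk
    rw [map_add]; exact (h k hk).add (h' k hk)
  · intro V hV i D a ha h k hk
    rw [hT.ι_mul]
    obtain rfl : k = p + i := by omega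
    refine ((h₁ V hV D).mul ha).add (HasDegree.units_smul ?_ ε)
    -- If `p + i = 0`, then `a` is a function and the second Leibniz term vanishes; otherwise the
    -- induction hypothesis applies in degree `p + i - 1`.
    rcases Nat.eq_zero_or_pos (p + i) with h0 | h0
    · obtain ⟨f, rfl⟩ := HasDegree.exists_fn (a := a) (by convert ha; omega)
      rw [h₀' V hV f (by omega), mul_zero]
      exact hasDegree_zero _
    · obtain ⟨q, hq⟩ := Nat.exists_eq_add_of_lt h0
      have := (hasDegree_ι D).mul (h q (by omega))
      convert this using 1
      omega

theorem WOp.sgn_negOnePow (m n : ℤ) : (m * n).negOnePow = sgn m.negOnePow n.negOnePow := by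
  rcases Int.even_or_odd m with hm | hm
  · rw [Int.negOnePow_even _ hm, Int.negOnePow_even _ (hm.mul_right n)]; rfl
  · rw [Int.negOnePow_odd _ hm, sgn_neg_one_left]
    rcases Int.even_or_odd n with hn | hn
    · rw [Int.negOnePow_even _ hn, Int.negOnePow_even _ (hn.mul_left m)]
    · rw [Int.negOnePow_odd _ hn, Int.negOnePow_odd _ (hm.mul hn)]

theorem negOnePow_natCast (i : ℕ) : (i : ℤ).negOnePow = (-1) ^ i := rfl

theorem negOnePow_natCast_sub_one (i : ℕ) : ((i : ℤ) - 1).negOnePow = -(-1) ^ i := by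
  rw [Int.negOnePow_sub, Int.negOnePow_one, negOnePow_natCast, mul_neg_one]

theorem Wedge.invol_ι' {E : ModSheaf.{u, v, w} 𝒪} {U : Opens X} (D : E.Sec U) :
    invol (ι D) = (-1 : ℤˣ) • ι D := by rw [invol_ι, Units.neg_smul, one_smul]

theorem Wedge.tw_eq {E : ModSheaf.{u, v, w} 𝒪} {U : Opens X} {e e' : ℤˣ} {b : Wedge E U}
    (hb : invol b = e' • b) : tw e b = sgn e e' • b := by
  rcases Int.units_eq_one_or e with rfl | rfl
  · rw [tw_one, sgn_one_left, one_smul]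
  · rw [tw_neg_one, hb, sgn_neg_one_left]

namespace LieAlgebroid

variable {F : ModSheaf.{u, v, w} 𝒪} (𝓕 : LieAlgebroid F) {U V : Opens X}

/-- The operator `[c, ·]` for the component of `c` of parity `e`. -/
def ad (e : ℤˣ) (c : Wedge F U) : WOp F F U := (𝓕.exists_ad (invol_part e c)).choose

theorem ad_isDer (e : ℤˣ) (c : Wedge F U) : (𝓕.ad e c).IsDer (-e) :=
  (𝓕.exists_ad (invol_part e c)).choose_spec.1
theorem ad_hasParity (e : ℤˣ) (c : Wedge F U) : (𝓕.ad e c).HasParity (-e) :=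
  (𝓕.exists_ad (invol_part e c)).choose_spec.2.1
theorem ad_fn (e : ℤˣ) (c : Wedge F U) (hV : V ≤ U) (g : 𝒪.Sec V) :
    (𝓕.ad e c).app V hV (fn g) = e • 𝓕.brFn g (res hV (part e c)) :=
  (𝓕.exists_ad (invol_part e c)).choose_spec.2.2.1 V hV g
theorem ad_ι (e : ℤˣ) (c : Wedge F U) (hV : V ≤ U) (D : F.Sec V) :
    (𝓕.ad e c).app V hV (ι D) = -𝓕.brSec D (res hV (part e c)) :=
  (𝓕.exists_ad (invol_part e c)).choose_spec.2.2.2 V hV D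

theorem ad_restr (e : ℤˣ) (c : Wedge F U) (h : V ≤ U) :
    (𝓕.ad e c).restr h = 𝓕.ad e (res h c) :=
  ((𝓕.ad_isDer e c).restr h).ext (𝓕.ad_isDer _ _)
    (fun W hW g => by rw [restr_app, ad_fn, ad_fn, res_part, res_part, res_res])
    (fun W hW D => by rw [restr_app, ad_ι, ad_ι, res_part, res_part, res_res])

theorem ad_add (e : ℤˣ) (a b : Wedge F U) : 𝓕.ad e (a + b) = 𝓕.ad e a + 𝓕.ad e b :=
  (𝓕.ad_isDer e _).ext ((𝓕.ad_isDer _ _).add (𝓕.ad_isDer _ _))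
    (fun W hW g => by
      rw [add_app, ad_fn, ad_fn, ad_fn, part_add, map_add, map_add, smul_add])
    (fun W hW D => by
      rw [add_app, ad_ι, ad_ι, ad_ι, part_add, map_add, map_add, neg_add])

theorem ad_neg_eq_zero {e : ℤˣ} {c : Wedge F U} (hc : invol c = e • c) : 𝓕.ad (-e) c = 0 :=
  (𝓕.ad_isDer _ _).ext (isDer_zero _)
    (fun W hW g => by
      rw [ad_fn, part_neg_eq hc, map_zero, map_zero, smul_zero, zero_app])
    (fun W hW D => by
      rw [ad_ι, part_neg_eq hc, map_zero, map_zero, neg_zero, zero_app])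

/-- The Schouten bracket with `c` as an operator. -/
def opBr (c : Wedge F U) : WOp F F U := 𝓕.ad 1 c + 𝓕.ad (-1) c

theorem opBr_eq {e : ℤˣ} {c : Wedge F U} (hc : invol c = e • c) : 𝓕.opBr c = 𝓕.ad e c := by
  have h := 𝓕.ad_neg_eq_zero hc
  rcases Int.units_eq_one_or e with rfl | rfl
  · rw [opBr, h, add_zero]
  · rw [neg_neg] at h; rw [opBr, h, zero_add]

theorem opBr_isDer {e : ℤˣ} {c : Wedge F U} (hc : invol c = e • c) : (𝓕.opBr c).IsDer (-e) :=
  𝓕.opBr_eq hc ▸ 𝓕.ad_isDer e c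
theorem opBr_hasParity {e : ℤˣ} {c : Wedge F U} (hc : invol c = e • c) :
    (𝓕.opBr c).HasParity (-e) := 𝓕.opBr_eq hc ▸ 𝓕.ad_hasParity e c

theorem opBr_restr (c : Wedge F U) (h : V ≤ U) : (𝓕.opBr c).restr h = 𝓕.opBr (res h c) := by
  rw [opBr, opBr, ← ad_restr, ← ad_restr]; rfl

/-- The Schouten bracket. -/
def br (c : Wedge F U) : Wedge F U →+ Wedge F U := (𝓕.opBr c).app U le_rfl

theorem opBr_app (c : Wedge F U) (h : V ≤ U) (a : Wedge F V) :
    (𝓕.opBr c).app V h a = 𝓕.br (res h c) a := by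
  rw [br, ← opBr_restr]; rfl

theorem res_br (h : V ≤ U) (c a : Wedge F U) : res h (𝓕.br c a) = 𝓕.br (res h c) (res h a) := by
  rw [← opBr_app]; exact (𝓕.opBr c).nat U V le_rfl h a

theorem br_add_left (a b c : Wedge F U) : 𝓕.br (a + b) c = 𝓕.br a c + 𝓕.br b c := by
  change (𝓕.opBr (a + b)).app U le_rfl c = (𝓕.opBr a + 𝓕.opBr b).app U le_rfl c
  rw [opBr, opBr, opBr, ad_add, ad_add, add_add_add_comm]

theorem br_neg_left (a c : Wedge F U) : 𝓕.br (-a) c = -𝓕.br a c :=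
  map_neg (AddMonoidHom.mk' (fun a => 𝓕.br a c) fun a b => 𝓕.br_add_left a b c) a

theorem br_units_smul_left (e : ℤˣ) (a c : Wedge F U) : 𝓕.br (e • a) c = e • 𝓕.br a c :=
  map_units_smul (AddMonoidHom.mk' (fun a => 𝓕.br a c) fun a b => 𝓕.br_add_left a b c) e a

theorem br_mul {e : ℤˣ} {c : Wedge F U} (hc : invol c = e • c) (a b : Wedge F U) :
    𝓕.br c (a * b) = 𝓕.br c a * b + tw (-e) a * 𝓕.br c b := 𝓕.opBr_isDer hc U le_rfl a b

theorem invol_br {e : ℤˣ} {c : Wedge F U} (hc : invol c = e • c) (a : Wedge F U) :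
    invol (𝓕.br c a) = (-e) • 𝓕.br c (invol a) := 𝓕.opBr_hasParity hc U le_rfl a

theorem hasDegree_brFn (f : 𝒪.Sec U) {i k : ℕ} {a : Wedge F U} (ha : a.HasDegree i)
    (hk : i = k + 1) : (𝓕.brFn f a).HasDegree k :=
  (𝓕.opFn_isDer f).hasDegree 0 (by omega) (fun V hV g _ => 𝓕.opFn_fn f hV g)
    (fun V hV D => by rw [opFn_ι]; exact (hasDegree_fn _).neg) le_rfl a ha (by omega)

theorem hasDegree_brSec (D : F.Sec U) {i : ℕ} {a : Wedge F U} (ha : a.HasDegree i) :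
    (𝓕.brSec D a).HasDegree i :=
  (𝓕.opSec_isDer D).hasDegree 1 (fun V hV g k hk => by
      obtain rfl : k = 0 := by omega
      rw [opSec_fn]; exact hasDegree_fn _) (by omega)
    (fun V hV D => by rw [opSec_ι]; exact hasDegree_ι _) le_rfl a ha (by omega)

section

variable [CharZero K]

-- The sign `e` on the component of parity `e` assembles to the grading automorphism, which gives a
-- formula free of parity assumptions.
@[simp] theorem br_fn (c : Wedge F U) (g : 𝒪.Sec U) : 𝓕.br c (fn g) = 𝓕.brFn g (invol c) := by
  have : invol c = part 1 c - part (-1) c := by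
    conv_lhs => rw [← part_one_add c]
    rw [map_add, invol_part, invol_part, one_smul, Units.neg_smul, one_smul, sub_eq_add_neg]
  change (𝓕.ad 1 c).app U le_rfl (fn g) + (𝓕.ad (-1) c).app U le_rfl (fn g) = _
  rw [ad_fn, ad_fn, this, map_sub, one_smul, Units.neg_smul, one_smul, sub_eq_add_neg]; rfl

@[simp] theorem br_ι (c : Wedge F U) (D : F.Sec U) : 𝓕.br c (ι D) = -𝓕.brSec D c := by
  change (𝓕.ad 1 c).app U le_rfl (ι D) + (𝓕.ad (-1) c).app U le_rfl (ι D) = _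
  conv_rhs => rw [← part_one_add c]
  rw [ad_ι, ad_ι, map_add, neg_add]; rfl

theorem fn_br (f : 𝒪.Sec U) (a : Wedge F U) : 𝓕.br (fn f) a = 𝓕.brFn f a :=
  congr_app (S := 𝓕.opBr (fn f)) (T := 𝓕.opFn f)
    ((𝓕.opBr_isDer (e := 1) (by simp)).ext (𝓕.opFn_isDer f)
      (fun V hV g => by simp [opBr_app, opFn_app]) fun V hV D => by
        simp [opBr_app, opFn_app]) a

theorem ι_br (D : F.Sec U) (a : Wedge F U) : 𝓕.br (ι D) a = 𝓕.brSec D a :=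
  congr_app (S := 𝓕.opBr (ι D)) (T := 𝓕.opSec D)
    ((𝓕.opBr_isDer (invol_ι' D)).ext (𝓕.opSec_isDer D)
      (fun V hV g => by
        rw [opBr_app, opSec_app, br_fn, brSec_fn, res_ι, invol_ι, map_neg, brFn_ι, neg_neg])
      fun V hV D' => by
        rw [opBr_app, opSec_app, br_ι, brSec_ι, res_ι, brSec_ι, 𝓕.lie_swap, ι_neg, neg_neg]) a

/-- The Leibniz rule in the left argument, needed for the induction on `b` in the proof of
antisymmetry. For `b` of definite parity both sides are derivations in `c`. -/
theorem ι_mul_br (D : F.Sec U) (b c : Wedge F U) :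
    𝓕.br (ι D * b) c = ι D * 𝓕.br b c + invol b * 𝓕.brSec D c := by
  have key : ∀ (e : ℤˣ) (b : Wedge F U), invol b = e • b →
      𝓕.br (ι D * b) c = ι D * 𝓕.br b c + invol b * 𝓕.brSec D c := by
    intro e b hb
    have hD := invol_ι' D
    have h₁ := (𝓕.opBr_isDer (e := -e) (c := ι D * b) (by
      rw [map_mul, hb, hD, Units.neg_smul, Units.neg_smul, one_smul, neg_mul, mul_smul_comm]))
    have h₂ := (𝓕.opBr_isDer hb).lmul_mul hD
    have h₃ := (𝓕.opSec_isDer D).lmul_mul (x := invol b) (e := e) (by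
      rw [invol_invol, hb, smul_smul, Int.units_mul_self, one_smul])
    rw [neg_one_mul] at h₂
    rw [mul_one] at h₃
    rw [neg_neg] at h₁ h₂
    refine congr_app (h₁.ext (h₂.add h₃) (fun V hV g => ?_) fun V hV D' => ?_) c
    · simp only [opBr_app, opSec_app, add_app, mul_app, lmul_app, br_fn, map_mul, res_ι, invol_ι,
        brFn_mul, res_invol, brSec_fn, map_neg, brFn_ι, neg_mul]
      rw [fn_comm, neg_add, neg_neg, neg_neg, add_comm]
    · simp only [opBr_app, opSec_app, add_app, mul_app, lmul_app, br_ι, map_mul, res_ι,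
        brSec_mul, res_invol, brSec_ι, mul_neg]
      rw [← ι_mul_eq, 𝓕.lie_swap D', ι_neg, neg_mul]; abel
  have h1 := key 1 (part 1 b) (invol_part _ _)
  have h2 := key (-1) (part (-1) b) (invol_part _ _)
  rw [← part_one_add b, mul_add, br_add_left, br_add_left, h1, h2, map_add]
  noncomm_ring

/-- Graded antisymmetry of the Schouten bracket. -/
theorem br_antisymm {e : ℤˣ} {a : Wedge F U} (ha : invol a = e • a) (b : Wedge F U) :
    𝓕.br a b = e • 𝓕.br (tw (-e) b) a := by
  -- `tw (-e)` encodes the antisymmetry sign without a parity assumption on `b`, so the right side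
  -- is an operator in `b`, accessible to `ext_gen`.
  let T : WOp F F U := ⟨fun V hV => AddMonoidHom.mk' (fun b => e • 𝓕.br (tw (-e) b) (res hV a))
    fun b c => by rw [map_add, br_add_left, smul_add], fun V W hV hW b => by
      change res hW (e • _) = e • _
      rw [map_units_smul, res_br, res_tw]; rfl⟩
  have hT : ∀ (V : Opens X) (hV : V ≤ U) (b : Wedge F V),
    T.app V hV b = e • 𝓕.br (tw (-e) b) (res hV a) := fun _ _ _ => rfl
  refine congr_app (S := 𝓕.opBr a) (T := T) (ext_gen (fun V hV f => ?_) fun V hV D b h => ?_) b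
  · rw [hT, opBr_app, br_fn, tw_fn, fn_br, ← res_invol, ha, map_units_smul, map_units_smul]
  · have hV' : invol (res hV a) = e • res hV a := by rw [← res_invol, ha, map_units_smul]
    have hx : invol (𝓕.brSec D (res hV a)) = e • 𝓕.brSec D (res hV a) := by
      rw [invol_brSec, hV', map_units_smul]
    rw [hT, opBr_app] at h ⊢
    rw [br_mul _ hV', h, br_ι, map_mul]
    rcases Int.units_eq_one_or e with rfl | rfl
    · have := comm_of_invol_eq hx b
      rw [tw_one] at this
      simp only [one_smul, tw_neg_one, invol_ι, neg_mul, br_neg_left, ι_mul_br, invol_invol, this]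
      rw [neg_add_rev, ← sub_eq_add_neg]
    · have := comm_of_invol_eq hx (invol b)
      rw [tw_neg_one, invol_invol] at this
      simp only [neg_neg, tw_one, Units.neg_smul, one_smul, ι_mul_br, this]
      rw [neg_add_rev, mul_neg, neg_mul]

/-- The Jacobi identity with first entry a function. As derivations in `x` the two sides agree on
functions by `brFn_brFn` and on sections by `brSec_brFn`. -/
theorem brFn_br {e : ℤˣ} {a : Wedge F U} (ha : invol a = e • a) (f : 𝒪.Sec U) (x : Wedge F U) :
    𝓕.brFn f (𝓕.br a x) + e • 𝓕.br a (𝓕.brFn f x) = 𝓕.br (𝓕.brFn f a) x := by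
  have h := (𝓕.opFn_isDer f).commutator (𝓕.opBr_isDer ha) (𝓕.opFn_hasParity f)
    (𝓕.opBr_hasParity ha)
  have h' := 𝓕.opBr_isDer (c := 𝓕.brFn f a) (e := -e) (by
    rw [invol_brFn, ha, map_units_smul, Units.neg_smul])
  rw [sgn_neg_one_left, Units.neg_smul, sub_neg_eq_add, neg_one_mul] at h
  suffices key : 𝓕.opFn f * 𝓕.opBr a + e • (𝓕.opBr a * 𝓕.opFn f) = 𝓕.opBr (𝓕.brFn f a) by
    have := congr_app key x
    rwa [add_app, units_smul_app] at this
  refine h.ext h' (fun V hV g => ?_) fun V hV D => ?_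
  · have hV' : invol (res hV a) = e • res hV a := by rw [← res_invol, ha, map_units_smul]
    simp only [opBr_app, opFn_app, add_app, mul_app, units_smul_app, br_fn, brFn_fn, map_zero,
      smul_zero, add_zero, res_brFn, invol_brFn, hV', map_units_smul]
    rw [eq_neg_of_add_eq_zero_left (𝓕.brFn_brFn (𝒪.res hV f) g (res hV a)), smul_neg,
      map_neg, map_units_smul]
  · have hV' : invol (res hV a) = e • res hV a := by rw [← res_invol, ha, map_units_smul]
    simp only [opBr_app, opFn_app, add_app, mul_app, units_smul_app, br_ι, brFn_ι, map_neg,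
      br_fn, res_brFn, hV', map_units_smul, smul_neg, smul_smul, Int.units_mul_self, one_smul]
    rw [← brSec_brFn]; abel

theorem brSec_br {e : ℤˣ} {a : Wedge F U} (ha : invol a = e • a) (D : F.Sec U) (x : Wedge F U) :
    𝓕.brSec D (𝓕.br a x) - 𝓕.br a (𝓕.brSec D x) = 𝓕.br (𝓕.brSec D a) x := by
  have h := (𝓕.opSec_isDer D).commutator (𝓕.opBr_isDer ha) (𝓕.opSec_hasParity D)
    (𝓕.opBr_hasParity ha)
  have h' := 𝓕.opBr_isDer (c := 𝓕.brSec D a) (e := e) (by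
    rw [invol_brSec, ha, map_units_smul])
  rw [sgn_one_left, one_smul, one_mul] at h
  refine congr_app (h.ext h' (fun V hV g => ?_) fun V hV D' => ?_) x
  · have hV' : invol (res hV a) = e • res hV a := by rw [← res_invol, ha, map_units_smul]
    simp only [opBr_app, opSec_app, sub_app, mul_app, br_fn, brSec_fn,
      res_brSec, invol_brSec, hV', map_units_smul, ← smul_sub]
    rw [← brSec_brFn]; congr 1; abel
  · have hV' : invol (res hV a) = e • res hV a := by rw [← res_invol, ha, map_units_smul]
    simp only [opBr_app, opSec_app, sub_app, mul_app, br_ι, brSec_ι, map_neg, res_brSec]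
    rw [← brSec_brSec]; abel

/-- Antisymmetry puts the previous identity into the shape met when the general Jacobi identity is
evaluated on a function; `brSec_br'` does the same for a section. -/
theorem brFn_br' {e e' : ℤˣ} {a b : Wedge F U} (ha : invol a = e • a) (hb : invol b = e' • b)
    (f : 𝒪.Sec U) : 𝓕.brFn f (𝓕.br a b) + e • 𝓕.br a (𝓕.brFn f b) =
      -(e * sgn e e') • 𝓕.br b (𝓕.brFn f a) := by
  have hx : invol (𝓕.brFn f a) = (-e) • 𝓕.brFn f a := by
    rw [invol_brFn, ha, map_units_smul, Units.neg_smul]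
  rw [brFn_br 𝓕 ha, 𝓕.br_antisymm hx, neg_neg, tw_eq hb, br_units_smul_left, smul_smul, neg_mul]

theorem brSec_br' {e e' : ℤˣ} {a b : Wedge F U} (ha : invol a = e • a) (hb : invol b = e' • b)
    (D : F.Sec U) : 𝓕.brSec D (𝓕.br a b) - 𝓕.br a (𝓕.brSec D b) =
      (e * sgn (-e) e') • 𝓕.br b (𝓕.brSec D a) := by
  have hx : invol (𝓕.brSec D a) = e • 𝓕.brSec D a := by
    rw [invol_brSec, ha, map_units_smul]
  rw [brSec_br 𝓕 ha, 𝓕.br_antisymm hx, tw_eq hb, br_units_smul_left, smul_smul]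

/-- The graded Jacobi identity of the Schouten bracket. -/
theorem br_jacobi {e e' : ℤˣ} {a b : Wedge F U} (ha : invol a = e • a) (hb : invol b = e' • b)
    (x : Wedge F U) :
    𝓕.br a (𝓕.br b x) - sgn (-e) (-e') • 𝓕.br b (𝓕.br a x) = 𝓕.br (𝓕.br a b) x := by
  have h := (𝓕.opBr_isDer ha).commutator (𝓕.opBr_isDer hb) (𝓕.opBr_hasParity ha)
    (𝓕.opBr_hasParity hb)
  have hab : ∀ {V : Opens X} {a b : Wedge F V}, invol a = e • a → invol b = e' • b →
      invol (𝓕.br a b) = (-(e * e')) • 𝓕.br a b := fun ha hb => by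
    rw [invol_br _ ha, hb, map_units_smul, smul_smul, neg_mul]
  have h' := 𝓕.opBr_isDer (hab ha hb)
  rw [neg_mul_neg] at h
  rw [neg_neg] at h'
  suffices key : 𝓕.opBr a * 𝓕.opBr b - sgn (-e) (-e') • (𝓕.opBr b * 𝓕.opBr a) =
      𝓕.opBr (𝓕.br a b) by
    have := congr_app key x
    rwa [sub_app, units_smul_app] at this
  -- Sign bookkeeping over the four pairs of parities. Here `p`, `q`, `r` stand for `[a, [g, b]]`,
  -- `[b, [g, a]]`, `[g, [a, b]]`; in `aux₂` a section replaces `g`.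
  have aux₁ : ∀ {A : Type (max u v w)} [AddCommGroup A] (p q r : A),
      r + e • p = -(e * sgn e e') • q →
      e' • p - sgn (-e) (-e') • e • q = (-(e * e')) • r := by
    intro A _ p q r h
    rw [eq_sub_of_add_eq h]
    rcases Int.units_eq_one_or e with rfl | rfl <;> rcases Int.units_eq_one_or e' with rfl | rfl <;>
    simp [sgn_one_left, sgn_neg_one_left, Units.neg_smul] <;> abel
  have aux₂ : ∀ {A : Type (max u v w)} [AddCommGroup A] (p q r : A),
      r - p = (e * sgn (-e) e') • q → -p - sgn (-e) (-e') • -q = -r := by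
    intro A _ p q r h
    rw [sub_eq_iff_eq_add.1 h]
    rcases Int.units_eq_one_or e with rfl | rfl <;> rcases Int.units_eq_one_or e' with rfl | rfl <;>
    simp [sgn_one_left, sgn_neg_one_left, Units.neg_smul] <;> abel
  refine h.ext h' (fun V hV g => ?_) fun V hV D => ?_
  · have ha' : invol (res hV a) = e • res hV a := by rw [← res_invol, ha, map_units_smul]
    have hb' : invol (res hV b) = e' • res hV b := by rw [← res_invol, hb, map_units_smul]
    simp only [sub_app, mul_app, opBr_app, units_smul_app, br_fn, res_br]
    rw [hab ha' hb', ha', hb', map_units_smul, map_units_smul, map_units_smul, map_units_smul,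
      map_units_smul]
    exact aux₁ _ _ _ (𝓕.brFn_br' ha' hb' g)
  · have ha' : invol (res hV a) = e • res hV a := by rw [← res_invol, ha, map_units_smul]
    have hb' : invol (res hV b) = e' • res hV b := by rw [← res_invol, hb, map_units_smul]
    simp only [sub_app, mul_app, opBr_app, units_smul_app, br_ι, res_br, map_neg]
    exact aux₂ _ _ _ (𝓕.brSec_br' ha' hb' D)

theorem hasDegree_br {i j k : ℕ} {a b : Wedge F U} (ha : a.HasDegree i) (hb : b.HasDegree j)
    (hk : i + j = k + 1) : (𝓕.br a b).HasDegree k :=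
  (𝓕.opBr_isDer ha.invol).hasDegree i (fun V hV g k hk => by
      rw [opBr_app, br_fn, (ha.res hV).invol, map_units_smul]
      exact (𝓕.hasDegree_brFn g (ha.res hV) hk).units_smul _)
    (fun V hV g hi => by
      subst hi
      obtain ⟨f, rfl⟩ := ha.exists_fn
      simp [opBr_app])
    (fun V hV D => by
      rw [opBr_app, br_ι]; exact (𝓕.hasDegree_brSec D (ha.res hV)).neg) le_rfl b hb hk

/-- The Schouten bracket as a Gerstenhaber bracket. -/
def schoutenBracket : GerstenhaberBracket F where
  br a b := 𝓕.br a b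
  br_res h a b := 𝓕.res_br h a b
  add_br := 𝓕.br_add_left
  br_add a b b' := map_add _ _ _
  smul_br := by
    intro U c a b
    have h : ∀ e : ℤˣ, 𝓕.ad e (fn (algebraMap K (𝒪.Sec U) c) * a) =
        lmul (fn (algebraMap K (𝒪.Sec U) c)) * 𝓕.ad e a := by
      intro e
      have hp : part e (fn (algebraMap K (𝒪.Sec U) c) * a) =
          fn (algebraMap K (𝒪.Sec U) c) * part e a := by
        rw [part, part, map_mul, invol_fn, ← mul_smul_comm, ← mul_add, fn_left_comm]
      refine (𝓕.ad_isDer _ _).ext (by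
          simpa using (𝓕.ad_isDer e a).lmul_mul (x := fn (algebraMap K (𝒪.Sec U) c)) (e := 1)
            (by simp))
        (fun V hV g => ?_) fun V hV D => ?_
      · rw [mul_app, lmul_app, ad_fn, ad_fn, hp, map_mul, brFn_mul]
        simp [mul_smul_comm]
      · rw [mul_app, lmul_app, ad_ι, ad_ι, hp, map_mul, brSec_mul]
        simp
    change (𝓕.opBr _).app U le_rfl b = fn _ * (𝓕.opBr _).app U le_rfl b
    rw [opBr, h, h, ← mul_add]; rfl
  br_smul := by
    intro U c a b
    have h : ∀ e : ℤˣ, (𝓕.ad e a).app U le_rfl (fn (algebraMap K (𝒪.Sec U) c) * b) =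
        fn (algebraMap K (𝒪.Sec U) c) * (𝓕.ad e a).app U le_rfl b := by
      intro e
      rw [(𝓕.ad_isDer e a).fn_mul, ad_fn]
      -- Constants are killed by every `𝔞(D)`, which makes the bracket `K`-linear in the right
      -- argument.
      have : 𝓕.brFn (algebraMap K (𝒪.Sec U) c) (part e a) = 0 := by
        refine congr_app (S := 𝓕.opFn (algebraMap K (𝒪.Sec U) c)) (T := 0)
          ((𝓕.opFn_isDer _).ext (isDer_zero _) (fun V hV g => ?_) fun V hV D => ?_) _
        · rw [opFn_fn]; rfl
        · rw [opFn_ι]; simp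
      rw [res_rfl, this, smul_zero, zero_mul, zero_add]
    change (𝓕.ad 1 a + 𝓕.ad (-1) a).app U le_rfl (_ * b) =
      _ * (𝓕.ad 1 a + 𝓕.ad (-1) a).app U le_rfl b
    rw [add_app, h, h, ← mul_add, add_app]
  degree a b ha hb hk := 𝓕.hasDegree_br ha hb hk
  degree_zero a b ha hb := by
    obtain ⟨f, rfl⟩ := ha.exists_fn
    obtain ⟨g, rfl⟩ := hb.exists_fn
    simp
  antisymm := by
    intro U i j a b ha hb
    rw [sgn_negOnePow, negOnePow_natCast_sub_one, negOnePow_natCast_sub_one,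
      𝓕.br_antisymm ha.invol]
    have := hb.invol
    rcases Int.units_eq_one_or ((-1) ^ i) with h | h <;> rw [h]
    · rw [tw_neg_one, this, br_units_smul_left, sgn_neg_one_left, one_smul, neg_neg]
    · rw [neg_neg, tw_one, sgn_one_left, Units.neg_smul, one_smul]
  jacobi := by
    intro U i j a b c ha hb
    rw [sgn_negOnePow, negOnePow_natCast_sub_one, negOnePow_natCast_sub_one,
      ← 𝓕.br_jacobi ha.invol hb.invol, sub_add_cancel]
  leibniz := by
    intro U i j a b c ha hb
    rw [sgn_negOnePow, negOnePow_natCast_sub_one, negOnePow_natCast, 𝓕.br_mul ha.invol]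
    have := hb.invol
    rcases Int.units_eq_one_or ((-1) ^ i) with h | h <;> rw [h]
    · rw [tw_neg_one, this, sgn_neg_one_left, smul_mul_assoc]
    · rw [neg_neg, tw_one, sgn_one_left, one_smul]

theorem isSchouten_schoutenBracket : IsSchouten 𝓕 𝓕.schoutenBracket :=
  ⟨fun U D D' => by change 𝓕.br _ _ = _; rw [ι_br, brSec_ι],
    fun U D f => by change 𝓕.br _ _ = _; rw [ι_br, brSec_fn]⟩

end

end LieAlgebroid

end

/-! ### Gerstenhaber brackets are determined on generators -/

section

open Wedge WOp

namespace GerstenhaberBracket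

variable {E : ModSheaf.{u, v, w} 𝒪} (β : GerstenhaberBracket E) {U : Opens X}

/-- The operator `[a, ·]`. -/
def ad (a : Wedge E U) : WOp E E U :=
  ⟨fun V hV => AddMonoidHom.mk' (β.br (res hV a)) (β.br_add _), fun V W hV hW b => by
    change res hW (β.br _ _) = _; rw [β.br_res]; rfl⟩

@[simp] theorem ad_app (a : Wedge E U) (V : Opens X) (hV : V ≤ U) (b : Wedge E V) :
    (β.ad a).app V hV b = β.br (res hV a) b := rfl

/-- The operator `[·, b]`. -/
def adRight (b : Wedge E U) : WOp E E U :=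
  ⟨fun V hV => AddMonoidHom.mk' (fun a => β.br a (res hV b)) fun a a' => β.add_br a a' _,
    fun V W hV hW a => by change res hW (β.br _ _) = _; rw [β.br_res]; rfl⟩

@[simp] theorem adRight_app (b : Wedge E U) (V : Opens X) (hV : V ≤ U) (a : Wedge E V) :
    (β.adRight b).app V hV a = β.br a (res hV b) := rfl

theorem ad_isDer {i : ℕ} {a : Wedge E U} (ha : a.HasDegree i) : (β.ad a).IsDer (-(-1) ^ i) := by
  refine IsDer.of_gen (fun V hV f b => ?_) fun V hV D b => ?_
  · have := β.leibniz _ _ b (ha.res hV) (hasDegree_fn f)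
    rw [Nat.cast_zero, mul_zero, Int.negOnePow_zero, one_smul] at this
    exact this
  · have := β.leibniz _ _ b (ha.res hV) (hasDegree_ι D)
    rw [Nat.cast_one, mul_one, negOnePow_natCast_sub_one] at this
    exact this

@[simp] theorem br_zero (a : Wedge E U) : β.br a 0 = 0 := map_zero ((β.ad a).app U le_rfl)
@[simp] theorem zero_br (b : Wedge E U) : β.br 0 b = 0 := map_zero ((β.adRight b).app U le_rfl)

@[simp] theorem br_fn_fn (f g : 𝒪.Sec U) : β.br (fn f) (fn g) = 0 :=
  β.degree_zero _ _ (hasDegree_fn f) (hasDegree_fn g)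

theorem br_fn_ι (f : 𝒪.Sec U) (D : E.Sec U) : β.br (fn f) (ι D) = -β.br (ι D) (fn f) := by
  rw [β.antisymm _ _ (hasDegree_fn f) (hasDegree_ι D)]
  simp

/-- A Gerstenhaber bracket is determined by its values on functions and sections of `E`. -/
theorem ext_gen {β β' : GerstenhaberBracket E}
    (h₀ : ∀ (U : Opens X) (D : E.Sec U) (f : 𝒪.Sec U),
      β.br (ι D) (fn f) = β'.br (ι D) (fn f))
    (h₁ : ∀ (U : Opens X) (D D' : E.Sec U), β.br (ι D) (ι D') = β'.br (ι D) (ι D')) :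
    β = β' := by
  have hD : ∀ (U : Opens X) (D : E.Sec U), β.ad (ι D) = β'.ad (ι D) := fun U D =>
    (β.ad_isDer (hasDegree_ι D)).ext (β'.ad_isDer (hasDegree_ι D))
      (fun V hV f => by simp [h₀]) (fun V hV D' => by simp [h₁])
  have hf : ∀ (U : Opens X) (f : 𝒪.Sec U), β.ad (fn f) = β'.ad (fn f) := fun U f =>
    (β.ad_isDer (hasDegree_fn f)).ext (β'.ad_isDer (hasDegree_fn f))
      (fun V hV f => by simp) (fun V hV D' => by simp [br_fn_ι, h₀])
  -- On a generator, antisymmetry exchanges the homogeneous `a` with the generator, and this case is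
  -- settled by `hD` and `hf`.
  have ha : ∀ (U : Opens X) (i : ℕ) (a : Wedge E U), a.HasDegree i → β.ad a = β'.ad a := by
    intro U i a ha
    refine (β.ad_isDer ha).ext (β'.ad_isDer ha) (fun V hV f => ?_) fun V hV D => ?_
    · rw [ad_app, ad_app, β.antisymm _ _ (ha.res hV) (hasDegree_fn f),
        β'.antisymm _ _ (ha.res hV) (hasDegree_fn f)]
      have := congr_app (hf V f) (res hV a)
      rw [ad_app, ad_app, res_rfl] at this
      rw [this]
    · rw [ad_app, ad_app, β.antisymm _ _ (ha.res hV) (hasDegree_ι D),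
        β'.antisymm _ _ (ha.res hV) (hasDegree_ι D)]
      have := congr_app (hD V D) (res hV a)
      rw [ad_app, ad_app, res_rfl] at this
      rw [this]
  refine GerstenhaberBracket.ext ?_
  funext U a b
  have : β.adRight b = β'.adRight b := ext_hom fun V hV i a h => by
    exact congr_app (ha V i a h) (res hV b)
  exact congr_app this a

end GerstenhaberBracket

variable {F : ModSheaf.{u, v, w} 𝒪}

theorem IsSchouten.unique {𝓕 : LieAlgebroid F} {β β' : GerstenhaberBracket F}
    (h : IsSchouten 𝓕 β) (h' : IsSchouten 𝓕 β') : β = β' :=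
  GerstenhaberBracket.ext_gen (fun U D f => by rw [h.2, h'.2]) fun U D D' => by rw [h.1, h'.1]

theorem existsUnique_isSchouten [CharZero K] (𝓕 : LieAlgebroid F) : ∃! β, IsSchouten 𝓕 β :=
  ⟨_, 𝓕.isSchouten_schoutenBracket, fun _ h => h.unique 𝓕.isSchouten_schoutenBracket⟩

theorem isSchouten_schouten [CharZero K] (𝓕 : LieAlgebroid F) : IsSchouten 𝓕 (schouten 𝓕) :=
  Classical.epsilon_spec (existsUnique_isSchouten 𝓕).exists

end

section

open Wedge WOp

theorem Wedge.eq_zero_of_nsmul {E : ModSheaf.{u, v, w} 𝒪} {U : Opens X} [CharZero K] {n : ℕ}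
    (hn : n ≠ 0) {a : Wedge E U} (h : n • a = 0) : a = 0 := by
  have h1 : n • a = fn (algebraMap K (𝒪.Sec U) n) * a := by
    rw [map_natCast, ← fnHom_apply, map_natCast, nsmul_eq_mul]
  have h2 : (fn (algebraMap K (𝒪.Sec U) (n : K)⁻¹) : Wedge E U) * fn (algebraMap K (𝒪.Sec U) n) =
      1 := by
    rw [← fn_mul, ← map_mul, inv_mul_cancel₀ (Nat.cast_ne_zero.2 hn), map_one, fn_one]
  rw [← one_mul a, ← h2, mul_assoc, ← h1, h, mul_zero]

/-! ## Perfect pairings -/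

namespace Pairing

variable {E : ModSheaf.{u, v, w} 𝒪} {F : ModSheaf.{u, v, w'} 𝒪} (p : Pairing E F)

/-- The frames `e` of `E` and `ε` of `F` over `U` are dual to each other. -/
structure IsDualOn {U : Opens X} {n : ℕ} (e : Fin n → E.Sec U) (ε : Fin n → F.Sec U) : Prop where
  pair_eq : ∀ i j, p.pair (e i) (ε j) = if i = j then 1 else 0
  left : ∀ (V : Opens X) (hV : V ≤ U) (D : E.Sec V),
    D = ∑ j, p.pair D (F.res hV (ε j)) • E.res hV (e j)
  right : ∀ (V : Opens X) (hV : V ≤ U) (ξ : F.Sec V),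
    ξ = ∑ j, p.pair (E.res hV (e j)) ξ • F.res hV (ε j)

/-- The pairing is perfect: locally there are dual frames. -/
def IsPerfect : Prop := ∀ x : X, ∃ (U : Opens X) (n : ℕ) (e : Fin n → E.Sec U)
  (ε : Fin n → F.Sec U), x ∈ U ∧ p.IsDualOn e ε

variable {p} {U V : Opens X}

theorem IsDualOn.res {n : ℕ} {e : Fin n → E.Sec U} {ε : Fin n → F.Sec U} (h : p.IsDualOn e ε)
    (hV : V ≤ U) : p.IsDualOn (fun i => E.res hV (e i)) (fun i => F.res hV (ε i)) where
  pair_eq i j := by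
    rw [p.pair_res, h.pair_eq]; split_ifs <;> simp
  left W hW D := by
    simp only [E.res_res, F.res_res]; exact h.left W _ D
  right W hW D := by
    simp only [E.res_res, F.res_res]; exact h.right W _ D

theorem IsDualOn.flip {n : ℕ} {e : Fin n → E.Sec U} {ε : Fin n → F.Sec U} (h : p.IsDualOn e ε) :
    p.flip.IsDualOn ε e where
  pair_eq i j := by
    change p.pair (e j) (ε i) = _
    rw [h.pair_eq]; simp only [eq_comm]
  left := h.right
  right := h.left

theorem IsDualOn.isFreeOn {n : ℕ} {e : Fin n → E.Sec U} {ε : Fin n → F.Sec U}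
    (h : p.IsDualOn e ε) : E.IsFreeOn U n := by
  refine ⟨e, fun V hV => ⟨fun c c' hc => funext fun i => ?_, fun D => ⟨_, (h.left V hV D).symm⟩⟩⟩
  have := congrArg (fun D => p.pair D (F.res hV (ε i))) hc
  simpa [(h.res hV).pair_eq] using this

theorem IsPerfect.flip (h : p.IsPerfect) : p.flip.IsPerfect := fun x => by
  obtain ⟨U, n, e, ε, hx, hd⟩ := h x
  exact ⟨U, n, ε, e, hx, hd.flip⟩

theorem IsPerfect.exists_le (h : p.IsPerfect) {x : X} (hx : x ∈ U) :
    ∃ (V : Opens X) (_ : V ≤ U) (n : ℕ) (e : Fin n → E.Sec V) (ε : Fin n → F.Sec V),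
      x ∈ V ∧ p.IsDualOn e ε := by
  obtain ⟨V, n, e, ε, hxV, hd⟩ := h x
  exact ⟨U ⊓ V, inf_le_left, n, _, _, ⟨hx, hxV⟩, hd.res inf_le_right⟩

theorem IsPerfect.ext_left (h : p.IsPerfect) {D D' : E.Sec U}
    (H : ∀ (V : Opens X) (hV : V ≤ U) (ξ : F.Sec V),
      p.pair (E.res hV D) ξ = p.pair (E.res hV D') ξ) : D = D' := by
  refine E.ext_local fun x hx => ?_
  obtain ⟨V, hV, n, e, ε, hxV, hd⟩ := h.exists_le hx
  refine ⟨V, hV, hxV, ?_⟩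
  rw [hd.left V le_rfl (E.res hV D), hd.left V le_rfl (E.res hV D')]
  simp only [H]

theorem IsPerfect.ext_right (h : p.IsPerfect) {ξ ξ' : F.Sec U}
    (H : ∀ (V : Opens X) (hV : V ≤ U) (D : E.Sec V),
      p.pair D (F.res hV ξ) = p.pair D (F.res hV ξ')) : ξ = ξ' :=
  h.flip.ext_left H

/-- Representability of linear forms on `F`. -/
theorem IsPerfect.exists_left (h : p.IsPerfect) (lam : DualSec F U) :
    ∃ D : E.Sec U, ∀ (V : Opens X) (hV : V ≤ U) (ξ : F.Sec V),
      p.pair (E.res hV D) ξ = lam.app V hV ξ := by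
  obtain ⟨D, hD⟩ := E.exists_glue (U := U)
    (fun V hV D => ∀ (W : Opens X) (hW : W ≤ V) (ξ : F.Sec W),
      p.pair (E.res hW D) ξ = lam.app W (hW.trans hV) ξ)
    (fun x hx => by
      obtain ⟨V, hV, n, e, ε, hxV, hd⟩ := h.exists_le hx
      refine ⟨V, hV, ∑ j, lam.app V hV (ε j) • e j, hxV, fun W hW ξ => ?_⟩
      conv_rhs => rw [hd.right W hW ξ]
      simp only [map_sum, map_smul, map_smulₛₗ, LinearMap.smul_apply, LinearMap.sum_apply,
        smul_eq_mul, ← lam.natural V W hV hW]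
      exact Finset.sum_congr rfl fun j _ => mul_comm _ _)
    (fun V W hV hW D D' hD hD' => h.ext_left fun Z hZ ξ => by
      rw [E.res_res, E.res_res, hD, hD'])
  refine ⟨D, fun V hV ξ => ?_⟩
  refine TopRingedSpace.ext_local fun x hx => ?_
  obtain ⟨W, hW, n, e, ε, hxW, hd⟩ := h.exists_le hx
  refine ⟨W, hW, hxW, ?_⟩
  have key : ∀ (Z : Opens X) (hZ : Z ≤ W) (ζ : F.Sec Z),
      p.pair (E.res hZ (∑ j, lam.app W (hW.trans hV) (ε j) • e j)) ζ =
        lam.app Z (hZ.trans (hW.trans hV)) ζ := fun Z hZ ζ => by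
    conv_rhs => rw [hd.right Z hZ ζ]
    simp only [map_sum, map_smul, map_smulₛₗ, LinearMap.smul_apply, LinearMap.sum_apply,
      smul_eq_mul, ← lam.natural W Z (hW.trans hV) hZ]
    exact Finset.sum_congr rfl fun j _ => mul_comm _ _
  rw [← p.pair_res, E.res_res, hD W (hW.trans hV) _ key, lam.natural]
  simpa [E.res_id] using key W le_rfl (F.res hW ξ)

/-! ## Contractions -/

variable (p)

theorem exists_contr (ξ : F.Sec U) : ∃ T : WOp E E U, T.IsDer (-1) ∧ T.HasParity (-1) ∧
      (∀ (V : Opens X) (hV : V ≤ U) (f : 𝒪.Sec V), T.app V hV (fn f) = 0) ∧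
      ∀ (V : Opens X) (hV : V ≤ U) (D : E.Sec V),
        T.app V hV (ι D) = fn (p.pair D (F.res hV ξ)) := by
  refine WOp.exists_der (-1) (fun _ _ => 0)
    (fun V hV => AddMonoidHom.mk' (fun D => fn (p.pair D (F.res hV ξ))) fun D D' => by
      rw [map_add, LinearMap.add_apply, fn_add]) ?_ ?_ ?_ ?_ ?_ ?_
  · intros; simp
  · intro V W hV hW D
    simp [← p.pair_res, F.res_res]
  · intros; simp
  · intro V hV f D
    simp [fn_mul]
  · intros; simp
  · intros; simp

/-- Contraction with a section of `F`. -/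
def contr (ξ : F.Sec U) : WOp E E U := (p.exists_contr ξ).choose

theorem contr_isDer (ξ : F.Sec U) : (p.contr ξ).IsDer (-1) := (p.exists_contr ξ).choose_spec.1
theorem contr_hasParity (ξ : F.Sec U) : (p.contr ξ).HasParity (-1) :=
  (p.exists_contr ξ).choose_spec.2.1
@[simp] theorem contr_fn (ξ : F.Sec U) (hV : V ≤ U) (f : 𝒪.Sec V) :
    (p.contr ξ).app V hV (fn f) = 0 := (p.exists_contr ξ).choose_spec.2.2.1 V hV f
@[simp] theorem contr_ι (ξ : F.Sec U) (hV : V ≤ U) (D : E.Sec V) :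
    (p.contr ξ).app V hV (ι D) = fn (p.pair D (F.res hV ξ)) :=
  (p.exists_contr ξ).choose_spec.2.2.2 V hV D

theorem contr_ι_mul (ξ : F.Sec U) (hV : V ≤ U) (D : E.Sec V) (a : Wedge E V) :
    (p.contr ξ).app V hV (ι D * a) =
      fn (p.pair D (F.res hV ξ)) * a - ι D * (p.contr ξ).app V hV a := by
  rw [(p.contr_isDer ξ).ι_mul, contr_ι, Units.neg_smul, one_smul, sub_eq_add_neg]

theorem contr_fn_mul (ξ : F.Sec U) (hV : V ≤ U) (f : 𝒪.Sec V) (a : Wedge E V) :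
    (p.contr ξ).app V hV (fn f * a) = fn f * (p.contr ξ).app V hV a := by
  rw [(p.contr_isDer ξ).fn_mul, contr_fn, zero_mul, zero_add]

theorem contr_restr (ξ : F.Sec U) (hV : V ≤ U) : (p.contr ξ).restr hV = p.contr (F.res hV ξ) :=
  ((p.contr_isDer ξ).restr hV).ext (p.contr_isDer _) (fun W hW f => by simp)
    fun W hW D => by simp [F.res_res]

theorem contr_app (ξ : F.Sec U) (hV : V ≤ U) (a : Wedge E V) :
    (p.contr ξ).app V hV a = (p.contr (F.res hV ξ)).app V le_rfl a :=
  congr_app (p.contr_restr ξ hV) a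

theorem contr_add (ξ η : F.Sec U) : p.contr (ξ + η) = p.contr ξ + p.contr η :=
  (p.contr_isDer _).ext ((p.contr_isDer _).add (p.contr_isDer _)) (fun W hW f => by simp)
    fun W hW D => by simp [fn_add]

theorem contr_smul (f : 𝒪.Sec U) (ξ : F.Sec U) : p.contr (f • ξ) = lmul (fn f) * p.contr ξ :=
  (p.contr_isDer _).ext (by
    simpa using (p.contr_isDer ξ).lmul_mul (x := fn f) (e := 1) (by simp)) (fun W hW f => by simp)
    fun W hW D => by simp [fn_mul]

theorem contr_contr (ξ η : F.Sec U) : p.contr ξ * p.contr η = -(p.contr η * p.contr ξ) := by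
  have h := (p.contr_isDer ξ).commutator (p.contr_isDer η) (p.contr_hasParity ξ)
    (p.contr_hasParity η)
  rw [sgn_neg_one_left, Units.neg_smul, one_smul, sub_neg_eq_add] at h
  exact eq_neg_of_add_eq_zero_left (h.ext (isDer_zero _) (fun W hW f => by simp)
    fun W hW D => by simp)

/-- Contractions anticommute, so twice the square is zero. -/
theorem contr_self [CharZero K] (ξ : F.Sec U) : p.contr ξ * p.contr ξ = 0 :=
  ext_app fun V hV a => by
    have h : ((p.contr ξ).restr hV * (p.contr ξ).restr hV) =
        -((p.contr ξ).restr hV * (p.contr ξ).restr hV) := by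
      rw [contr_restr]; exact p.contr_contr _ _
    refine eq_zero_of_nsmul two_ne_zero ?_
    rw [two_nsmul]
    exact eq_neg_iff_add_eq_zero.1 (congr_app h a)

theorem hasDegree_contr (ξ : F.Sec U) (hV : V ≤ U) {a : Wedge E V} {k : ℕ}
    (ha : a.HasDegree (k + 1)) : ((p.contr ξ).app V hV a).HasDegree k :=
  (p.contr_isDer ξ).hasDegree 0 (by simp) (by simp)
    (fun V hV D => by rw [contr_ι]; exact hasDegree_fn _) hV a ha (zero_add _)

theorem contr_degree_zero (ξ : F.Sec U) (hV : V ≤ U) {a : Wedge E V}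
    (ha : a.HasDegree 0) : (p.contr ξ).app V hV a = 0 := by
  obtain ⟨f, rfl⟩ := ha.exists_fn
  simp

variable {p}

theorem IsPerfect.contr_injective (h : p.IsPerfect) {ξ η : F.Sec U}
    (H : p.contr ξ = p.contr η) : ξ = η :=
  h.ext_right fun V hV D => by
    have h2 : (p.contr ξ).app V hV (ι D) = (p.contr η).app V hV (ι D) := by rw [H]
    rw [contr_ι, contr_ι] at h2
    exact fn_injective h2

/-- The Euler operator is multiplication by `k` in degree `k`. -/
theorem IsDualOn.euler {n : ℕ} {e : Fin n → E.Sec U} {ε : Fin n → F.Sec U} (h : p.IsDualOn e ε)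
    {k : ℕ} {a : Wedge E U} (ha : a.HasDegree k) :
    ∑ j, ι (e j) * (p.contr (ε j)).app U le_rfl a = k • a := by
  refine hom_induction (U := U) (p := fun V hV k a =>
    ∑ j, ι (E.res hV (e j)) * (p.contr (ε j)).app V hV a = k • a) ?_ ?_ ?_ ?_ U le_rfl k a ha
      |> Eq.trans (by simp [E.res_id])
  · intro V hV i a _ H
    refine Wedge.ext_local fun x hx => ?_
    obtain ⟨W, hW, hxW, e'⟩ := H x hx
    refine ⟨W, hW, hxW, ?_⟩
    rw [map_sum, map_nsmul, ← e']
    simp [WOp.nat, E.res_res]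
  · intros; simp
  · intro V hV i a b _ _ iha ihb
    simp only [map_add, mul_add, Finset.sum_add_distrib, iha, ihb, nsmul_add]
  · intro V hV i D a _ ih
    -- Contracting `D ∧ a` gives two sums: the frame expansion of `D` turns the first into `D ∧ a`,
    -- and the second is `-D` times the Euler operator on `a`.
    simp only [contr_ι_mul, mul_sub, Finset.sum_sub_distrib]
    have h1 : ∑ j, ι (E.res hV (e j)) * (fn (p.pair D (F.res hV (ε j))) * a) = ι D * a := by
      conv_rhs => rw [h.left V hV D]
      rw [ι_sum, Finset.sum_mul]
      refine Finset.sum_congr rfl fun j _ => ?_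
      rw [ι_smul, mul_assoc, fn_left_comm]
    have h2 : ∑ j, ι (E.res hV (e j)) * (ι D * (p.contr (ε j)).app V hV a) =
        -(ι D * (i • a)) := by
      rw [← ih, Finset.mul_sum, ← Finset.sum_neg_distrib]
      refine Finset.sum_congr rfl fun j _ => ?_
      rw [← mul_assoc, ι_mul_swap, neg_mul, mul_assoc]
    rw [h1, h2, sub_neg_eq_add, mul_smul_comm, succ_nsmul']

/-- If all contractions vanish, so does the Euler operator, which is multiplication by `k + 1`, a
unit in `K`. In degree zero the statement would fail. -/
theorem IsPerfect.eq_zero_of_contr [CharZero K] (h : p.IsPerfect) {k : ℕ} {a : Wedge E U}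
    (ha : a.HasDegree (k + 1)) (H : ∀ (V : Opens X) (hV : V ≤ U) (ξ : F.Sec V),
      (p.contr ξ).app V le_rfl (res hV a) = 0) : a = 0 := by
  refine Wedge.ext_local fun x hx => ?_
  obtain ⟨V, hV, n, e, ε, hxV, hd⟩ := h.exists_le hx
  refine ⟨V, hV, hxV, ?_⟩
  rw [map_zero]
  refine eq_zero_of_nsmul (Nat.succ_ne_zero k) ?_
  rw [← hd.euler (ha.res hV)]
  simp [H]

theorem IsPerfect.ext_contr [CharZero K] (h : p.IsPerfect) {k : ℕ} {a b : Wedge E U}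
    (ha : a.HasDegree (k + 1)) (hb : b.HasDegree (k + 1))
    (H : ∀ (V : Opens X) (hV : V ≤ U) (ξ : F.Sec V),
      (p.contr ξ).app V le_rfl (res hV a) = (p.contr ξ).app V le_rfl (res hV b)) : a = b :=
  sub_eq_zero.1 (h.eq_zero_of_contr (ha.sub hb) fun V hV ξ => by
    rw [map_sub, map_sub, H, sub_self])

/-- A derivation of `⋀ E` of degree `-1` is the contraction with a section of `F`. -/
theorem IsPerfect.exists_eq_contr (h : p.IsPerfect) {T : WOp E E U} (hT : T.IsDer (-1))
    (h₀ : ∀ (V : Opens X) (hV : V ≤ U) (f : 𝒪.Sec V), T.app V hV (fn f) = 0)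
    (h₁ : ∀ (V : Opens X) (hV : V ≤ U) (D : E.Sec V), (T.app V hV (ι D)).HasDegree 0) :
    ∃ ξ : F.Sec U, T = p.contr ξ := by
  -- Since `T` kills functions, `D ↦ T D` is `𝒪`-linear with values in functions, hence represented
  -- by a section of `F`.
  choose c hc using fun V hV D => (h₁ V hV D).exists_fn
  obtain ⟨ξ, hξ⟩ := h.flip.exists_left (U := U)
    { app := fun V hV =>
      { toFun := c V hV
        map_add' := fun D D' => fn_injective (E := E) <| by
          rw [fn_add, ← hc, ← hc, ← hc, ι_add, map_add]
        map_smul' := fun f D => fn_injective (E := E) <| by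
          rw [← hc, ι_smul, hT.fn_mul, h₀, zero_mul, zero_add, hc, RingHom.id_apply, smul_eq_mul,
            fn_mul] }
      natural := fun V W hV hW D => fn_injective (E := E) <| by
        change fn (𝒪.res hW (c V hV D)) = fn (c W _ _)
        rw [← res_fn, ← hc, ← hc, T.nat, res_ι] }
  refine ⟨ξ, hT.ext (p.contr_isDer ξ) (fun V hV f => by rw [h₀, contr_fn]) fun V hV D => ?_⟩
  rw [contr_ι, hc]
  exact congrArg fn (hξ V hV D).symm

end Pairing

/-- The evaluation pairing of a locally free sheaf is perfect. -/
theorem ModSheaf.IsLocallyFree.isPerfect {E : ModSheaf.{u, v, w} 𝒪} (hE : E.IsLocallyFree) :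
    (evalPairing E).IsPerfect := by
  intro x
  obtain ⟨U, n, hx, e, he⟩ := hE x
  let b (V : Opens X) (hV : V ≤ U) := LinearEquiv.ofBijective
    (∑ i, (LinearMap.proj (R := 𝒪.Sec V) (φ := fun _ : Fin n => 𝒪.Sec V) i).smulRight
      (E.res hV (e i))) (by
      convert he V hV using 1
      ext c
      simp)
  have hb : ∀ V hV c, b V hV c = ∑ i, c i • E.res hV (e i) := fun V hV c => by simp [b]
  have hs : ∀ V hV (D : E.Sec V), D = ∑ i, (b V hV).symm D i • E.res hV (e i) := fun V hV D => by
    rw [← hb, LinearEquiv.apply_symm_apply]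
  -- Coordinates commute with restriction, so the coordinate functions are sections of the dual
  -- sheaf; they form the dual frame.
  have hn : ∀ V W (hV : V ≤ U) (hW : W ≤ V) (D : E.Sec V) (i : Fin n),
      𝒪.res hW ((b V hV).symm D i) = (b W (hW.trans hV)).symm (E.res hW D) i := by
    intro V W hV hW D i
    have : (b W (hW.trans hV)).symm (E.res hW D) = fun i => 𝒪.res hW ((b V hV).symm D i) := by
      rw [LinearEquiv.symm_apply_eq, hb]
      conv_lhs => rw [hs V hV D]
      simp [E.res_res]
    rw [this]
  have hone : ∀ V (hV : V ≤ U) i j, (b V hV).symm (E.res hV (e i)) j = if i = j then 1 else 0 := by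
    intro V hV i j
    have : (b V hV).symm (E.res hV (e i)) = Pi.single i 1 := by
      rw [LinearEquiv.symm_apply_eq, hb]
      simp [Pi.single_apply]
    rw [this, Pi.single_apply]
    simp only [eq_comm]
  let ε (j : Fin n) : E.dual.Sec U :=
    (⟨fun V hV => LinearMap.proj (R := 𝒪.Sec V) (φ := fun _ : Fin n => 𝒪.Sec V) j ∘ₗ
      (b V hV).symm.toLinearMap, fun V W hV hW s => hn V W hV hW s j⟩ : DualSec E U)
  refine ⟨U, n, ε, e, hx, fun i j => ?_, fun V hV ω => ?_, fun V hV D => hs V hV D⟩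
  · have := hone U le_rfl j i
    rw [E.res_id] at this
    simp only [eq_comm (a := j)] at this
    exact this
  · refine DualSec.ext (funext fun W => funext fun hW => LinearMap.ext fun D => ?_)
    have h1 : ∀ (s : Finset (Fin n)) (f : Fin n → DualSec E V),
        (∑ i ∈ s, f i).app W hW = ∑ i ∈ s, (f i).app W hW := fun s f =>
      map_sum (AddMonoidHom.mk' (fun a : DualSec E V => a.app W hW) fun _ _ => rfl) f s
    refine Eq.trans ?_ (congrArg (fun l => l D) (h1 Finset.univ _)).symm
    rw [LinearMap.sum_apply]
    conv_lhs => rw [hs W (hW.trans hV) D, map_sum]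
    refine Finset.sum_congr rfl fun j _ => ?_
    rw [map_smul, smul_eq_mul, mul_comm, ← E.res_res hV hW, ← ω.natural V W le_rfl hW]
    rfl

end

section

open Wedge WOp

/-! ## Evaluation of forms -/

section Algebra

variable {R M N : Type*} [CommRing R] [AddCommGroup M] [Module R M] [AddCommGroup N] [Module R N]

theorem contractLeft_ιMulti (d : Module.Dual R M) (n : ℕ) (m : Fin (n + 1) → M) :
    CliffordAlgebra.contractLeft (Q := (0 : QuadraticForm R M)) d
      (ExteriorAlgebra.ιMulti R (n + 1) m) =
      ∑ i : Fin (n + 1), ((-1) ^ (i : ℕ) * d (m i)) •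
        ExteriorAlgebra.ιMulti R n (fun j => m (i.succAbove j)) := by
  induction n with
  | zero =>
    rw [ExteriorAlgebra.ιMulti_succ_apply, ExteriorAlgebra.ιMulti_zero_apply, mul_one]
    refine (CliffordAlgebra.contractLeft_ι (Q := (0 : QuadraticForm R M)) d (m 0)).trans ?_
    simp [Algebra.algebraMap_eq_smul_one, ExteriorAlgebra.ιMulti_zero_apply]
  | succ n ih =>
    rw [ExteriorAlgebra.ιMulti_succ_apply]
    refine (CliffordAlgebra.contractLeft_ι_mul _ _ _).trans ?_
    rw [ih, Fin.sum_univ_succ (n := n + 1), Finset.mul_sum, sub_eq_add_neg, ← Finset.sum_neg_distrib]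
    congr 1
    · simp [Matrix.vecTail, Function.comp_def]
    · refine Finset.sum_congr rfl fun i _ => ?_
      rw [ExteriorAlgebra.ιMulti_succ_apply, Algebra.mul_smul_comm, ← neg_smul]
      simp [Matrix.vecTail, Function.comp_def, pow_succ]

/-- Laplace expansion of the determinant along its first column, which matches the alternating sum
for the contraction of a product. -/
theorem extPair_cons (B : M →ₗ[R] N →ₗ[R] R) {k : ℕ} (ξ₀ : N) (ξ : Fin k → N)
    (t : ExteriorAlgebra R M) :
    extPair B (Fin.cons ξ₀ ξ) t =
      extPair B ξ (CliffordAlgebra.contractLeft (Q := (0 : QuadraticForm R M)) (B.flip ξ₀) t) := by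
  have ht : t ∈ Submodule.span R
      (Set.range fun x : Σ n, (Fin n → M) => ExteriorAlgebra.ιMulti R x.1 x.2) := by
    rw [ExteriorAlgebra.ιMulti_span]; trivial
  induction ht using Submodule.span_induction with
  | mem x hx =>
    obtain ⟨⟨l, m⟩, rfl⟩ := hx
    dsimp only
    rcases l with _ | l
    · rw [extPair_ιMulti_of_ne _ (Nat.succ_ne_zero k).symm, ExteriorAlgebra.ιMulti_zero_apply]
      erw [CliffordAlgebra.contractLeft_one]
      rw [map_zero]
    · rw [contractLeft_ιMulti, map_sum]
      simp only [map_smul, smul_eq_mul]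
      by_cases hl : l = k
      · subst hl
        rw [extPair_ιMulti, Matrix.det_succ_column_zero]
        refine Finset.sum_congr rfl fun i _ => ?_
        rw [extPair_ιMulti]
        congr 1
      · rw [extPair_ιMulti_of_ne _ (by simpa using hl)]
        simp [extPair_ιMulti_of_ne _ hl]
  | zero => simp
  | add x y _ _ hx hy => rw [map_add, map_add, map_add, hx, hy]
  | smul r x _ hx => rw [map_smul, map_smul, map_smul, hx]

end Algebra

namespace Pairing

variable {E : ModSheaf.{u, v, w} 𝒪} {F : ModSheaf.{u, v, w'} 𝒪} (p : Pairing E F)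
variable {U V : Opens X}

/-- Identifies the derivation built from generators with the algebraic contraction of the exterior
algebra, which is tied to the determinant pairing by `extPair_cons`. -/
theorem contr_ofPre (ξ : F.Sec U) (t : ExtPre E U) : (p.contr ξ).app U le_rfl (ofPre U t) =
    ofPre U (CliffordAlgebra.contractLeft (Q := (0 : QuadraticForm (𝒪.Sec U) (E.Sec U)))
      (p.pair.flip ξ) t) := by
  induction t using CliffordAlgebra.left_induction with
  | algebraMap r =>
    refine (p.contr_fn ξ le_rfl r).trans ?_
    rw [CliffordAlgebra.contractLeft_algebraMap, map_zero]
  | add x y hx hy => rw [map_add, map_add, map_add, hx, hy, map_add]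
  | ι_mul x m hx =>
    rw [map_mul]
    refine (p.contr_ι_mul ξ le_rfl m _).trans ?_
    rw [hx, CliffordAlgebra.contractLeft_ι_mul, map_sub, map_mul, Algebra.smul_def, map_mul,
      F.res_id]
    rfl

theorem res_ev (h : V ≤ U) (a : Wedge E U) {k : ℕ} (ξ : Fin k → F.Sec U) :
    𝒪.res h (p.ev a ξ) = p.ev (res h a) (fun i => F.res h (ξ i)) := by
  refine TopRingedSpace.ext_local fun x hx => ?_
  obtain ⟨W, hW, t, hxW, ht⟩ := (res h a).exists_local hx
  refine ⟨W, hW, hxW, Subtype.ext (funext fun y => ?_)⟩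
  have hy : a.1 ⟨y.1, h (hW y.2)⟩ = (extPresheaf E).germ y.1 y.2 t :=
    congrArg (fun b : Wedge E W => b.1 y) ht
  change p.stalkValue ξ ⟨y.1, (hW.trans h) y.2⟩ (a.1 ⟨y.1, _⟩) =
    p.stalkValue _ ⟨y.1, hW y.2⟩ (a.1 ⟨y.1, _⟩)
  rw [hy, p.stalkValue_germ, p.stalkValue_germ]
  simp only [F.res_res]

theorem ev_add (a b : Wedge E U) {k : ℕ} (ξ : Fin k → F.Sec U) :
    p.ev (a + b) ξ = p.ev a ξ + p.ev b ξ := by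
  refine TopRingedSpace.ext_local fun x hx => ?_
  obtain ⟨V, hV, s, hxV, hs⟩ := a.exists_local hx
  obtain ⟨W, hW, t, hxW, ht⟩ := (res hV b).exists_local hxV
  refine ⟨W, hW.trans hV, hxW, ?_⟩
  have hs' : res (hW.trans hV) a = ofPre W (ExtPre.res E hW s) := by
    rw [← res_res hV hW, hs, res_ofPre]
  rw [res_res] at ht
  rw [map_add, res_ev, res_ev, res_ev, map_add, hs', ht, ← map_add, ev_ofPre, ev_ofPre, ev_ofPre,
    map_add]

/-- Evaluation as an additive homomorphism. -/
def evHom {k : ℕ} (ξ : Fin k → F.Sec U) : Wedge E U →+ 𝒪.Sec U :=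
  AddMonoidHom.mk' (fun a => p.ev a ξ) fun a b => p.ev_add a b ξ

theorem ev_sub (a b : Wedge E U) {k : ℕ} (ξ : Fin k → F.Sec U) :
    p.ev (a - b) ξ = p.ev a ξ - p.ev b ξ := map_sub (p.evHom ξ) a b
theorem ev_neg (a : Wedge E U) {k : ℕ} (ξ : Fin k → F.Sec U) :
    p.ev (-a) ξ = -p.ev a ξ := map_neg (p.evHom ξ) a

@[simp] theorem ev_fn (f : 𝒪.Sec U) (ξ : Fin 0 → F.Sec U) : p.ev (fn f : Wedge E U) ξ = f := by
  rw [fn, ev_ofPre, Algebra.algebraMap_eq_smul_one, map_smul,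
    ← ExteriorAlgebra.ιMulti_zero_apply (R := 𝒪.Sec U) (M := E.Sec U) Fin.elim0, extPair_ιMulti]
  simp

theorem ev_cons (a : Wedge E U) {k : ℕ} (ξ₀ : F.Sec U) (ξ : Fin k → F.Sec U) :
    p.ev a (Fin.cons ξ₀ ξ) = p.ev ((p.contr ξ₀).app U le_rfl a) ξ := by
  refine TopRingedSpace.ext_local fun x hx => ?_
  obtain ⟨V, hV, t, hxV, ht⟩ := a.exists_local hx
  refine ⟨V, hV, hxV, ?_⟩
  have hc : (fun i => F.res hV ((Fin.cons ξ₀ ξ : Fin (k + 1) → F.Sec U) i)) =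
      Fin.cons (F.res hV ξ₀) fun i => F.res hV (ξ i) := by
    funext i; refine Fin.cases ?_ (fun i => ?_) i <;> rfl
  rw [res_ev, res_ev, hc, ht, ev_ofPre, extPair_cons, WOp.nat, ht, contr_app, contr_ofPre,
    ev_ofPre]

theorem ev_cons_cons (a : Wedge E U) {k : ℕ} (ξ η : F.Sec U) (ζ : Fin k → F.Sec U) :
    p.ev a (Fin.cons ξ (Fin.cons η ζ)) = -p.ev a (Fin.cons η (Fin.cons ξ ζ)) := by
  rw [ev_cons, ev_cons, ev_cons, ev_cons, ← ev_neg]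
  exact congrArg (p.ev · ζ) (congr_app (p.contr_contr η ξ) a)

variable {p}

/-- By `ev_cons` evaluation is iterated contraction, and contractions detect zero in positive
degree. -/
theorem IsPerfect.eq_zero_of_ev [CharZero K] (h : p.IsPerfect) {k : ℕ} {a : Wedge E U}
    (ha : a.HasDegree k) (H : ∀ (V : Opens X) (hV : V ≤ U) (ξ : Fin k → F.Sec V),
      p.ev (res hV a) ξ = 0) : a = 0 := by
  induction k generalizing U with
  | zero =>
    obtain ⟨f, rfl⟩ := ha.exists_fn
    have := H U le_rfl Fin.elim0
    rw [res_rfl, ev_fn] at this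
    rw [this, fn_zero]
  | succ k ih =>
    refine h.eq_zero_of_contr ha fun V hV ξ => ih (p.hasDegree_contr ξ le_rfl (ha.res hV))
      fun W hW ζ => ?_
    rw [WOp.nat, contr_app, ← ev_cons]
    exact H W (hW.trans hV) _

end Pairing

/-! ## The Chevalley-Eilenberg formula -/

section CE

variable {E : ModSheaf.{u, v, w} 𝒪} {F : ModSheaf.{u, v, w'} 𝒪}

/-- The recursion `i_ξ₀ d = L_ξ₀ - d i_ξ₀` in terms of values: the terms of the formula in which
`ξ₀` acts or is bracketed form the Lie derivative, and the rest is the formula for `i_ξ₀ a` with the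
opposite sign. -/
theorem ceFormula_cons (𝓕 : LieAlgebroid F) (p : Pairing E F) {U : Opens X} (m : ℕ)
    (a : Wedge E U) (ξ₀ : F.Sec U) (ξ : Fin (m + 1) → F.Sec U) :
    ceFormula 𝓕 (m + 1) (p.ev a) (Fin.cons ξ₀ ξ) = 𝓕.anchor ξ₀ (p.ev a ξ) -
      ∑ j : Fin (m + 1), (-1) ^ (j : ℕ) * p.ev a (Fin.cons (𝓕.lie ξ₀ (ξ j)) (j.removeNth ξ)) -
      ceFormula 𝓕 m (p.ev ((p.contr ξ₀).app U le_rfl a)) ξ := by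
  have hfun : ∀ n : ℕ, p.ev ((p.contr ξ₀).app U le_rfl a) (k := n) =
      fun ζ : Fin n → F.Sec U => p.ev a (Fin.cons ξ₀ ζ) := fun n => by
    funext ζ; rw [p.ev_cons]
  rw [hfun]
  have hrem : ∀ {n : ℕ} (j : Fin (n + 1)) (ζ : Fin (n + 1) → F.Sec U),
      j.succ.removeNth (Fin.cons ξ₀ ζ : Fin (n + 2) → F.Sec U) = Fin.cons ξ₀ (j.removeNth ζ) := by
    intro n j ζ
    funext i
    refine Fin.cases ?_ (fun i => ?_) i <;> simp [Fin.removeNth]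
  have h0 : ∀ {n : ℕ} (ζ : Fin n → F.Sec U),
      (0 : Fin (n + 1)).removeNth (Fin.cons ξ₀ ζ : Fin (n + 1) → F.Sec U) = ζ := by
    intro n ζ; rfl
  rw [ceFormula, Fin.sum_univ_succ, Fin.sum_univ_succ (n := m + 1)]
  simp only [Fin.cons_zero, Fin.cons_succ, h0, hrem]
  -- `ceFormula` has no double sum for `k = 0`, so that case is separate.
  rcases m with _ | m
  · simp [ceFormula]
    ring
  · rw [ceFormula]
    have h1 : ∀ i j : Fin (m + 2), ¬ (i.succ ≤ (0 : Fin (m + 2)).castSucc) := by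
      intro i j; simp
    -- For a pair not involving `ξ₀`, the shift of both indices leaves the sign unchanged; the minus
    -- sign comes from moving the bracket past `ξ₀`. The summand `j = 0` is excluded by the index
    -- condition.
    have h2 : ∀ i : Fin (m + 2), ∑ j : Fin (m + 2), (if i.succ ≤ j.castSucc then
        (-1) ^ ((i.succ : ℕ) + (j.succ : ℕ)) * p.ev a (Fin.cons (𝓕.lie (ξ i) (ξ j))
          (j.removeNth (Fin.cons ξ₀ (i.removeNth ξ) : Fin (m + 2) → F.Sec U))) else 0) =
        -∑ j : Fin (m + 1), (if i ≤ j.castSucc then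
          (-1) ^ ((i : ℕ) + (j.succ : ℕ)) * p.ev a (Fin.cons ξ₀ (Fin.cons (𝓕.lie (ξ i) (ξ j.succ))
            (j.removeNth (i.removeNth ξ)))) else 0) := by
      intro i
      rw [Fin.sum_univ_succ, if_neg (h1 i 0), zero_add, ← Finset.sum_neg_distrib]
      refine Finset.sum_congr rfl fun j _ => ?_
      rw [hrem]
      have hij : i.succ ≤ j.succ.castSucc ↔ i ≤ j.castSucc := by
        simp [Fin.le_iff_val_le_val]
      simp only [hij]
      split_ifs with h
      · rw [p.ev_cons_cons]
        simp only [Fin.val_succ]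
        ring
      · simp
    rw [Finset.sum_congr rfl fun i _ => h2 i]
    simp only [Fin.zero_le, if_true, Finset.sum_neg_distrib, Fin.val_zero, Fin.val_succ, pow_zero,
      one_mul, zero_add, pow_succ, mul_neg, neg_mul, mul_one]
    ring

end CE

end

section

open Wedge WOp

/-! ## Cartan calculus -/

namespace WOp

variable {E : ModSheaf.{u, v, w} 𝒪} {U V : Opens X}

theorem restr_mul (S T : WOp E E U) (hV : V ≤ U) : (S * T).restr hV = S.restr hV * T.restr hV := rfl
theorem restr_sub (S T : WOp E E U) (hV : V ≤ U) : (S - T).restr hV = S.restr hV - T.restr hV := rfl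

end WOp

section Cartan

variable {E : ModSheaf.{u, v, w} 𝒪} {F : ModSheaf.{u, v, w'} 𝒪} {p : Pairing E F}
variable {δ : DegOneOp E} {U V : Opens X}

theorem DegOneOp.d_zero (δ : DegOneOp E) : δ.d (0 : Wedge E U) = 0 :=
  map_zero ((δ.toWOp U).app U le_rfl)

/-- The operator of degree one `δ` is a graded derivation. -/
def DegOneOp.IsDer (δ : DegOneOp E) : Prop := (δ.toWOp ⊤).IsDer (-1)

namespace DegOneOp.IsDer


theorem toWOp (hδ : δ.IsDer) (U : Opens X) : (δ.toWOp U).IsDer (-1) := WOp.IsDer.restr hδ le_top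

theorem hasParity (hδ : δ.IsDer) (U : Opens X) : (δ.toWOp U).HasParity (-1) :=
  (hδ.toWOp U).hasParity (fun V hV f => by
    rw [DegOneOp.toWOp_app, (δ.degree _ (hasDegree_fn f)).invol]; rfl) fun V hV D => by
    rw [DegOneOp.toWOp_app, (δ.degree _ (hasDegree_ι D)).invol]; rfl

theorem sq (hδ : δ.IsDer) (U : Opens X) : (δ.toWOp U * δ.toWOp U).IsDer 1 := fun V hV a b => by
  have h := hδ.toWOp U V hV
  have h' := hδ.hasParity U V hV a
  simp only [DegOneOp.toWOp_app, tw_neg_one, Units.neg_smul, one_smul] at h h'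
  simp only [mul_app, DegOneOp.toWOp_app, h, δ.d_add, h', invol_invol, tw_one, neg_mul]
  abel

end DegOneOp.IsDer

variable (p δ) in
/-- The Lie derivative along a section of `F`. -/
def lieOp (ξ : F.Sec U) : WOp E E U := p.contr ξ * δ.toWOp U + δ.toWOp U * p.contr ξ

theorem lieOp_restr (ξ : F.Sec U) (hV : V ≤ U) :
    (lieOp p δ ξ).restr hV = lieOp p δ (F.res hV ξ) := by
  rw [lieOp, lieOp, ← p.contr_restr]; rfl

theorem lieOp_app (ξ : F.Sec U) (hV : V ≤ U) (a : Wedge E V) : (lieOp p δ ξ).app V hV a =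
    (p.contr ξ).app V hV (δ.d a) + δ.d ((p.contr ξ).app V hV a) := rfl

theorem lieOp_fn (ξ : F.Sec U) (hV : V ≤ U) (f : 𝒪.Sec V) : (lieOp p δ ξ).app V hV (fn f) =
    (p.contr ξ).app V hV (δ.d (fn f)) := by
  rw [lieOp_app, p.contr_fn]
  exact (congrArg _ (map_zero ((δ.toWOp V).app V le_rfl))).trans (add_zero _)

theorem hasDegree_lieOp (ξ : F.Sec U) (hV : V ≤ U) {a : Wedge E V} {k : ℕ} (ha : a.HasDegree k) :
    ((lieOp p δ ξ).app V hV a).HasDegree k := by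
  refine HasDegree.add (p.hasDegree_contr ξ hV (δ.degree _ ha)) ?_
  rcases k with _ | k
  · rw [mul_app, p.contr_degree_zero ξ hV ha]
    exact (map_zero ((δ.toWOp V).app V le_rfl)).symm ▸ hasDegree_zero _
  · exact δ.degree _ (p.hasDegree_contr ξ hV ha)

theorem lieOp_isDer (hδ : δ.IsDer) (ξ : F.Sec U) : (lieOp p δ ξ).IsDer 1 := by
  have h := (p.contr_isDer ξ).commutator (hδ.toWOp U) (p.contr_hasParity ξ) (hδ.hasParity U)
  rw [sgn_neg_one_left, Units.neg_smul, one_smul, sub_neg_eq_add] at h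
  exact h

theorem lieOp_hasParity (hδ : δ.IsDer) (ξ : F.Sec U) : (lieOp p δ ξ).HasParity 1 := by
  have h := (p.contr_hasParity ξ).commutator (hδ.hasParity U)
  rw [sgn_neg_one_left, Units.neg_smul, one_smul, sub_neg_eq_add] at h
  exact h

theorem lieOp_commutator_isDer (hδ : δ.IsDer) (ξ η : F.Sec U) :
    (lieOp p δ ξ * p.contr η - p.contr η * lieOp p δ ξ).IsDer (-1) := by
  have h := (lieOp_isDer (p := p) hδ ξ).commutator (p.contr_isDer η) (lieOp_hasParity hδ ξ)
    (p.contr_hasParity η)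
  rwa [sgn_one_left, one_smul, one_mul] at h

theorem lieOp_commutator_fn (ξ η : F.Sec U) (hV : V ≤ U) (f : 𝒪.Sec V) :
    (lieOp p δ ξ * p.contr η - p.contr η * lieOp p δ ξ).app V hV (fn f) = 0 := by
  rw [sub_app, mul_app, mul_app, p.contr_fn, map_zero,
    p.contr_degree_zero η hV (hasDegree_lieOp ξ hV (hasDegree_fn f)), sub_zero]

theorem hasDegree_lieOp_commutator (ξ η : F.Sec U) (hV : V ≤ U) (D : E.Sec V) :
    ((lieOp p δ ξ * p.contr η - p.contr η * lieOp p δ ξ).app V hV (ι D)).HasDegree 0 :=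
  (hasDegree_lieOp ξ hV (p.hasDegree_contr η hV (hasDegree_ι D))).sub
    (p.hasDegree_contr η hV (hasDegree_lieOp ξ hV (hasDegree_ι D)))

variable (p) in
/-- The derivation `δ` and the Lie algebroid `𝓕` are related by the Cartan formulas. -/
structure IsCartan (𝓕 : LieAlgebroid F) (δ : DegOneOp E) : Prop where
  isDer : δ.IsDer
  anchor : ∀ (U : Opens X) (ξ : F.Sec U) (f : 𝒪.Sec U),
    (p.contr ξ).app U le_rfl (δ.d (fn f)) = fn (𝓕.anchor ξ f)
  lie : ∀ (U : Opens X) (ξ η : F.Sec U),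
    lieOp p δ ξ * p.contr η - p.contr η * lieOp p δ ξ = p.contr (𝓕.lie ξ η)

variable {𝓕 : LieAlgebroid F}

namespace IsCartan

theorem lieOp_fn (h : IsCartan p 𝓕 δ) (ξ : F.Sec U) (hV : V ≤ U) (f : 𝒪.Sec V) :
    (lieOp p δ ξ).app V hV (fn f) = fn (𝓕.anchor (F.res hV ξ) f) := by
  rw [LBialg.lieOp_fn, p.contr_app, h.anchor]

theorem ev_lieOp (h : IsCartan p 𝓕 δ) (ξ : F.Sec U) {m : ℕ} {a : Wedge E U}
    (ha : a.HasDegree (m + 1)) (ζ : Fin (m + 1) → F.Sec U) :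
    p.ev ((lieOp p δ ξ).app U le_rfl a) ζ = 𝓕.anchor ξ (p.ev a ζ) -
      ∑ j : Fin (m + 1), (-1) ^ (j : ℕ) *
        p.ev a (Fin.cons (𝓕.lie ξ (ζ j)) (j.removeNth ζ)) := by
  -- Peels off the first argument by means of `[L_ξ, i_η] = i_[ξ,η]`.
  have step : ∀ (m : ℕ) (a : Wedge E U) (η : F.Sec U) (ζ : Fin m → F.Sec U),
      p.ev ((lieOp p δ ξ).app U le_rfl a) (Fin.cons η ζ) =
        p.ev ((lieOp p δ ξ).app U le_rfl ((p.contr η).app U le_rfl a)) ζ -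
          p.ev a (Fin.cons (𝓕.lie ξ η) ζ) := by
    intro m a η ζ
    have := congr_app (h.lie U ξ η) a
    rw [p.ev_cons, p.ev_cons, ← this, sub_app, mul_app, mul_app, p.ev_sub, sub_sub_cancel]
  induction m generalizing a with
  | zero =>
    obtain ⟨η, ζ, rfl⟩ : ∃ η ζ', ζ = Fin.cons η ζ' := ⟨ζ 0, Fin.tail ζ, (Fin.cons_self_tail ζ).symm⟩
    obtain ⟨f, hf⟩ := (p.hasDegree_contr η le_rfl ha).exists_fn
    rw [step, hf, h.lieOp_fn, p.ev_fn, p.ev_cons a η, hf, p.ev_fn, F.res_id]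
    simp
  | succ m ih =>
    obtain ⟨η, ζ, rfl⟩ : ∃ η ζ', ζ = Fin.cons η ζ' := ⟨ζ 0, Fin.tail ζ, (Fin.cons_self_tail ζ).symm⟩
    rw [step, ih (p.hasDegree_contr η le_rfl ha), Fin.sum_univ_succ (n := m + 1), ← p.ev_cons,
      sub_sub]
    refine congrArg _ ((add_comm _ _).trans ?_)
    refine congrArg₂ _ (by simp) ?_
    · refine Finset.sum_congr rfl fun j _ => ?_
      have hrem : j.succ.removeNth (Fin.cons η ζ : Fin (m + 2) → F.Sec U) =
          Fin.cons η (j.removeNth ζ) := by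
        funext i
        refine Fin.cases ?_ (fun i => ?_) i <;> simp [Fin.removeNth]
      rw [hrem, ← p.ev_cons a, p.ev_cons_cons, Fin.cons_succ, Fin.val_succ, pow_succ]
      ring

/-- The Cartan formulas imply the Chevalley-Eilenberg formula. -/
theorem isCEDifferential (h : IsCartan p 𝓕 δ) : IsCEDifferential p 𝓕 δ := by
  intro U k a ξ ha
  obtain ⟨ξ₀, ξ, rfl⟩ : ∃ η ζ', ξ = Fin.cons η ζ' := ⟨ξ 0, Fin.tail ξ, (Fin.cons_self_tail ξ).symm⟩
  induction k generalizing a ξ₀ with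
  | zero =>
    obtain ⟨f, rfl⟩ := ha.exists_fn
    rw [p.ev_cons, h.anchor, p.ev_fn, ceFormula, p.ev_fn, Fin.cons_zero]
  | succ k ih =>
    obtain ⟨ξ₁, ξ, rfl⟩ : ∃ η ζ', ξ = Fin.cons η ζ' :=
      ⟨ξ 0, Fin.tail ξ, (Fin.cons_self_tail ξ).symm⟩
    rw [ceFormula_cons, ← ih _ (p.hasDegree_contr ξ₀ le_rfl ha) ξ₁ ξ, ← h.ev_lieOp ξ₀ ha, ← p.ev_sub,
      p.ev_cons, lieOp_app, add_sub_cancel_right]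

end IsCartan

theorem IsCEDifferential.unique [CharZero K] (hp : p.IsPerfect) {δ' : DegOneOp E}
    (h : IsCEDifferential p 𝓕 δ) (h' : IsCEDifferential p 𝓕 δ') : δ = δ' := by
  refine DegOneOp.ext ?_
  funext U a
  refine congr_app (S := δ.toWOp U) (T := δ'.toWOp U) (ext_hom fun V hV i a ha => ?_) a
  rw [DegOneOp.toWOp_app, DegOneOp.toWOp_app]
  refine sub_eq_zero.1 (hp.eq_zero_of_ev ((δ.degree a ha).sub (δ'.degree a ha)) fun W hW ξ => ?_)
  rw [map_sub, δ.d_res, δ'.d_res, p.ev_sub, h _ _ _ _ (ha.res hW), h' _ _ _ _ (ha.res hW), sub_self]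

/-- Two Lie algebroid structures with the same differential agree. -/
theorem IsCartan.unique (hp : p.IsPerfect) {𝓕' : LieAlgebroid F} (h : IsCartan p 𝓕 δ)
    (h' : IsCartan p 𝓕' δ) : 𝓕 = 𝓕' := by
  refine LieAlgebroid.ext ?_ ?_
  · funext U ξ η
    exact hp.contr_injective ((h.lie U ξ η).symm.trans (h'.lie U ξ η))
  · funext U
    refine LinearMap.ext fun ξ => Derivation.ext fun f => ?_
    exact fn_injective ((h.anchor U ξ f).symm.trans (h'.anchor U ξ f))

theorem Pairing.IsPerfect.eq_zero_of_contr_contr [CharZero K] (h : p.IsPerfect) {k : ℕ}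
    {a : Wedge E U} (ha : a.HasDegree (k + 2)) (H : ∀ (V : Opens X) (hV : V ≤ U) (ξ η : F.Sec V),
      (p.contr η).app V le_rfl ((p.contr ξ).app V le_rfl (Wedge.res hV a)) = 0) : a = 0 :=
  h.eq_zero_of_contr ha fun V hV ξ => h.eq_zero_of_contr (p.hasDegree_contr ξ le_rfl (ha.res hV))
    fun W hW η => by
      rw [WOp.nat, p.contr_app ξ hW]
      exact H W (hW.trans hV) (F.res hW ξ) η

/-- For a section `D` the contraction `i_ζ D` is a function, where `S` and `T` agree; the
commutators then show that `S D` and `T D` have the same contractions, which suffices in positive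
degree. -/
theorem Pairing.IsPerfect.ext_of_commutator_contr [CharZero K] (h : p.IsPerfect) {ε : ℤˣ}
    {S T : WOp E E U} {k : ℕ} (e : ℤˣ)
    (h₀ : ∀ (V : Opens X) (hV : V ≤ U) (f : 𝒪.Sec V), S.app V hV (fn f) = T.app V hV (fn f))
    (hS₁ : ∀ (V : Opens X) (hV : V ≤ U) (D : E.Sec V), (S.app V hV (ι D)).HasDegree (k + 1))
    (hT₁ : ∀ (V : Opens X) (hV : V ≤ U) (D : E.Sec V), (T.app V hV (ι D)).HasDegree (k + 1))
    (hS : S.IsDer ε) (hT : T.IsDer ε)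
    (hc : ∀ (V : Opens X) (hV : V ≤ U) (ζ : F.Sec V),
      S.restr hV * p.contr ζ - e • (p.contr ζ * S.restr hV) =
        T.restr hV * p.contr ζ - e • (p.contr ζ * T.restr hV)) : S = T := by
  refine hS.ext hT h₀ fun V hV D => h.ext_contr (hS₁ V hV D) (hT₁ V hV D) fun W hW ζ => ?_
  have := congr_app (hc W (hW.trans hV) ζ) (ι (E.res hW D))
  simp only [sub_app, mul_app, units_smul_app, restr_app, p.contr_ι, h₀] at this
  rw [sub_right_inj, (MulAction.injective e).eq_iff] at this
  rw [S.nat, T.nat, res_ι, this]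

section Identities

variable {R : Type*} [Ring R]

/-- The Jacobi identity of commutators in a ring. The next two identities are used with `i` a
contraction and `d` the differential: the second compares `[l, i d + d i]` with `[l, i] d + d [l,
i]`, the third expresses `[L, d]` through `d²`. -/
theorem commutator_mul_identity (l l' i : R) :
    (l * l' - l' * l) * i - i * (l * l' - l' * l) =
      (l * (l' * i - i * l') - (l' * i - i * l') * l) -
      (l' * (l * i - i * l) - (l * i - i * l) * l') := by
  noncomm_ring

theorem commutator_cartan_identity (l i d : R) :
    l * (i * d + d * i) - (i * d + d * i) * l - ((l * i - i * l) * d + d * (l * i - i * l)) =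
      i * (l * d - d * l) + (l * d - d * l) * i := by
  noncomm_ring

theorem commutator_sq_identity (i d : R) :
    (i * d + d * i) * d - d * (i * d + d * i) = i * (d * d) - d * d * i := by
  noncomm_ring

end Identities

namespace IsCartan

/-- Both sides are even derivations. They agree on functions because the anchor respects brackets,
and have the same commutators with contractions by the Jacobi identity of `𝓕`. -/
theorem commutator_lieOp [CharZero K] (hp : p.IsPerfect) (h : IsCartan p 𝓕 δ) (ξ η : F.Sec U) :
    lieOp p δ ξ * lieOp p δ η - lieOp p δ η * lieOp p δ ξ = lieOp p δ (𝓕.lie ξ η) := by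
  have key : ∀ {U : Opens X} (ξ η ζ : F.Sec U),
      (lieOp p δ ξ * lieOp p δ η - lieOp p δ η * lieOp p δ ξ) * p.contr ζ -
        p.contr ζ * (lieOp p δ ξ * lieOp p δ η - lieOp p δ η * lieOp p δ ξ) =
      lieOp p δ (𝓕.lie ξ η) * p.contr ζ - p.contr ζ * lieOp p δ (𝓕.lie ξ η) := by
    intro U ξ η ζ
    rw [commutator_mul_identity, h.lie, h.lie, h.lie, h.lie, h.lie, 𝓕.jacobi, p.contr_add]
    abel
  have hder := (lieOp_isDer (p := p) h.isDer ξ).commutator (lieOp_isDer (p := p) h.isDer η)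
    (lieOp_hasParity h.isDer ξ) (lieOp_hasParity h.isDer η)
  rw [sgn_one_left, one_smul, one_mul] at hder
  refine hp.ext_of_commutator_contr (k := 0) 1 (fun V hV f => ?_) (fun V hV D =>
      (hasDegree_lieOp _ _ (hasDegree_lieOp _ _ (hasDegree_ι D))).sub
        (hasDegree_lieOp _ _ (hasDegree_lieOp _ _ (hasDegree_ι D))))
      (fun V hV D => hasDegree_lieOp _ _ (hasDegree_ι D)) hder (lieOp_isDer h.isDer _)
      fun V hV ζ => ?_
  · simp only [sub_app, mul_app, h.lieOp_fn, 𝓕.lie_res, 𝓕.anchor_lie, Derivation.commutator_apply,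
      fn_sub]
  · rw [one_smul, one_smul, restr_sub, restr_mul, restr_mul, lieOp_restr, lieOp_restr, lieOp_restr,
      key, 𝓕.lie_res]

/-- The differential of a Lie algebroid squares to zero. -/
theorem sq_eq_zero [CharZero K] (hp : p.IsPerfect) (h : IsCartan p 𝓕 δ) :
    δ.toWOp U * δ.toWOp U = 0 := by
  -- Two contractions of `δ²f` give `𝔞(ξ)𝔞(η)f - 𝔞(η)𝔞(ξ)f - 𝔞([ξ, η])f = 0` up to sign, which
  -- suffices in degree two.
  have hfn : ∀ (U : Opens X) (f : 𝒪.Sec U), δ.d (δ.d (fn f)) = (0 : Wedge E U) := by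
    intro U f
    refine hp.eq_zero_of_contr_contr (δ.degree _ (δ.degree _ (hasDegree_fn (E := E) f)))
      fun V hV ξ η => ?_
    have h3 := congr_app (h.lie V ξ η) (δ.d (fn (𝒪.res hV f)))
    have h2 := lieOp_app (p := p) (δ := δ) ξ le_rfl (δ.d (fn (𝒪.res hV f)))
    rw [h.anchor] at h2
    rw [sub_app, mul_app, mul_app, h2, h.anchor, h.anchor, h.lieOp_fn, map_add,
      h.anchor, F.res_id, 𝓕.anchor_lie, Derivation.commutator_apply, fn_sub] at h3
    rw [δ.d_res, δ.d_res, res_fn]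
    exact add_eq_right.1 (sub_right_injective h3)
  -- `[L_ξ, δ] = 0`: on functions by `hfn`; and its anticommutator with `i_ζ` is `[L_ξ, L_ζ] -
  -- L_[ξ,ζ] = 0`.
  have hZ : ∀ (U : Opens X) (ξ : F.Sec U),
      lieOp p δ ξ * δ.toWOp U - δ.toWOp U * lieOp p δ ξ = 0 := by
    intro U ξ
    have hder := (lieOp_isDer (p := p) h.isDer ξ).commutator (h.isDer.toWOp U)
      (lieOp_hasParity h.isDer ξ) (h.isDer.hasParity U)
    rw [sgn_one_left, one_smul, one_mul] at hder
    refine hp.ext_of_commutator_contr (k := 1) (-1) (fun V hV f => ?_) (fun V hV D =>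
      (hasDegree_lieOp _ _ (δ.degree _ (hasDegree_ι D))).sub
        (δ.degree _ (hasDegree_lieOp _ _ (hasDegree_ι D))))
      (fun V hV D => hasDegree_zero _) hder (isDer_zero _) fun V hV ζ => ?_
    · rw [lieOp, commutator_sq_identity]
      simp [hfn, δ.d_zero]
    · have := commutator_cartan_identity (lieOp p δ (F.res hV ξ)) (p.contr ζ) (δ.toWOp V)
      rw [h.lie] at this
      have h' := h.commutator_lieOp hp (F.res hV ξ) ζ
      rw [← sub_eq_zero] at h'
      rw [restr_sub, restr_mul, restr_mul, lieOp_restr, Units.neg_smul, one_smul, sub_neg_eq_add,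
        add_comm]
      refine this.symm.trans (h'.trans ?_)
      refine ext_app fun W hW a => ?_
      simp
  -- The commutator of `δ²` with `i_ζ` is `[δ, L_ζ]`, which vanishes by `hZ`.
  refine hp.ext_of_commutator_contr (k := 2) 1 (fun V hV f => hfn V f) (fun V hV D =>
      δ.degree _ (δ.degree _ (hasDegree_ι D)))
      (fun V hV D => hasDegree_zero _) (h.isDer.sq U) (isDer_zero _) fun V hV ζ => ?_
  have := hZ V ζ
  rw [lieOp, commutator_sq_identity, ← neg_eq_zero, neg_sub] at this
  rw [one_smul]
  refine this.trans (ext_app fun W hW a => ?_)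
  simp

end IsCartan

end Cartan

end

section

open Wedge WOp

/-! ## Existence of the differential -/

section Existence

variable {E : ModSheaf.{u, v, w} 𝒪} {F : ModSheaf.{u, v, w'} 𝒪} {p : Pairing E F}
variable {U V : Opens X}

/-- The two-form with given coefficients in a pair of dual frames. -/
def frameForm {n : ℕ} (e : Fin n → E.Sec U) (ε : Fin n → F.Sec U)
    (c : F.Sec U →ₗ[𝒪.Sec U] F.Sec U →ₗ[𝒪.Sec U] 𝒪.Sec U) : Wedge E U :=
  fn (algebraMap K (𝒪.Sec U) 2⁻¹) * ∑ i, ∑ j, fn (c (ε i) (ε j)) * (ι (e i) * ι (e j))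

theorem Pairing.IsDualOn.contr_contr_frameForm [CharZero K] {n : ℕ} {e : Fin n → E.Sec U}
    {ε : Fin n → F.Sec U} (h : p.IsDualOn e ε)
    (c : F.Sec U →ₗ[𝒪.Sec U] F.Sec U →ₗ[𝒪.Sec U] 𝒪.Sec U) (hc : ∀ ξ η, c ξ η = -c η ξ)
    (ξ η : F.Sec U) :
    (p.contr η).app U le_rfl ((p.contr ξ).app U le_rfl (frameForm e ε c)) = fn (c ξ η) := by
  have hexp : ∀ ξ η, c ξ η = ∑ i, ∑ j, c (ε i) (ε j) * (p.pair (e i) ξ * p.pair (e j) η) := by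
    intro ξ η
    conv_lhs => rw [h.right U le_rfl ξ, h.right U le_rfl η]
    simp only [map_sum, map_smul, LinearMap.sum_apply, LinearMap.smul_apply, smul_eq_mul,
      F.res_id, E.res_id, Finset.mul_sum]
    rw [Finset.sum_comm]
    refine Finset.sum_congr rfl fun i _ => Finset.sum_congr rfl fun j _ => ?_
    ring
  have hhalf : algebraMap K (𝒪.Sec U) 2⁻¹ * 2 = 1 := by
    rw [← map_ofNat (algebraMap K (𝒪.Sec U)) 2, ← map_mul, inv_mul_cancel₀ two_ne_zero, map_one]
  -- The double sum meets each pair of frame vectors in both orders, whence the factor `1/2` and the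
  -- difference `c ξ η - c η ξ`.
  have hcalc : (p.contr η).app U le_rfl ((p.contr ξ).app U le_rfl (frameForm e ε c)) =
      fn (algebraMap K (𝒪.Sec U) 2⁻¹ * (c ξ η - c η ξ)) := by
    simp only [frameForm, p.contr_fn_mul, map_sum, p.contr_ι_mul, p.contr_ι, map_sub, F.res_id]
    rw [fn_mul, hexp ξ η, hexp η ξ, ← Finset.sum_sub_distrib, fn_sum]
    refine congrArg _ (Finset.sum_congr rfl fun i _ => ?_)
    rw [← Finset.sum_sub_distrib, fn_sum]
    refine Finset.sum_congr rfl fun j _ => ?_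
    rw [p.contr_fn, mul_zero, sub_zero, ← fn_mul, ← fn_mul, ← fn_sub, ← fn_mul]
    congr 1
    ring
  rw [hcalc, hc η ξ, sub_neg_eq_add, ← two_mul, ← mul_assoc, hhalf, one_mul]

theorem hasDegree_frameForm {n : ℕ} (e : Fin n → E.Sec U) (ε : Fin n → F.Sec U)
    (c : F.Sec U →ₗ[𝒪.Sec U] F.Sec U →ₗ[𝒪.Sec U] 𝒪.Sec U) : (frameForm e ε c).HasDegree 2 :=
  HasDegree.fn_mul (HasDegree.sum fun _ => HasDegree.sum fun _ =>
    HasDegree.fn_mul ((hasDegree_ι _).mul (hasDegree_ι _)) _) _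

/-- Representability of alternating bilinear forms on `F`. -/
theorem Pairing.IsPerfect.exists_twoForm [CharZero K] (h : p.IsPerfect)
    (c : ∀ V : Opens X, V ≤ U → (F.Sec V →ₗ[𝒪.Sec V] F.Sec V →ₗ[𝒪.Sec V] 𝒪.Sec V))
    (nat : ∀ (V W : Opens X) (hV : V ≤ U) (hW : W ≤ V) (ξ η : F.Sec V),
      𝒪.res hW (c V hV ξ η) = c W (hW.trans hV) (F.res hW ξ) (F.res hW η))
    (hc : ∀ (V : Opens X) (hV : V ≤ U) (ξ η : F.Sec V), c V hV ξ η = -c V hV η ξ) :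
    ∃ b : Wedge E U, b.HasDegree 2 ∧ ∀ (V : Opens X) (hV : V ≤ U) (ξ η : F.Sec V),
      (p.contr η).app V le_rfl ((p.contr ξ).app V le_rfl (res hV b)) = fn (c V hV ξ η) := by
  let Rel : ∀ V : Opens X, V ≤ U → Wedge E V → Prop := fun V hV s => s.HasDegree 2 ∧
    ∀ (W : Opens X) (hW : W ≤ V) (ξ η : F.Sec W),
      (p.contr η).app W le_rfl ((p.contr ξ).app W le_rfl (res hW s)) = fn (c W (hW.trans hV) ξ η)
  have cover : ∀ x ∈ U, ∃ (V : Opens X) (hV : V ≤ U) (s : Wedge E V), x ∈ V ∧ Rel V hV s := by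
    intro x hx
    obtain ⟨V, hV, n, e, ε, hxV, hd⟩ := h.exists_le hx
    refine ⟨V, hV, frameForm e ε (c V hV), hxV, hasDegree_frameForm _ _ _, fun W hW ξ η => ?_⟩
    have hres : res hW (frameForm e ε (c V hV)) = frameForm (fun i => E.res hW (e i))
        (fun i => F.res hW (ε i)) (c W (hW.trans hV)) := by
      simp only [frameForm, map_mul, map_sum, res_fn, res_ι, nat, TopRingedSpace.res_algebraMap]
    rw [hres, (hd.res hW).contr_contr_frameForm _ (hc W _)]
  -- Forms from different frames agree on overlaps because a form of degree two is determined by its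
  -- double contractions.
  obtain ⟨b, hb⟩ := Wedge.exists_glue Rel cover fun V W hV hW s t hs ht x hxV hxW =>
    ⟨V ⊓ W, inf_le_left, inf_le_right, ⟨hxV, hxW⟩, sub_eq_zero.1 <|
      h.eq_zero_of_contr_contr (k := 0) ((hs.1.res _).sub (ht.1.res _)) fun Z hZ ξ η => by
        rw [map_sub, map_sub, map_sub, res_res, res_res, hs.2, ht.2, sub_self]⟩
  refine ⟨b, hasDegree_local fun x hx => ?_, fun V hV ξ η => Wedge.ext_local fun x hx => ?_⟩
  · obtain ⟨V, hV, s, hxV, hs⟩ := cover x hx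
    exact ⟨V, hV, hxV, by rw [hb V hV s hs]; exact hs.1⟩
  · obtain ⟨W, hW, s, hxW, hs⟩ := cover x (hV hx)
    refine ⟨V ⊓ W, inf_le_left, ⟨hx, hxW⟩, ?_⟩
    have := hs.2 (V ⊓ W) inf_le_right (F.res inf_le_left ξ) (F.res inf_le_left η)
    rw [← hb W hW s hs, res_res] at this
    rw [WOp.nat, WOp.nat, p.contr_app, p.contr_app ξ, res_res, this, res_fn, nat]

variable (p) in
/-- The values of the differential on sections of `E`, as bilinear forms on `F`. -/
def dForm (𝓕 : LieAlgebroid F) (D : E.Sec U) :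
    F.Sec U →ₗ[𝒪.Sec U] F.Sec U →ₗ[𝒪.Sec U] 𝒪.Sec U :=
  LinearMap.mk₂ (𝒪.Sec U)
    (fun ξ η => 𝓕.anchor ξ (p.pair D η) - 𝓕.anchor η (p.pair D ξ) - p.pair D (𝓕.lie ξ η))
    (fun ξ ξ' η => by
      simp only [map_add, 𝓕.add_lie, Derivation.add_apply]; ring)
    (fun f ξ η => by
      rw [𝓕.lie_swap]
      simp only [map_smul, map_neg, map_add, 𝓕.leibniz, Derivation.smul_apply, smul_eq_mul,
        Derivation.leibniz]
      rw [𝓕.lie_swap ξ η, map_neg]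
      ring)
    (fun ξ η η' => by
      simp only [map_add, 𝓕.lie_add, Derivation.add_apply]; ring)
    (fun f ξ η => by
      simp only [map_smul, map_add, 𝓕.leibniz, Derivation.smul_apply, smul_eq_mul,
        Derivation.leibniz]
      ring)

theorem dForm_apply (𝓕 : LieAlgebroid F) (D : E.Sec U) (ξ η : F.Sec U) : dForm p 𝓕 D ξ η =
    𝓕.anchor ξ (p.pair D η) - 𝓕.anchor η (p.pair D ξ) - p.pair D (𝓕.lie ξ η) := rfl

theorem exists_dFn (hp : p.IsPerfect) (𝓕 : LieAlgebroid F) (f : 𝒪.Sec U) : ∃ D : E.Sec U,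
    ∀ (V : Opens X) (hV : V ≤ U) (ξ : F.Sec V),
      p.pair (E.res hV D) ξ = 𝓕.anchor ξ (𝒪.res hV f) :=
  hp.exists_left (U := U)
    { app := fun V hV =>
      { toFun := fun ξ => 𝓕.anchor ξ (𝒪.res hV f)
        map_add' := fun ξ η => by rw [map_add, Derivation.add_apply]
        map_smul' := fun g ξ => by rw [map_smul, Derivation.smul_apply]; rfl }
      natural := fun V W hV hW ξ => 𝓕.anchor_res hW ξ _ }

theorem exists_dSec [CharZero K] (hp : p.IsPerfect) (𝓕 : LieAlgebroid F) (D : E.Sec U) :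
    ∃ b : Wedge E U, b.HasDegree 2 ∧ ∀ (V : Opens X) (hV : V ≤ U) (ξ η : F.Sec V),
      (p.contr η).app V le_rfl ((p.contr ξ).app V le_rfl (res hV b)) =
        fn (dForm p 𝓕 (E.res hV D) ξ η) :=
  hp.exists_twoForm (fun V hV => dForm p 𝓕 (E.res hV D))
    (fun V W hV hW ξ η => by
      simp only [dForm_apply, map_sub, 𝓕.anchor_res, ← p.pair_res, 𝓕.lie_res, E.res_res])
    (fun V hV ξ η => by rw [dForm_apply, dForm_apply, 𝓕.lie_swap η ξ, map_neg]; ring)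

/-- The Chevalley-Eilenberg formula in degrees 0 and 1 defines a linear form for each function and
an alternating bilinear form for each section. Perfectness represents both in `⋀ E`, and
`WOp.exists_der` extends them to an odd derivation. -/
theorem exists_isCartan [CharZero K] (hp : p.IsPerfect) (𝓕 : LieAlgebroid F) :
    ∃ δ : DegOneOp E, IsCartan p 𝓕 δ := by
  choose d₀ hd₀ using fun V : Opens X => exists_dFn hp 𝓕 (U := V)
  choose d₁ hd₁ hd₁' using fun V : Opens X => exists_dSec hp 𝓕 (U := V)
  -- Used, with `hp.ext_left` in degree one, to reduce the hypotheses of the extension theorem to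
  -- identities between functions.
  have ext₂ : ∀ {V : Opens X} {a b : Wedge E V}, a.HasDegree 2 → b.HasDegree 2 →
      (∀ (W : Opens X) (hW : W ≤ V) (ξ η : F.Sec W),
        (p.contr η).app W le_rfl ((p.contr ξ).app W le_rfl (res hW a)) =
        (p.contr η).app W le_rfl ((p.contr ξ).app W le_rfl (res hW b))) → a = b :=
    fun ha hb H => sub_eq_zero.1 (hp.eq_zero_of_contr_contr (k := 0) (ha.sub hb)
      fun W hW ξ η => by rw [map_sub, map_sub, map_sub, H, sub_self])
  obtain ⟨T, hT, -, hT₀, hT₁⟩ := WOp.exists_der (E := E) (U := ⊤) (-1)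
    (fun V _ => AddMonoidHom.mk' (fun f => ι (d₀ V f)) fun f g => by
      rw [← ι_add]
      refine congrArg ι (hp.ext_left fun W hW ξ => ?_)
      simp only [map_add, LinearMap.add_apply, hd₀])
    (fun V _ => AddMonoidHom.mk' (d₁ V) fun D D' => by
      refine ext₂ (hd₁ V _) ((hd₁ V _).add (hd₁ V _)) fun W hW ξ η => ?_
      simp only [map_add, hd₁', ← fn_add, dForm_apply, LinearMap.add_apply]
      congr 1; ring)
    (fun V W hV hW f => by
      refine (res_ι hW _).trans (congrArg ι (hp.ext_left fun Z hZ ξ => ?_))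
      simp only [E.res_res, hd₀, TopRingedSpace.res_res])
    (fun V W hV hW D => by
      refine ext₂ ((hd₁ V _).res hW) (hd₁ W _) fun Z hZ ξ η => ?_
      simp only [AddMonoidHom.mk'_apply, hd₁', res_res, E.res_res])
    (fun V hV f g => by
      simp only [AddMonoidHom.mk'_apply, ← ι_smul, ← ι_add]
      refine congrArg ι (hp.ext_left fun Z hZ ξ => ?_)
      simp only [hd₀, map_add, map_smulₛₗ, LinearMap.add_apply, LinearMap.smul_apply, map_mul,
        Derivation.leibniz, smul_eq_mul, RingHom.id_apply])
    (fun V hV f D => by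
      refine ext₂ (hd₁ V _) (((hd₁ V _).fn_mul f).add ((hasDegree_ι _).mul (hasDegree_ι _)))
        fun W hW ξ η => ?_
      simp only [AddMonoidHom.mk'_apply, map_add, map_mul, res_fn, res_ι, p.contr_fn_mul,
        p.contr_ι_mul, p.contr_ι, hd₁', hd₀, F.res_id, map_sub,
        fn_comm (p.pair _ _)]
      simp only [← fn_mul, ← fn_sub, ← fn_add, dForm_apply]
      congr 1
      simp only [map_smulₛₗ, LinearMap.smul_apply, smul_eq_mul, Derivation.leibniz,
        RingHom.id_apply]
      ring)
    (fun V hV f => by simp [Units.smul_def])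
    (fun V hV D => by
      rw [AddMonoidHom.mk'_apply, (hd₁ V D).invol, neg_neg]; rfl)
  have hTfn : ∀ (V : Opens X) (hV : V ≤ ⊤) (f : 𝒪.Sec V), T.app V hV (fn f) = ι (d₀ V f) := hT₀
  have hTι : ∀ (V : Opens X) (hV : V ≤ ⊤) (D : E.Sec V), T.app V hV (ι D) = d₁ V D := hT₁
  have hdeg : ∀ {V : Opens X} {i : ℕ} (a : Wedge E V), a.HasDegree i →
      (T.app V le_top a).HasDegree (i + 1) := fun {V i} a ha =>
    hT.hasDegree 2 (fun W hW f k hk => by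
      obtain rfl : k = 1 := by omega
      rw [hTfn]; exact hasDegree_ι _) (by simp)
      (fun W hW D => by rw [hTι]; exact hd₁ _ _) le_top a ha (by ring)
  let δ : DegOneOp E :=
    { d := fun {U} a => T.app U le_top a
      d_res := fun h a => T.nat _ _ _ h a
      d_add := fun a b => map_add _ _ _
      d_smul := fun {U} c a => by
        have : d₀ U (algebraMap K (𝒪.Sec U) c) = 0 := hp.ext_left fun V hV ξ => by
          rw [hd₀, TopRingedSpace.res_algebraMap, Derivation.map_algebraMap, map_zero, map_zero,
            LinearMap.zero_apply]
        rw [hT.fn_mul, hTfn, this, ι_zero, zero_mul, zero_add]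
      degree := fun a ha => hdeg a ha }
  have hδ : δ.IsDer := hT
  have hδfn : ∀ (V : Opens X) (f : 𝒪.Sec V), δ.d (fn f) = ι (d₀ V f) := fun V f => hTfn V _ f
  have hδι : ∀ (V : Opens X) (D : E.Sec V), δ.d (ι D) = d₁ V D := fun V D => hTι V _ D
  have hanchor : ∀ (U : Opens X) (ξ : F.Sec U) (f : 𝒪.Sec U),
      (p.contr ξ).app U le_rfl (δ.d (fn f)) = fn (𝓕.anchor ξ f) := fun U ξ f => by
    have := hd₀ U f U le_rfl ξ
    rw [E.res_id, TopRingedSpace.res_rfl] at this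
    rw [hδfn, p.contr_ι, F.res_id, this]
  -- Both sides of the last Cartan formula are odd derivations killing functions; on a section the
  -- formula is the definition of `dForm`.
  refine ⟨δ, hδ, hanchor, fun U ξ η => (lieOp_commutator_isDer hδ ξ η).ext (p.contr_isDer _)
    (fun V hV f => by rw [lieOp_commutator_fn, p.contr_fn]) fun V hV D => ?_⟩
  have h2 := hd₁' V D V le_rfl (F.res hV ξ) (F.res hV η)
  rw [res_rfl, E.res_id, dForm_apply, ← hδι] at h2
  rw [sub_app, mul_app, mul_app, lieOp_app ξ hV (ι D), map_add, p.contr_app ξ, p.contr_app η hV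
    ((p.contr (F.res hV ξ)).app V le_rfl _), h2, p.contr_ι, p.contr_ι, p.contr_ι, lieOp_fn,
    p.contr_app ξ, hanchor, p.contr_app η, hanchor, ← fn_add, ← fn_sub, 𝓕.lie_res]
  congr 1
  ring

end Existence

end

/-! ### Well-definedness of the Chevalley-Eilenberg differential -/

section

open Wedge WOp

section

variable {E : ModSheaf.{u, v, w} 𝒪} {F : ModSheaf.{u, v, w'} 𝒪} {p : Pairing E F}
variable {U V : Opens X}

theorem existsUnique_isCEDifferential [CharZero K] (hp : p.IsPerfect) (𝓕 : LieAlgebroid F) :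
    ∃! δ, IsCEDifferential p 𝓕 δ := by
  obtain ⟨δ, hδ⟩ := exists_isCartan hp 𝓕
  exact ⟨δ, hδ.isCEDifferential, fun _ h => h.unique hp hδ.isCEDifferential⟩

theorem isCEDifferential_ceDifferential [CharZero K] (hp : p.IsPerfect) (𝓕 : LieAlgebroid F) :
    IsCEDifferential p 𝓕 (ceDifferential p 𝓕) :=
  Classical.epsilon_spec (existsUnique_isCEDifferential hp 𝓕).exists

/-- A Cartan differential satisfies the Chevalley-Eilenberg formula, and that formula has only one
solution. -/
theorem IsCEDifferential.isCartan [CharZero K] (hp : p.IsPerfect) {𝓕 : LieAlgebroid F}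
    {δ : DegOneOp E} (h : IsCEDifferential p 𝓕 δ) : IsCartan p 𝓕 δ := by
  obtain ⟨δ', hδ'⟩ := exists_isCartan hp 𝓕
  rwa [h.unique hp hδ'.isCEDifferential]

/-! ## The Lie algebroid of a differential -/

theorem toWOp_mul_lmul (δ : DegOneOp E) (c : K) :
    δ.toWOp U * lmul (fn (algebraMap K (𝒪.Sec U) c)) =
      lmul (fn (algebraMap K (𝒪.Sec U) c)) * δ.toWOp U :=
  ext_app fun V hV a => by
    simp only [mul_app, lmul_app, DegOneOp.toWOp_app, res_fn, TopRingedSpace.res_algebraMap,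
      δ.d_smul]

theorem lmul_fn_comm (f : 𝒪.Sec U) {ε : ℤˣ} {T : WOp E E U} (hT : T.IsDer ε)
    : T * lmul (fn f) = lmul (T.app U le_rfl (fn f)) + lmul (fn f) * T :=
  ext_app fun V hV a => by
    simp only [mul_app, lmul_app, add_app, res_fn, hT.fn_mul, T.nat]

theorem lieOp_add (δ : DegOneOp E) (ξ η : F.Sec U) :
    lieOp p δ (ξ + η) = lieOp p δ ξ + lieOp p δ η := by
  rw [lieOp, lieOp, lieOp, p.contr_add]; noncomm_ring

theorem lieOp_algebraMap_smul (δ : DegOneOp E) (c : K) (ξ : F.Sec U) :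
    lieOp p δ (algebraMap K (𝒪.Sec U) c • ξ) =
      lmul (fn (algebraMap K (𝒪.Sec U) c)) * lieOp p δ ξ := by
  rw [lieOp, lieOp, p.contr_smul, ← mul_assoc (δ.toWOp U), toWOp_mul_lmul]; noncomm_ring

theorem lieOp_commutator_self_identity {R : Type*} [Ring R] (i d : R) (h : i * i = 0) :
    (i * d + d * i) * i - i * (i * d + d * i) = 0 := by
  have : (i * d + d * i) * i - i * (i * d + d * i) = d * (i * i) - i * i * d := by noncomm_ring
  rw [this, h, mul_zero, zero_mul, sub_zero]

theorem commutator_contr_identity {R : Type*} [Ring R] (l l' i : R) :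
    l * (l' * i - i * l') - (l' * i - i * l') * l =
    ((l * l' - l' * l) * i - i * (l * l' - l' * l)) +
      (l' * (l * i - i * l) - (l * i - i * l) * l') := by
  noncomm_ring

/-- A differential on `⋀ E` gives a Lie algebroid structure on `F`. -/
theorem exists_isCartan_of_sq_eq_zero [CharZero K] (hp : p.IsPerfect) {δ : DegOneOp E}
    (hδ : δ.IsDer) (hsq : ∀ (U : Opens X) (a : Wedge E U), δ.d (δ.d a) = 0) :
    ∃ 𝓕 : LieAlgebroid F, IsCartan p 𝓕 δ := by
  -- The derived bracket: `[L_ξ, i_η]` is a derivation of degree `-1` vanishing on functions, hence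
  -- a contraction. Injectivity of `p.contr` turns the axioms for the bracket into operator
  -- identities.
  have hlie : ∀ {U : Opens X} (ξ η : F.Sec U), ∃ ζ : F.Sec U,
      lieOp p δ ξ * p.contr η - p.contr η * lieOp p δ ξ = p.contr ζ := fun ξ η =>
    hp.exists_eq_contr (lieOp_commutator_isDer hδ ξ η)
      (fun V hV f => lieOp_commutator_fn ξ η hV f)
      fun V hV D => hasDegree_lieOp_commutator ξ η hV D
  choose lie hlie using @hlie
  have hanc : ∀ {U : Opens X} (ξ : F.Sec U) (f : 𝒪.Sec U), ∃ g : 𝒪.Sec U,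
      (p.contr ξ).app U le_rfl (δ.d (fn f)) = fn g := fun ξ f =>
    (p.hasDegree_contr ξ le_rfl (δ.degree _ (hasDegree_fn f))).exists_fn
  choose anc hanc using @hanc
  have hsq' : ∀ U : Opens X, δ.toWOp U * δ.toWOp U = 0 := fun U => ext_app fun V hV a => hsq V a
  have hL : ∀ {U : Opens X} (ξ : F.Sec U) (f : 𝒪.Sec U),
      (lieOp p δ ξ).app U le_rfl (fn f) = fn (anc ξ f) := fun ξ f => by rw [lieOp_fn, hanc]
  -- The only place where `δ² = 0` is needed: it gives `[L_ξ, δ] = 0` and hence `L_[ξ,η] = [L_ξ,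
  -- L_η]`, the source of the Jacobi identity and of the compatibility of the anchor with brackets.
  have hLL : ∀ {U : Opens X} (ξ η : F.Sec U), lieOp p δ (lie ξ η) =
      lieOp p δ ξ * lieOp p δ η - lieOp p δ η * lieOp p δ ξ := by
    intro U ξ η
    have h1 : lieOp p δ ξ * δ.toWOp U - δ.toWOp U * lieOp p δ ξ = 0 := by
      rw [lieOp, commutator_sq_identity, hsq', mul_zero, zero_mul, sub_zero]
    have h2 := commutator_cartan_identity (lieOp p δ ξ) (p.contr η) (δ.toWOp U)
    rw [h1, hlie, mul_zero, zero_mul, add_zero] at h2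
    exact (sub_eq_zero.1 h2).symm
  let anchor {U : Opens X} : F.Sec U →ₗ[𝒪.Sec U] Derivation K (𝒪.Sec U) (𝒪.Sec U) :=
    { toFun := fun ξ => Derivation.mk'
        { toFun := anc ξ
          map_add' := fun f g => fn_injective (E := E) <| by
            rw [fn_add, ← hL, ← hL, ← hL, fn_add, map_add]
          map_smul' := fun c f => fn_injective (E := E) <| by
            rw [RingHom.id_apply, Algebra.smul_def, Algebra.smul_def, fn_mul, ← hanc, ← hanc, fn_mul,
              δ.d_smul, p.contr_fn_mul] }
        (fun f g => fn_injective (E := E) <| by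
          change fn (anc ξ (f * g)) = fn (f * anc ξ g + g * anc ξ f)
          rw [fn_add, fn_mul, fn_mul, ← hL, ← hL, ← hL, fn_mul, (lieOp_isDer hδ ξ).fn_mul, add_comm,
            fn_comm])
      map_add' := fun ξ η => Derivation.ext fun f => fn_injective (E := E) <| by
        change fn (anc (ξ + η) f) = fn (anc ξ f + anc η f)
        rw [fn_add, ← hanc, ← hanc, ← hanc, p.contr_add, add_app]
      map_smul' := fun g ξ => Derivation.ext fun f => fn_injective (E := E) <| by
        change fn (anc (g • ξ) f) = fn (g * anc ξ f)
        rw [fn_mul, ← hanc, ← hanc, p.contr_smul]; rfl }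
  have hA : ∀ {U : Opens X} (ξ : F.Sec U) (f : 𝒪.Sec U), anchor ξ f = anc ξ f := fun _ _ => rfl
  refine ⟨{ lie := lie, anchor := anchor, lie_res := ?_, anchor_res := ?_, add_lie := ?_,
            lie_add := ?_, smul_lie := ?_, lie_smul := ?_, lie_self := ?_, jacobi := ?_,
            anchor_lie := ?_, leibniz := ?_ }, hδ, fun U ξ f => hanc ξ f, fun U ξ η => hlie ξ η⟩
  · intro U V h ξ η
    refine hp.contr_injective ?_
    rw [← hlie, ← p.contr_restr, ← hlie, ← lieOp_restr, ← p.contr_restr]; rfl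
  · intro U V h ξ f
    refine fn_injective (E := E) ?_
    rw [hA, hA, ← hanc, ← res_fn, ← hanc, WOp.nat, p.contr_app, δ.d_res, res_fn]
  · intro U ξ ξ' η
    refine hp.contr_injective ?_
    rw [p.contr_add, ← hlie, ← hlie, ← hlie, lieOp_add]; noncomm_ring
  · intro U ξ η η'
    refine hp.contr_injective ?_
    rw [p.contr_add, ← hlie, ← hlie, ← hlie, p.contr_add]; noncomm_ring
  · intro U c ξ η
    refine hp.contr_injective ?_
    rw [p.contr_smul, ← hlie, ← hlie, lieOp_algebraMap_smul, mul_sub, ← mul_assoc (p.contr η),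
      lmul_fn_comm _ (p.contr_isDer η), p.contr_fn, mul_assoc, ← mul_assoc]
    have : lmul (0 : Wedge E U) = 0 := ext_app fun V hV a => by simp
    rw [this, zero_add, mul_assoc, mul_assoc]
  · intro U c ξ η
    have h1 : (lieOp p δ ξ).app U le_rfl (fn (algebraMap K (𝒪.Sec U) c)) = 0 := by
      rw [hL, ← hA, Derivation.map_algebraMap, fn_zero]
    have : lmul (0 : Wedge E U) = 0 := ext_app fun V hV a => by simp
    refine hp.contr_injective ?_
    rw [p.contr_smul, ← hlie, ← hlie, p.contr_smul, mul_sub, ← mul_assoc,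
      lmul_fn_comm _ (lieOp_isDer hδ ξ), h1, this, zero_add]
    noncomm_ring
  · intro U ξ
    refine hp.contr_injective ?_
    rw [← hlie, lieOp, lieOp_commutator_self_identity _ _ (p.contr_self ξ)]
    exact ((p.contr_isDer _).ext (isDer_zero _) (fun V hV f => by simp) fun V hV D => by simp).symm
  · intro U ξ η ζ
    refine hp.contr_injective ?_
    rw [p.contr_add, ← hlie, ← hlie, ← hlie, hLL, ← hlie, ← hlie, commutator_contr_identity]
  · intro U ξ η
    refine Derivation.ext fun f => fn_injective (E := E) ?_
    rw [Derivation.commutator_apply, hA, hA, hA, hA, hA, fn_sub, ← hL, hLL, sub_app, mul_app,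
      mul_app, hL, hL, hL, hL]
  · intro U ξ η f
    refine hp.contr_injective ?_
    rw [p.contr_add, p.contr_smul, p.contr_smul, ← hlie, ← hlie, p.contr_smul, ← mul_assoc,
      lmul_fn_comm _ (lieOp_isDer hδ ξ), hL, hA]
    noncomm_ring

end

end

section

open Wedge WOp

/-! ## Derivations along homomorphisms -/

section Along

variable {E : ModSheaf.{u, v, w} 𝒪} {G : ModSheaf.{u, v, w'} 𝒪} {U : Opens X}

/-- Graded derivations along a homomorphism. -/
def WOp.IsDerAlong (Φ : GradedAlgHom E G) (ε : ℤˣ) (T : WOp E G U) : Prop :=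
  ∀ (V : Opens X) (hV : V ≤ U) (D : E.Sec V) (a : Wedge E V),
    T.app V hV (ι D * a) = T.app V hV (ι D) * Φ.map a + ε • (Φ.map (ι D) * T.app V hV a)

variable {Φ : GradedAlgHom E G} {ε : ℤˣ}

theorem WOp.IsDerAlong.ext {S T : WOp E G U} (hS : S.IsDerAlong Φ ε) (hT : T.IsDerAlong Φ ε)
    (h₀ : ∀ (V : Opens X) (hV : V ≤ U) (f : 𝒪.Sec V), S.app V hV (fn f) = T.app V hV (fn f))
    (h₁ : ∀ (V : Opens X) (hV : V ≤ U) (D : E.Sec V), S.app V hV (ι D) = T.app V hV (ι D)) :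
    S = T :=
  ext_gen h₀ fun V hV D a e => by rw [hS, hT, h₁, e]

theorem GradedAlgHom.exists_map_ι (Φ : GradedAlgHom E G) (D : E.Sec U) :
    ∃ D' : G.Sec U, Φ.map (ι D) = ι D' := (Φ.degree _ (hasDegree_ι D)).exists_ι

theorem WOp.IsDer.comp_hom {T : WOp G G U} (hT : T.IsDer ε) (Φ : GradedAlgHom E G) :
    (T.comp (Φ.toWOp U)).IsDerAlong Φ ε := fun V hV D a => by
  obtain ⟨D', hD'⟩ := Φ.exists_map_ι D
  simp only [comp_app, GradedAlgHom.toWOp_app, map_mul, hD', hT.ι_mul]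

theorem WOp.IsDer.hom_comp {T : WOp E E U} (hT : T.IsDer ε) (Φ : GradedAlgHom E G) :
    ((Φ.toWOp U).comp T).IsDerAlong Φ ε := fun V hV D a => by
  simp only [comp_app, GradedAlgHom.toWOp_app, hT.ι_mul, map_add, map_units_smul, map_mul]

/-- Preservation of degree keeps sections of `E` in degree one, so `Φ` restricts to a morphism of
modules there. -/
theorem GradedAlgHom.exists_linear (Φ : GradedAlgHom E G) :
    ∃ φ : ∀ U : Opens X, E.Sec U →ₗ[𝒪.Sec U] G.Sec U,
      (∀ (U : Opens X) (D : E.Sec U), Φ.map (ι D) = ι (φ U D)) ∧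
      ∀ (U V : Opens X) (h : V ≤ U) (D : E.Sec U), G.res h (φ U D) = φ V (E.res h D) := by
  choose c hc using fun (U : Opens X) (D : E.Sec U) => Φ.exists_map_ι D
  refine ⟨fun U => ⟨⟨c U, fun D D' => ι_injective ?_⟩, fun f D => ι_injective ?_⟩,
    hc, fun U V h D => ι_injective ?_⟩
  · rw [ι_add, ← hc, ← hc, ← hc, ι_add, map_add]
  · change ι (c U (f • D)) = ι (f • c U D)
    rw [ι_smul, ← hc, ← hc, ι_smul, map_mul, Φ.map_fn]
  · change ι (G.res h (c U D)) = ι (c V (E.res h D))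
    rw [← res_ι, ← hc, ← hc, Φ.map_res, res_ι]

/-- A homomorphism of graded algebras is compatible with Gerstenhaber brackets if it is so on
generators. -/
theorem GradedAlgHom.map_br {β : GerstenhaberBracket E} {β' : GerstenhaberBracket G}
    (Φ : GradedAlgHom E G)
    (h₀ : ∀ (U : Opens X) (D : E.Sec U) (f : 𝒪.Sec U),
      Φ.map (β.br (ι D) (fn f)) = β'.br (Φ.map (ι D)) (fn f))
    (h₁ : ∀ (U : Opens X) (D D' : E.Sec U),
      Φ.map (β.br (ι D) (ι D')) = β'.br (Φ.map (ι D)) (Φ.map (ι D')))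
    (a b : Wedge E U) : Φ.map (β.br a b) = β'.br (Φ.map a) (Φ.map b) := by
  let S {U : Opens X} (a : Wedge E U) : WOp E G U := (Φ.toWOp U).comp (β.ad a)
  let T {U : Opens X} (a : Wedge E U) : WOp E G U := (β'.ad (Φ.map a)).comp (Φ.toWOp U)
  have hS : ∀ {U : Opens X} (a : Wedge E U) (V : Opens X) (hV : V ≤ U) (b : Wedge E V),
    (S a).app V hV b = Φ.map (β.br (res hV a) b) := fun _ _ _ _ => rfl
  have hT : ∀ {U : Opens X} (a : Wedge E U) (V : Opens X) (hV : V ≤ U) (b : Wedge E V),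
    (T a).app V hV b = β'.br (Φ.map (res hV a)) (Φ.map b) := fun a V hV b => by
      rw [← Φ.map_res]; rfl
  have dS : ∀ {U : Opens X} {i : ℕ} {a : Wedge E U}, a.HasDegree i →
    (S a).IsDerAlong Φ (-(-1) ^ i) := fun ha => (β.ad_isDer ha).hom_comp Φ
  have dT : ∀ {U : Opens X} {i : ℕ} {a : Wedge E U}, a.HasDegree i →
    (T a).IsDerAlong Φ (-(-1) ^ i) := fun ha => (β'.ad_isDer (Φ.degree _ ha)).comp_hom Φ
  -- Generators are treated first; a homogeneous `a` follows by antisymmetry, and arbitrary `a` and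
  -- `b` by additivity.
  have hι : ∀ {U : Opens X} (D : E.Sec U), S (ι D) = T (ι D) := fun D =>
    (dS (hasDegree_ι D)).ext (dT (hasDegree_ι D))
      (fun V hV f => by rw [hS, hT, res_ι, h₀, Φ.map_fn])
      (fun V hV D' => by rw [hS, hT, res_ι, h₁])
  have hfn : ∀ {U : Opens X} (f : 𝒪.Sec U), S (fn f) = T (fn f) := fun f =>
    (dS (hasDegree_fn f)).ext (dT (hasDegree_fn f))
      (fun V hV g => by rw [hS, hT, res_fn, Φ.map_fn, Φ.map_fn, β.br_fn_fn, β'.br_fn_fn, map_zero])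
      (fun V hV D' => by
        obtain ⟨D'', hD''⟩ := Φ.exists_map_ι D'
        rw [hS, hT, res_fn, Φ.map_fn, β.br_fn_ι, map_neg, h₀, hD'', β'.br_fn_ι])
  have ha : ∀ {U : Opens X} {i : ℕ} {a : Wedge E U}, a.HasDegree i → S a = T a := by
    intro U i a ha
    refine (dS ha).ext (dT ha) (fun V hV f => ?_) fun V hV D => ?_
    · rw [hS, hT, β.antisymm _ _ (ha.res hV) (hasDegree_fn f),
        β'.antisymm _ _ (Φ.degree _ (ha.res hV)) (Φ.degree _ (hasDegree_fn f)), map_units_smul]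
      exact congrArg _ (congr_app (hfn f) (res hV a))
    · rw [hS, hT, β.antisymm _ _ (ha.res hV) (hasDegree_ι D),
        β'.antisymm _ _ (Φ.degree _ (ha.res hV)) (Φ.degree _ (hasDegree_ι D)), map_units_smul]
      exact congrArg _ (congr_app (hι D) (res hV a))
  have := congr_app (S := (Φ.toWOp U).comp (β.adRight b))
    (T := (β'.adRight (Φ.map b)).comp (Φ.toWOp U)) (ext_hom fun V hV i a h => by
      have := congr_app (ha h) (res hV b)
      simp only [comp_app, GradedAlgHom.toWOp_app, GerstenhaberBracket.adRight_app, Φ.map_res]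
      exact this) a
  exact this

end Along

/-! ## Transposes -/

section Transpose

variable {E : ModSheaf.{u, v, w} 𝒪} {F : ModSheaf.{u, v, w'} 𝒪} {p : Pairing E F}
variable {M : ModSheaf.{u, v, w''} 𝒪} {L : ModSheaf.{u, v, w₃} 𝒪} {q : Pairing M L}
variable {U V : Opens X}

variable (p q) in
/-- The homomorphism `Ψ : ⋀ M → ⋀ E` extends the transpose of `φ : F → L`. -/
structure IsTranspose (Ψ : GradedAlgHom M E) (φ : ∀ U : Opens X, F.Sec U → L.Sec U) : Prop where
  res : ∀ (U V : Opens X) (h : V ≤ U) (ξ : F.Sec U), L.res h (φ U ξ) = φ V (F.res h ξ)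
  contr_ι : ∀ (U : Opens X) (ξ : F.Sec U) (ω : M.Sec U),
    (p.contr ξ).app U le_rfl (Ψ.map (ι ω)) = fn (q.pair ω (φ U ξ))

variable {Ψ : GradedAlgHom M E} {φ : ∀ U : Opens X, F.Sec U → L.Sec U}

namespace IsTranspose

/-- The transpose relation, given on degree one, extends to all degrees because both composites are
derivations along `Ψ`. -/
theorem contr_comp (h : IsTranspose p q Ψ φ) (ξ : F.Sec U) :
    (p.contr ξ).comp (Ψ.toWOp U) = (Ψ.toWOp U).comp (q.contr (φ U ξ)) :=
  ((p.contr_isDer ξ).comp_hom Ψ).ext ((q.contr_isDer _).hom_comp Ψ)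
    (fun V hV f => by simp [Ψ.map_fn])
    (fun V hV ω => by
      simp only [comp_app, GradedAlgHom.toWOp_app, q.contr_ι, Ψ.map_fn]
      rw [p.contr_app, h.contr_ι, h.res])

theorem contr_map (h : IsTranspose p q Ψ φ) (ξ : F.Sec U) (a : Wedge M U) :
    (p.contr ξ).app U le_rfl (Ψ.map a) = Ψ.map ((q.contr (φ U ξ)).app U le_rfl a) :=
  congr_app (h.contr_comp ξ) a

variable {𝓕 : LieAlgebroid F} {𝓛 : LieAlgebroid L} {δ : DegOneOp E} {d : DegOneOp M}

theorem lieOp_map (h : IsTranspose p q Ψ φ)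
    (hΨ : ∀ (U : Opens X) (a : Wedge M U), Ψ.map (d.d a) = δ.d (Ψ.map a))
    (ξ : F.Sec U) (a : Wedge M U) :
    (lieOp p δ ξ).app U le_rfl (Ψ.map a) = Ψ.map ((lieOp q d (φ U ξ)).app U le_rfl a) := by
  rw [lieOp_app, lieOp_app, map_add, ← hΨ, h.contr_map, h.contr_map, hΨ]

theorem anchor_map (h : IsTranspose p q Ψ φ) (h𝓕 : IsCartan p 𝓕 δ) (h𝓛 : IsCartan q 𝓛 d)
    (hΨ : ∀ (U : Opens X) (a : Wedge M U), Ψ.map (d.d a) = δ.d (Ψ.map a))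
    (ξ : F.Sec U) (f : 𝒪.Sec U) : 𝓛.anchor (φ U ξ) f = 𝓕.anchor ξ f := by
  refine fn_injective (E := E) ?_
  rw [← h𝓕.anchor, ← Ψ.map_fn f, ← hΨ, h.contr_map, h𝓛.anchor, Ψ.map_fn]

/-- `Ψ` intertwines contractions and differentials, hence Lie derivatives. Applying it to `[L, i] =
i_[·,·]` on `M` evaluates `ω` on both candidate brackets, and perfectness of `q` separates sections
of `L`. -/
theorem lie_map (hq : q.IsPerfect) (h : IsTranspose p q Ψ φ) (h𝓕 : IsCartan p 𝓕 δ)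
    (h𝓛 : IsCartan q 𝓛 d)
    (hΨ : ∀ (U : Opens X) (a : Wedge M U), Ψ.map (d.d a) = δ.d (Ψ.map a))
    (ξ η : F.Sec U) : φ U (𝓕.lie ξ η) = 𝓛.lie (φ U ξ) (φ U η) := by
  refine hq.ext_right fun V hV ω => fn_injective (E := E) ?_
  rw [h.res, 𝓕.lie_res, 𝓛.lie_res, h.res, h.res, ← h.contr_ι, ← h𝓕.lie, sub_app, mul_app, mul_app,
    h.contr_map, h.lieOp_map hΨ, h.lieOp_map hΨ, h.contr_map, ← map_sub]
  have := congr_app (h𝓛.lie V (φ V (F.res hV ξ)) (φ V (F.res hV η))) (ι ω)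
  rw [sub_app, mul_app, mul_app] at this
  rw [this, q.contr_ι, Ψ.map_fn, L.res_id]

end IsTranspose

theorem IsCartan.contr_contr_ι {𝓕 : LieAlgebroid F} {δ : DegOneOp E} (h : IsCartan p 𝓕 δ)
    (D : E.Sec U) (ξ η : F.Sec U) :
    (p.contr η).app U le_rfl ((p.contr ξ).app U le_rfl (δ.d (ι D))) = fn (dForm p 𝓕 D ξ η) := by
  have := congr_app (h.lie U ξ η) (ι D)
  rw [sub_app, mul_app, mul_app, lieOp_app ξ le_rfl (ι D), map_add, p.contr_ι, p.contr_ι, p.contr_ι,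
    h.lieOp_fn, h.anchor, F.res_id, F.res_id, F.res_id, sub_eq_iff_eq_add] at this
  rw [dForm_apply, fn_sub, fn_sub, this]
  abel

namespace IsTranspose

variable {𝓕 : LieAlgebroid F} {𝓛 : LieAlgebroid L} {δ : DegOneOp E} {d : DegOneOp M}

/-- The transpose of a morphism of Lie algebroids is compatible with the differentials. -/
theorem map_d [CharZero K] (hp : p.IsPerfect) (h : IsTranspose p q Ψ φ) (h𝓕 : IsCartan p 𝓕 δ)
    (h𝓛 : IsCartan q 𝓛 d)
    (hanchor : ∀ (U : Opens X) (ξ : F.Sec U) (f : 𝒪.Sec U), 𝓛.anchor (φ U ξ) f = 𝓕.anchor ξ f)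
    (hlie : ∀ (U : Opens X) (ξ η : F.Sec U), φ U (𝓕.lie ξ η) = 𝓛.lie (φ U ξ) (φ U η))
    (a : Wedge M U) : Ψ.map (d.d a) = δ.d (Ψ.map a) := by
  -- Both composites are odd derivations along `Ψ`. On functions one contraction compares them
  -- through the anchors, on sections two contractions compare them through `dForm`.
  refine congr_app (((h𝓛.isDer.toWOp U).hom_comp Ψ).ext ((h𝓕.isDer.toWOp U).comp_hom Ψ)
    (fun V hV f => ?_) fun V hV ω => ?_) a
  · simp only [comp_app, GradedAlgHom.toWOp_app, DegOneOp.toWOp_app, Ψ.map_fn]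
    refine hp.ext_contr (k := 0) (Ψ.degree _ (d.degree _ (hasDegree_fn f)))
      (δ.degree _ (hasDegree_fn f)) fun W hW ξ => ?_
    rw [Ψ.map_res, h.contr_map, d.d_res, δ.d_res, res_fn, res_fn, h𝓛.anchor, h𝓕.anchor, hanchor,
      Ψ.map_fn]
  · simp only [comp_app, GradedAlgHom.toWOp_app, DegOneOp.toWOp_app]
    refine sub_eq_zero.1 (hp.eq_zero_of_contr_contr (k := 0)
      ((Ψ.degree _ (d.degree _ (hasDegree_ι ω))).sub
        (δ.degree _ (Ψ.degree _ (hasDegree_ι ω)))) fun W hW ξ η => ?_)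
    obtain ⟨D, hD⟩ := Ψ.exists_map_ι (M.res hW ω)
    have hpair : ∀ ζ : F.Sec W, p.pair D ζ = q.pair (M.res hW ω) (φ W ζ) := fun ζ => by
      refine fn_injective (E := E) ?_
      rw [← h.contr_ι, hD, p.contr_ι, F.res_id]
    rw [map_sub, map_sub, map_sub, Ψ.map_res, h.contr_map, h.contr_map, d.d_res, δ.d_res, Ψ.map_res,
      res_ι, hD, h𝓛.contr_contr_ι, h𝓕.contr_contr_ι, Ψ.map_fn, dForm_apply, dForm_apply, hpair,
      hpair, hpair, hanchor, hanchor, hlie, sub_self]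

end IsTranspose

end Transpose

end

section

open Wedge WOp

/-! ## From Gerstenhaber algebras to bialgebroids -/

section

variable {E : ModSheaf.{u, v, w'} 𝒪} {L : ModSheaf.{u, v, w} 𝒪} {U V : Opens X}

/-- A Gerstenhaber bracket is the Schouten bracket of a Lie algebroid. -/
theorem exists_isSchouten [CharZero K] (β : GerstenhaberBracket E) : ∃ 𝓕 : LieAlgebroid E, IsSchouten 𝓕 β := by
  have hlie : ∀ {U : Opens X} (D D' : E.Sec U), ∃ D'' : E.Sec U, β.br (ι D) (ι D') = ι D'' :=
    fun D D' => (β.degree _ _ (hasDegree_ι D) (hasDegree_ι D') rfl).exists_ι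
  have hanc : ∀ {U : Opens X} (D : E.Sec U) (f : 𝒪.Sec U), ∃ g : 𝒪.Sec U,
      β.br (ι D) (fn f) = fn g :=
    fun D f => (β.degree _ _ (hasDegree_ι D) (hasDegree_fn f) rfl).exists_fn
  choose lie hlie using @hlie
  choose anc hanc using @hanc
  have ad_fn_mul : ∀ {U : Opens X} (D : E.Sec U) (f : 𝒪.Sec U) (b : Wedge E U),
      β.br (ι D) (fn f * b) = fn (anc D f) * b + fn f * β.br (ι D) b := fun {U} D f b => by
    have := (β.ad_isDer (hasDegree_ι D)).fn_mul le_rfl f b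
    simp only [GerstenhaberBracket.ad_app, res_rfl, hanc] at this
    exact this
  have swap : ∀ {U : Opens X} (D D' : E.Sec U), β.br (ι D) (ι D') = -β.br (ι D') (ι D) := by
    intro U D D'
    rw [β.antisymm _ _ (hasDegree_ι D) (hasDegree_ι D')]
    simp
  have jac : ∀ {U : Opens X} (D D' : E.Sec U) (a : Wedge E U), β.br (ι D) (β.br (ι D') a) =
      β.br (β.br (ι D) (ι D')) a + β.br (ι D') (β.br (ι D) a) := by
    intro U D D' a
    rw [β.jacobi _ _ _ (hasDegree_ι D) (hasDegree_ι D')]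
    simp
  -- Linearity of the anchor is the Leibniz rule for `[f, g D]`, in which `[f, g] = 0`.
  have anc_smul : ∀ {U : Opens X} (g : 𝒪.Sec U) (D : E.Sec U) (f : 𝒪.Sec U),
      anc (g • D) f = g * anc D f := by
    intro U g D f
    refine fn_injective (E := E) (neg_injective ?_)
    have h1 := (β.ad_isDer (hasDegree_fn f)).fn_mul le_rfl g (ι D)
    simp only [GerstenhaberBracket.ad_app, res_rfl, β.br_fn_fn, zero_mul, zero_add,
      β.br_fn_ι, hanc, mul_neg] at h1
    rw [fn_mul, ← h1, ← ι_smul, β.br_fn_ι, hanc]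
  let anchor {U : Opens X} : E.Sec U →ₗ[𝒪.Sec U] Derivation K (𝒪.Sec U) (𝒪.Sec U) :=
    { toFun := fun D => Derivation.mk'
        { toFun := anc D
          map_add' := fun f g => fn_injective (E := E) <| by
            rw [fn_add, ← hanc, ← hanc, ← hanc, fn_add, β.br_add]
          map_smul' := fun c f => fn_injective (E := E) <| by
            rw [RingHom.id_apply, Algebra.smul_def, Algebra.smul_def, fn_mul, ← hanc, ← hanc, fn_mul,
              β.br_smul] }
        (fun f g => fn_injective (E := E) <| by
          change fn (anc D (f * g)) = fn (f * anc D g + g * anc D f)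
          rw [fn_add, fn_mul, fn_mul, ← hanc D (f * g), fn_mul, ad_fn_mul, hanc, add_comm,
            ← fn_mul g, mul_comm g, fn_mul])
      map_add' := fun D D' => Derivation.ext fun f => fn_injective (E := E) <| by
        change fn (anc (D + D') f) = fn (anc D f + anc D' f)
        rw [fn_add, ← hanc, ← hanc, ← hanc, ι_add, β.add_br]
      map_smul' := fun g D => Derivation.ext fun f => anc_smul g D f }
  have hA : ∀ {U : Opens X} (D : E.Sec U) (f : 𝒪.Sec U), anchor D f = anc D f := fun _ _ => rfl
  refine ⟨{ lie := lie, anchor := anchor, lie_res := ?_, anchor_res := ?_, add_lie := ?_,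
            lie_add := ?_, smul_lie := ?_, lie_smul := ?_, lie_self := ?_, jacobi := ?_,
            anchor_lie := ?_, leibniz := ?_ }, fun U D D' => hlie D D', fun U D f => hanc D f⟩
  · intro U V h D D'
    refine ι_injective ?_
    rw [← hlie, ← res_ι, ← hlie, β.br_res, res_ι, res_ι]
  · intro U V h D f
    refine fn_injective (E := E) ?_
    rw [hA, hA, ← hanc, ← res_fn, ← hanc, β.br_res, res_ι, res_fn]
  · intro U D₁ D₂ D'
    refine ι_injective ?_
    rw [ι_add, ← hlie, ← hlie, ← hlie, ι_add, β.add_br]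
  · intro U D D₁ D₂
    refine ι_injective ?_
    rw [ι_add, ← hlie, ← hlie, ← hlie, ι_add, β.br_add]
  · intro U c D D'
    refine ι_injective ?_
    rw [ι_smul, ← hlie, ← hlie, ι_smul, β.smul_br]
  · intro U c D D'
    refine ι_injective ?_
    rw [ι_smul, ← hlie, ← hlie, ι_smul, β.br_smul]
  · intro U D
    -- Graded antisymmetry in degree one only gives `2[D, D] = 0`.
    refine ι_injective (eq_zero_of_nsmul two_ne_zero ?_ |>.trans ι_zero.symm)
    rw [two_nsmul, ← hlie, ← eq_neg_iff_add_eq_zero]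
    exact swap D D
  · intro U D₁ D₂ D₃
    refine ι_injective ?_
    rw [ι_add, ← hlie, ← hlie, ← hlie, ← hlie, jac, hlie, hlie, hlie, hlie]
  · intro U D D'
    refine Derivation.ext fun f => fn_injective (E := E) ?_
    rw [Derivation.commutator_apply, hA, hA, hA, hA, hA, fn_sub, ← hanc, ← hlie, ← hanc, ← hanc D',
      ← hanc, ← hanc, jac]
    abel
  · intro U D D' f
    refine ι_injective ?_
    rw [ι_add, ι_smul, ι_smul, ← hlie, ι_smul, ad_fn_mul, hlie, add_comm]; rfl

theorem StrongDiffGerstenhaber.diff_isDer {𝓛 : LieAlgebroid L} (S : StrongDiffGerstenhaber 𝓛 E) :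
    S.diff.IsDer := IsDer.of_gen
  (fun V hV f a => by
    have := S.diff_mul V 0 (fn f) a (hasDegree_fn f)
    rwa [Nat.cast_zero, Int.negOnePow_zero, one_smul] at this)
  (fun V hV D a => by
    have := S.diff_mul V 1 (ι D) a (hasDegree_ι D)
    rwa [Nat.cast_one, Int.negOnePow_one] at this)

end

/-! ### Homomorphisms of exterior algebras and their transposes -/

section

variable {E : ModSheaf.{u, v, w} 𝒪} {F : ModSheaf.{u, v, w'} 𝒪} {p : Pairing E F}
variable {M : ModSheaf.{u, v, w''} 𝒪} {L : ModSheaf.{u, v, w₃} 𝒪} {q : Pairing M L}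
variable {U V : Opens X}

/-- For fixed `ξ`, pairing the degree-one part of `Ψ` with `ξ` is a linear form on `M`, represented
by a section of `L` since `q` is perfect. In `exists_isTranspose'` the roles are exchanged and
perfectness of `p` is used. -/
theorem exists_isTranspose (hq : q.IsPerfect) (Ψ : GradedAlgHom M E) :
    ∃ φ : ∀ U : Opens X, F.Sec U →ₗ[𝒪.Sec U] L.Sec U,
      IsTranspose p q Ψ (fun U => φ U) := by
  obtain ⟨ψ, hψ, hψ'⟩ := Ψ.exists_linear
  have : ∀ (U : Opens X) (ξ : F.Sec U), ∃ ℓ : L.Sec U, ∀ (V : Opens X) (hV : V ≤ U) (ω : M.Sec V),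
      q.pair ω (L.res hV ℓ) = p.pair (ψ V ω) (F.res hV ξ) := fun U ξ => hq.flip.exists_left (U := U)
    { app := fun V hV =>
      { toFun := fun ω => p.pair (ψ V ω) (F.res hV ξ)
        map_add' := fun ω ω' => by rw [map_add, map_add, LinearMap.add_apply]
        map_smul' := fun f ω => by rw [map_smul, map_smul, LinearMap.smul_apply]; rfl }
      natural := fun V W hV hW ω => by
        change 𝒪.res hW (p.pair (ψ V ω) (F.res hV ξ)) = p.pair (ψ W (M.res hW ω)) (F.res _ ξ)
        rw [← hψ', ← p.pair_res, F.res_res] }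
  choose φ hφ using this
  refine ⟨fun U => ⟨⟨φ U, fun ξ η => hq.ext_right fun V hV ω => ?_⟩, fun f ξ =>
    hq.ext_right fun V hV ω => ?_⟩, fun U V h ξ => hq.ext_right fun W hW ω => ?_, fun U ξ ω => ?_⟩
  · simp only [map_add, hφ]
  · change q.pair ω (L.res hV (φ U (f • ξ))) = q.pair ω (L.res hV (f • φ U ξ))
    rw [map_smulₛₗ, map_smul, hφ, hφ, map_smulₛₗ, map_smul]
  · change q.pair ω (L.res hW (L.res h (φ U ξ))) = q.pair ω (L.res hW (φ V (F.res h ξ)))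
    rw [L.res_res, hφ, hφ, F.res_res]
  · have := hφ U ξ U le_rfl ω
    rw [L.res_id, F.res_id] at this
    rw [hψ, p.contr_ι, F.res_id, ← this]
    rfl

theorem IsTranspose.unique (hq : q.IsPerfect) {Ψ : GradedAlgHom M E}
    {φ φ' : ∀ U : Opens X, F.Sec U → L.Sec U} (h : IsTranspose p q Ψ φ)
    (h' : IsTranspose p q Ψ φ') : φ = φ' :=
  funext fun U => funext fun ξ => hq.ext_right fun V hV ω => fn_injective (E := E) <| by
    rw [h.res, h'.res, ← h.contr_ι, ← h'.contr_ι]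

theorem exists_isTranspose' (hp : p.IsPerfect) (φ : ∀ U : Opens X, F.Sec U →ₗ[𝒪.Sec U] L.Sec U)
    (hφ : ∀ (U V : Opens X) (h : V ≤ U) (ξ : F.Sec U), L.res h (φ U ξ) = φ V (F.res h ξ)) :
    ∃ Ψ : GradedAlgHom M E, IsTranspose p q Ψ (fun U => φ U) := by
  have : ∀ (U : Opens X) (ω : M.Sec U), ∃ D : E.Sec U, ∀ (V : Opens X) (hV : V ≤ U) (ξ : F.Sec V),
      p.pair (E.res hV D) ξ = q.pair (M.res hV ω) (φ V ξ) := fun U ω => hp.exists_left (U := U)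
    { app := fun V hV => q.pair (M.res hV ω) ∘ₗ φ V
      natural := fun V W hV hW ξ => by
        change 𝒪.res hW (q.pair (M.res hV ω) (φ V ξ)) = q.pair (M.res _ ω) (φ W (F.res hW ξ))
        rw [← hφ, ← q.pair_res, M.res_res] }
  choose ψ hψ using this
  refine ⟨extHom (fun {U} => ⟨⟨ψ U, fun ω ω' => hp.ext_left fun V hV ξ => ?_⟩, fun f ω =>
    hp.ext_left fun V hV ξ => ?_⟩) fun {U V} h ω => hp.ext_left fun W hW ξ => ?_, hφ, fun U ξ ω => ?_⟩
  · simp only [map_add, LinearMap.add_apply, hψ]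
  · change p.pair (E.res hV (ψ U (f • ω))) ξ = p.pair (E.res hV (f • ψ U ω)) ξ
    rw [map_smulₛₗ, map_smul, LinearMap.smul_apply, hψ, hψ, map_smulₛₗ, map_smul,
      LinearMap.smul_apply]
  · change p.pair (E.res hW (E.res h (ψ U ω))) ξ = p.pair (E.res hW (ψ V (M.res h ω))) ξ
    rw [E.res_res, hψ, hψ, M.res_res]
  · have := hψ U ω U le_rfl ξ
    rw [E.res_id, M.res_id] at this
    rw [extHom_ι, p.contr_ι, F.res_id, ← this]
    rfl

theorem IsTranspose.unique' (hp : p.IsPerfect) {Ψ Ψ' : GradedAlgHom M E}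
    {φ : ∀ U : Opens X, F.Sec U → L.Sec U} (h : IsTranspose p q Ψ φ)
    (h' : IsTranspose p q Ψ' φ) : Ψ = Ψ' := by
  refine GradedAlgHom.ext_ι fun U ω => ?_
  obtain ⟨D, hD⟩ := Ψ.exists_map_ι ω
  obtain ⟨D', hD'⟩ := Ψ'.exists_map_ι ω
  rw [hD, hD']
  refine congrArg ι (hp.ext_left fun V hV ξ => fn_injective (E := E) ?_)
  have h1 := h.contr_ι V ξ (M.res hV ω)
  have h2 := h'.contr_ι V ξ (M.res hV ω)
  rw [← res_ι, ← Ψ.map_res, hD, res_ι, p.contr_ι, F.res_id] at h1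
  rw [← res_ι, ← Ψ'.map_res, hD', res_ι, p.contr_ι, F.res_id] at h2
  rw [h1, h2]

end

end

section

open Wedge WOp

/-! ## From Gerstenhaber algebras to Lie bialgebroids -/

section

variable {E : ModSheaf.{u, v, w'} 𝒪} {L : ModSheaf.{u, v, w} 𝒪} {U V : Opens X}
variable {𝓛 : LieAlgebroid L}

theorem LieAlgebroidHom.congr_map {F : ModSheaf.{u, v, w''} 𝒪} {𝓕 : LieAlgebroid F}
    {φ φ' : LieAlgebroidHom 𝓕 𝓛} (h : ∀ (U : Opens X) (D : F.Sec U), φ.map D = φ'.map D) :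
    φ = φ' :=
  LieAlgebroidHom.ext (funext fun U => LinearMap.ext (h U))

theorem IsSchouten.unique_lieAlgebroid {𝓕 𝓕' : LieAlgebroid E} {β : GerstenhaberBracket E}
    (h : IsSchouten 𝓕 β) (h' : IsSchouten 𝓕' β) : 𝓕 = 𝓕' := by
  refine LieAlgebroid.ext ?_ ?_
  · funext U D D'
    exact ι_injective ((h.1 U D D').symm.trans (h'.1 U D D'))
  · funext U
    refine LinearMap.ext fun D => Derivation.ext fun f => ?_
    exact fn_injective (E := E) ((h.2 U D f).symm.trans (h'.2 U D f))

theorem Corresponds.isTranspose {B : LieBialgebroid 𝓛 E} {S : StrongDiffGerstenhaber 𝓛 E}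
    (h : Corresponds B S) :
    IsTranspose (evalPairing E).flip (evalPairing L) S.fromΩ (fun _ => B.φ'.map) where
  res U V h ξ := B.φ'.map_res h ξ
  contr_ι U ξ ω := by
    obtain ⟨D, hD, hD'⟩ := h.fromΩ U ω
    rw [hD, Pairing.contr_ι, E.dual.res_id]
    have := hD' U le_rfl ξ
    rw [E.res_id, L.dual.res_id] at this
    exact congrArg fn this

theorem IsTranspose.corresponds_fromΩ {Ψ : GradedAlgHom L.dual E}
    {φ : ∀ U : Opens X, E.dual.Sec U → L.Sec U}
    (h : IsTranspose (evalPairing E).flip (evalPairing L) Ψ φ) (U : Opens X) (ω : L.dual.Sec U) :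
    ∃ D : E.Sec U, Ψ.map (ι ω) = ι D ∧ ∀ (V : Opens X) (h : V ≤ U) (ξ : E.dual.Sec V),
      (evalPairing E).pair ξ (E.res h D) = (evalPairing L).pair (L.dual.res h ω) (φ V ξ) := by
  obtain ⟨D, hD⟩ := Ψ.exists_map_ι ω
  refine ⟨D, hD, fun V hV ξ => fn_injective (E := E) ?_⟩
  have := h.contr_ι V ξ (L.dual.res hV ω)
  rw [← res_ι, ← Ψ.map_res, hD, res_ι, Pairing.contr_ι, E.dual.res_id] at this
  exact this

/-- Each component is recovered from `S`: the structure on `E` from the bracket, that on `E*` from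
the Cartan formulas for `diff`, `φ` from degree one, and `φ'` as a transpose. -/
theorem Corresponds.unique_bialgebroid [CharZero K] (hE : E.IsLocallyFree) (hL : L.IsLocallyFree)
    {B B' : LieBialgebroid 𝓛 E} {S : StrongDiffGerstenhaber 𝓛 E}
    (h : Corresponds B S) (h' : Corresponds B' S) : B = B' := by
  have hstr : B.str = B'.str := h.bracket.unique_lieAlgebroid h'.bracket
  have hdual : B.dualStr = B'.dualStr := (h.diff.isCartan hE.isPerfect.flip).unique hE.isPerfect.flip
    (h'.diff.isCartan hE.isPerfect.flip)
  have hφ : ∀ (U : Opens X) (D : E.Sec U), B.φ.map D = B'.φ.map D := fun U D =>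
    ι_injective ((h.toG U D).symm.trans (h'.toG U D))
  have hφ' := h.isTranspose.unique hL.isPerfect h'.isTranspose
  replace hφ' : ∀ (U : Opens X) (ξ : E.dual.Sec U), B.φ'.map ξ = B'.φ'.map ξ := fun U ξ =>
    congrFun (congrFun hφ' U) ξ
  obtain ⟨str, dualStr, φ, φ', _⟩ := B
  obtain ⟨str', dualStr', ψ, ψ', _⟩ := B'
  obtain rfl : str = str' := hstr
  obtain rfl : dualStr = dualStr' := hdual
  obtain rfl : φ = ψ := LieAlgebroidHom.congr_map hφ
  obtain rfl : φ' = ψ' := LieAlgebroidHom.congr_map hφ'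
  rfl

theorem existsUnique_bialgebroid [CharZero K] (hE : E.IsLocallyFree) (hL : L.IsLocallyFree)
    (S : StrongDiffGerstenhaber 𝓛 E) : ∃! B : LieBialgebroid 𝓛 E, Corresponds B S := by
  have hp := hE.isPerfect.flip
  have hq := hL.isPerfect
  obtain ⟨str, hstr⟩ := exists_isSchouten S.bracket
  obtain ⟨dualStr, hdual⟩ := exists_isCartan_of_sq_eq_zero hp S.diff_isDer S.diff_diff
  obtain ⟨φ, hφ, hφ'⟩ := S.toG.exists_linear
  obtain ⟨φ', hφ''⟩ := exists_isTranspose (p := (evalPairing E).flip) hq S.fromΩ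
  have h𝓛 := (isCEDifferential_ceDifferential hq 𝓛).isCartan hq
  have hsch := isSchouten_schouten 𝓛
  have hbr : schouten str = S.bracket := (isSchouten_schouten str).unique hstr
  have hce : ceDifferential (evalPairing E).flip dualStr = S.diff :=
    (isCEDifferential_ceDifferential hp dualStr).unique hp hdual.isCEDifferential
  let Φ : LieAlgebroidHom str 𝓛 :=
    { map := fun {U} => φ U
      map_res := fun h D => hφ' _ _ h D
      map_lie := fun D D' => ι_injective <| by
        rw [← hφ, ← hstr.1, S.toG_bracket, hφ, hφ, hsch.1]
      anchor_map := fun D => Derivation.ext fun f => fn_injective (E := L) <| by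
        rw [← hsch.2, ← hφ, ← S.toG.map_fn, ← S.toG_bracket, hstr.2, S.toG.map_fn] }
  let Φ' : LieAlgebroidHom dualStr 𝓛 :=
    { map := fun {U} => φ' U
      map_res := fun h D => hφ''.res _ _ h D
      map_lie := fun ξ η => hφ''.lie_map hq hdual h𝓛 S.fromΩ_diff ξ η
      anchor_map := fun ξ => Derivation.ext fun f =>
        hφ''.anchor_map hdual h𝓛 S.fromΩ_diff ξ f }
  let B : LieBialgebroid 𝓛 E :=
    { str := str
      dualStr := dualStr
      φ := Φ
      φ' := Φ'
      compat := fun U D₁ D₂ => by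
        -- In degree one the sign `(-1)^(i-1)` is `1`, so this is the bialgebroid condition.
        have := S.diff_bracket U 1 (ι D₁) (ι D₂) (hasDegree_ι D₁)
        rw [Nat.cast_one, sub_self, Int.negOnePow_zero, one_smul, hstr.1] at this
        rw [hbr, hce, this] }
  have hB : Corresponds B S := ⟨hstr, hdual.isCEDifferential, hφ, hφ''.corresponds_fromΩ⟩
  exact ⟨B, hB, fun B' hB' => hB'.unique_bialgebroid hE hL hB⟩

end

end

section

open Wedge WOp

/-! ## Derivations of Gerstenhaber brackets -/

section

variable {E : ModSheaf.{u, v, w} 𝒪} {U V : Opens X} (β : GerstenhaberBracket E) (δ : DegOneOp E)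

theorem GerstenhaberBracket.ad_hasParity {i : ℕ} {a : Wedge E U} (ha : a.HasDegree i) :
    (β.ad a).HasParity (-(-1) ^ i) := by
  refine (β.ad_isDer ha).hasParity (fun V hV f => ?_) fun V hV D => ?_
  · rcases i with _ | i
    · obtain ⟨g, rfl⟩ := ha.exists_fn
      simp
    · rw [β.ad_app, (β.degree _ _ (ha.res hV) (hasDegree_fn f) (add_zero _)).invol, pow_succ,
        mul_neg_one, neg_neg]
  · rw [β.ad_app, (β.degree _ _ (ha.res hV) (hasDegree_ι D) rfl).invol, neg_neg]

/-- The failure of `δ` to be a derivation of the bracket. -/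
def defect (e : ℤˣ) (a : Wedge E U) : WOp E E U :=
  δ.toWOp U * β.ad a - e • (β.ad a * δ.toWOp U) - β.ad (δ.d a)

variable {β δ}

theorem defect_app (e : ℤˣ) (a : Wedge E U) (hV : V ≤ U) (b : Wedge E V) :
    (defect β δ e a).app V hV b =
      δ.d (β.br (res hV a) b) - e • β.br (res hV a) (δ.d b) - β.br (δ.d (res hV a)) b := by
  rw [defect, sub_app, sub_app, mul_app, units_smul_app, mul_app, β.ad_app, β.ad_app, β.ad_app,
    δ.d_res]
  rfl

theorem defect_app_res (e : ℤˣ) (a : Wedge E U) (hV : V ≤ U) (b : Wedge E V) :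
    (defect β δ e a).app V hV b = (defect β δ e (res hV a)).app V le_rfl b := by
  rw [defect_app, defect_app, res_rfl]

/-- A graded commutator of derivations minus the derivation `[δ a, ·]`, which has the same parity.
-/
theorem defect_isDer (hδ : δ.IsDer) {i : ℕ} {a : Wedge E U} (ha : a.HasDegree i) :
    (defect β δ (-(-1) ^ i) a).IsDer ((-1) ^ i) := by
  have h := (hδ.toWOp U).commutator (β.ad_isDer ha) (hδ.hasParity U) (β.ad_hasParity ha)
  have h' := β.ad_isDer (δ.degree _ ha)
  rw [sgn_neg_one_left, neg_one_mul, neg_neg] at h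
  rw [pow_succ, mul_neg_one, neg_neg] at h'
  exact h.sub h'

theorem defect_antisymm {i j : ℕ} {a b : Wedge E U} (ha : a.HasDegree i) (hb : b.HasDegree j) :
    (defect β δ (-(-1) ^ i) a).app U le_rfl b =
      -(sgn (-(-1) ^ i) (-(-1) ^ j)) • (defect β δ (-(-1) ^ j) b).app U le_rfl a := by
  have h1 := β.antisymm _ _ ha hb
  have h2 := β.antisymm _ _ (δ.degree _ ha) hb
  have h3 := β.antisymm _ _ ha (δ.degree _ hb)
  rw [sgn_negOnePow, negOnePow_natCast_sub_one, negOnePow_natCast_sub_one] at h1 h2 h3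
  rw [pow_succ, mul_neg_one, neg_neg] at h2 h3
  have hu : ∀ (e : ℤˣ) (x : Wedge E U), δ.d (e • x) = e • δ.d x := fun e x =>
    map_units_smul ((δ.toWOp U).app U le_rfl) e x
  rw [defect_app, defect_app, res_rfl, res_rfl, h1, h2, h3, hu]
  have key : ∀ {A : Type (max u v w)} [AddCommGroup A] (x y : ℤˣ) (p q r : A),
      -sgn (-x) (-y) • p - (-x) • -sgn (-x) y • r - -sgn x (-y) • q =
        -sgn (-x) (-y) • (p - (-y) • q - r) := by
    intro A _ x y p q r
    rcases Int.units_eq_one_or x with rfl | rfl <;> rcases Int.units_eq_one_or y with rfl | rfl <;>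
    simp [Units.neg_smul] <;> abel
  exact key _ _ _ _ _

variable {F : ModSheaf.{u, v, w'} 𝒪} {p : Pairing E F}

/-- Contracting `A ∧ e_j` with `ε_j` gives `⟨A, ε_j⟩ e_j - A`. The sum over `j` is `(1 - n) A = 0`,
and `1 - n` is invertible in `K` for `n ≠ 1`. -/
theorem Pairing.IsDualOn.eq_zero_of_ι_mul [CharZero K] {n : ℕ} (hn : n ≠ 1) {e : Fin n → E.Sec U}
    {ε : Fin n → F.Sec U} (h : p.IsDualOn e ε) {A : E.Sec U}
    (hA : ∀ D : E.Sec U, ι A * ι D = 0) : A = 0 := by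
  have h1 : ∀ j, fn (p.pair A (ε j)) * ι (e j) - fn (p.pair (e j) (ε j)) * ι A = 0 := fun j => by
    have := congrArg ((p.contr (ε j)).app U le_rfl) (hA (e j))
    rwa [p.contr_ι_mul, p.contr_ι, map_zero, F.res_id, fn_comm] at this
  have h2 : ι A - n • ι A = 0 := by
    rw [← Finset.sum_eq_zero fun j (_ : j ∈ Finset.univ) => h1 j, Finset.sum_sub_distrib]
    congr 1
    · conv_lhs => rw [h.left U le_rfl A]
      simp only [ι_sum, ι_smul, F.res_id, E.res_id]
    · simp [h.pair_eq]
  refine ι_injective (Eq.trans ?_ ι_zero.symm)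
  rcases Nat.lt_or_gt_of_ne hn with h0 | h0
  · obtain rfl : n = 0 := by omega
    simpa using h2
  · obtain ⟨k, rfl⟩ := Nat.exists_eq_add_of_lt h0
    refine eq_zero_of_nsmul (n := k + 1) (Nat.succ_ne_zero k) ?_
    rw [show 1 + k + 1 = (k + 1) + 1 by ring, succ_nsmul, sub_add_cancel_right, neg_eq_zero] at h2
    exact h2

variable (p) in
/-- On a locally free sheaf which has rank one nowhere, a differential which is a derivation of the
bracket of sections of `E` is a derivation of the Gerstenhaber bracket. -/
theorem defect_eq_zero [CharZero K] (hp : p.IsPerfect) (hE : E.NowhereRankOne) (hδ : δ.IsDer)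
    (hcompat : ∀ (U : Opens X) (D D' : E.Sec U), δ.d (β.br (ι D) (ι D')) =
      β.br (δ.d (ι D)) (ι D') + β.br (ι D) (δ.d (ι D')))
    {i : ℕ} {a : Wedge E U} (ha : a.HasDegree i) : defect β δ (-(-1) ^ i) a = 0 := by
  have hDer : ∀ {U : Opens X} (D : E.Sec U), (defect β δ (-(-1) ^ 1) (ι D)).IsDer ((-1) ^ 1) :=
    fun D => defect_isDer hδ (hasDegree_ι D)
  have hfDer : ∀ {U : Opens X} (f : 𝒪.Sec U), (defect β δ (-(-1) ^ 0) (fn f)).IsDer ((-1) ^ 0) :=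
    fun f => defect_isDer hδ (hasDegree_fn f)
  have hDD : ∀ {U : Opens X} (D D' : E.Sec U),
      (defect β δ (-(-1) ^ 1) (ι D)).app U le_rfl (ι D') = 0 := by
    intro U D D'
    rw [defect_app, res_rfl, hcompat, pow_one, neg_neg, one_smul, sub_sub, add_comm, sub_self]
  have hDf : ∀ {U : Opens X} (D : E.Sec U) (f : 𝒪.Sec U),
      (defect β δ (-(-1) ^ 1) (ι D)).app U le_rfl (fn f) = 0 := by
    intro U D f
    refine Wedge.ext_local fun x hx => ?_
    obtain ⟨V, hV, n, e, ε, hxV, hd⟩ := hp.exists_le hx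
    refine ⟨V, hV, hxV, ?_⟩
    have hn : n ≠ 1 := fun h => by
      subst h
      exact hE V ⟨x, hxV⟩ hd.isFreeOn
    rw [map_zero, WOp.nat, defect_app_res, res_ι, res_fn]
    obtain ⟨A, hA⟩ : ∃ A : E.Sec V,
        (defect β δ (-(-1) ^ 1) (ι (E.res hV D))).app V le_rfl (fn (𝒪.res hV f)) = ι A := by
      refine HasDegree.exists_ι ?_
      rw [defect_app, res_rfl]
      exact ((δ.degree _ (β.degree _ _ (hasDegree_ι _) (hasDegree_fn _) rfl)).sub
        ((β.degree _ _ (hasDegree_ι _) (δ.degree _ (hasDegree_fn _)) rfl).units_smul _)).sub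
        (β.degree _ _ (δ.degree _ (hasDegree_ι _)) (hasDegree_fn _) rfl)
    rw [hA, hd.eq_zero_of_ι_mul hn (A := A), ι_zero]
    -- The defect of `D` is a derivation that vanishes on sections. Applied to the section `f D'` it
    -- gives `A ∧ D' = 0`.
    intro D'
    have := (hDer (E.res hV D)).fn_mul le_rfl (𝒪.res hV f) (ι D')
    rwa [hA, hDD, mul_zero, add_zero, ← ι_smul, hDD, eq_comm] at this
  have hD : ∀ {U : Opens X} (D : E.Sec U), defect β δ (-(-1) ^ 1) (ι D) = 0 := fun D =>
    (hDer D).ext (isDer_zero _)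
      (fun V hV f => by rw [defect_app_res, res_ι, hDf]; rfl)
      (fun V hV D' => by rw [defect_app_res, res_ι, hDD]; rfl)
  have hfD : ∀ {U : Opens X} (f : 𝒪.Sec U) (D : E.Sec U),
      (defect β δ (-(-1) ^ 0) (fn f)).app U le_rfl (ι D) = 0 := fun f D => by
    rw [defect_antisymm (hasDegree_fn f) (hasDegree_ι D), hD]
    simp
  have hff : ∀ {U : Opens X} (f g : 𝒪.Sec U),
      (defect β δ (-(-1) ^ 0) (fn f)).app U le_rfl (fn g) = 0 := by
    intro U f g
    refine Wedge.ext_local fun x hx => ?_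
    obtain ⟨V, hV, n, e, ε, hxV, hd⟩ := hp.exists_le hx
    refine ⟨V, hV, hxV, ?_⟩
    rw [map_zero, WOp.nat, defect_app_res, res_fn, res_fn]
    -- In rank zero everything of degree one vanishes, including `δ f` and `δ g`. In positive rank,
    -- the Leibniz rule on `g e₀` leaves `h e₀ = 0`, and contraction with the dual vector gives `h =
    -- 0`.
    rcases n with _ | n
    · have h0 : ∀ {b : Wedge E V}, b.HasDegree 1 → b = 0 := fun hb => by
        obtain ⟨D, rfl⟩ := hb.exists_ι
        rw [hd.left V le_rfl D]
        simp
      rw [defect_app, res_rfl, h0 (δ.degree _ (hasDegree_fn (𝒪.res hV f))),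
        h0 (δ.degree _ (hasDegree_fn (𝒪.res hV g))), β.br_fn_fn, δ.d_zero]
      simp
    · obtain ⟨h, hh⟩ : ∃ h : 𝒪.Sec V,
          (defect β δ (-(-1) ^ 0) (fn (𝒪.res hV f))).app V le_rfl (fn (𝒪.res hV g)) = fn h := by
        refine HasDegree.exists_fn ?_
        rw [defect_app, res_rfl, β.br_fn_fn, δ.d_zero]
        exact ((hasDegree_zero _).sub ((β.degree _ _ (hasDegree_fn _)
          (δ.degree _ (hasDegree_fn _)) rfl).units_smul _)).sub
          (β.degree _ _ (δ.degree _ (hasDegree_fn _)) (hasDegree_fn _) rfl)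
      have h1 := (hfDer (𝒪.res hV f)).fn_mul le_rfl (𝒪.res hV g) (ι (e 0))
      rw [hh, hfD, mul_zero, add_zero, ← ι_smul, hfD] at h1
      have h2 := congrArg ((p.contr (ε 0)).app V le_rfl) h1
      rw [map_zero, p.contr_fn_mul, p.contr_ι, F.res_id, hd.pair_eq, if_pos rfl, fn_one,
        mul_one] at h2
      rw [hh, ← h2]
  have hf : ∀ {U : Opens X} (f : 𝒪.Sec U), defect β δ (-(-1) ^ 0) (fn f) = 0 := fun f =>
    (hfDer f).ext (isDer_zero _)
      (fun V hV g => by rw [defect_app_res, res_fn, hff]; rfl)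
      (fun V hV D => by rw [defect_app_res, res_fn, hfD]; rfl)
  -- By antisymmetry the values on generators are, up to sign, the defects of generators at `a`,
  -- which have been shown to vanish.
  refine (defect_isDer hδ ha).ext (isDer_zero _) (fun V hV f => ?_) fun V hV D => ?_
  · rw [defect_app_res, defect_antisymm (ha.res hV) (hasDegree_fn f), hf]
    simp
  · rw [defect_app_res, defect_antisymm (ha.res hV) (hasDegree_ι D), hD]
    simp

end

/-! ## From Lie bialgebroids to Gerstenhaber algebras -/

section

variable {E : ModSheaf.{u, v, w'} 𝒪} {L : ModSheaf.{u, v, w} 𝒪} {U V : Opens X}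
variable {𝓛 : LieAlgebroid L}

theorem Corresponds.unique_gerstenhaber [CharZero K] (hE : E.IsLocallyFree)
    {B : LieBialgebroid 𝓛 E} {S S' : StrongDiffGerstenhaber 𝓛 E}
    (h : Corresponds B S) (h' : Corresponds B S') : S = S' :=
  StrongDiffGerstenhaber.ext (h.bracket.unique h'.bracket)
    (GradedAlgHom.ext_ι fun U D => (h.toG U D).trans (h'.toG U D).symm)
    (h.diff.unique hE.isPerfect.flip h'.diff)
    (h.isTranspose.unique' hE.isPerfect.flip h'.isTranspose)

/-- The rank condition serves only to pass from `B.compat` to the derivation property of the full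
bracket, through `defect_eq_zero`; the other axioms come from generators. -/
theorem existsUnique_gerstenhaber [CharZero K] (hE : E.IsLocallyFree) (hL : L.IsLocallyFree)
    (hrank : E.NowhereRankOne) (B : LieBialgebroid 𝓛 E) :
    ∃! S : StrongDiffGerstenhaber 𝓛 E, Corresponds B S := by
  have hp := hE.isPerfect.flip
  have hq := hL.isPerfect
  have h𝓛 := (isCEDifferential_ceDifferential hq 𝓛).isCartan hq
  have hce := isCEDifferential_ceDifferential hp B.dualStr
  have hdual := hce.isCartan hp
  have hsch := isSchouten_schouten 𝓛
  have hstr := isSchouten_schouten B.str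
  obtain ⟨Ψ, hΨ⟩ := exists_isTranspose' (M := L.dual) (q := evalPairing L) hp
    (fun _ => B.φ'.map) fun U V h ξ => B.φ'.map_res h ξ
  let Φ : GradedAlgHom E L := extHom B.φ.map B.φ.map_res
  have hΦ : ∀ (U : Opens X) (D : E.Sec U), Φ.map (ι D) = ι (B.φ.map D) := fun U D =>
    extHom_ι _ _ D
  let S : StrongDiffGerstenhaber 𝓛 E :=
    { bracket := schouten B.str
      toG := Φ
      toG_bracket := fun U a b => Φ.map_br
        (fun U D f => by
          rw [hstr.2, Φ.map_fn, hΦ, hsch.2, B.φ.anchor_map])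
        (fun U D D' => by
          rw [hstr.1, hΦ, hΦ, hΦ, hsch.1, B.φ.map_lie]) a b
      diff := ceDifferential (evalPairing E).flip B.dualStr
      diff_diff := fun U a => congr_app (hdual.sq_eq_zero hp) a
      diff_mul := fun U i a b ha => by
        have := hdual.isDer.toWOp U U le_rfl a b
        rw [tw_neg_one, ha.invol, smul_mul_assoc] at this
        exact this
      diff_bracket := fun U i a b ha => by
        have := congr_app (defect_eq_zero _ hp hrank hdual.isDer (fun U D D' => by
          rw [hstr.1, B.compat]) ha) b
        rw [defect_app, res_rfl, zero_app, sub_eq_zero, sub_eq_iff_eq_add] at this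
        rw [negOnePow_natCast_sub_one]
        exact this
      fromΩ := Ψ
      fromΩ_diff := fun U a => hΨ.map_d hp hdual h𝓛
        (fun U ξ f => by rw [B.φ'.anchor_map]) (fun U ξ η => B.φ'.map_lie ξ η) a }
  have hS : Corresponds B S := ⟨hstr, hce, hΦ, hΨ.corresponds_fromΩ⟩
  exact ⟨S, hS, fun S' hS' => hS'.unique_gerstenhaber hE hS⟩

end

/-! ## The trivial structure -/

section

variable {E : ModSheaf.{u, v, w'} 𝒪} {L : ModSheaf.{u, v, w} 𝒪} {U V : Opens X}

/-- The homomorphism induced by the zero map `E → L`: it fixes functions and kills positive degrees.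
-/
theorem exists_augmentation (E : ModSheaf.{u, v, w'} 𝒪) (L : ModSheaf.{u, v, w} 𝒪) :
    ∃ Φ : GradedAlgHom E L, ∀ (U : Opens X) (i : ℕ) (a : Wedge E U), a.HasDegree (i + 1) →
      Φ.map a = 0 := by
  refine ⟨extHom (fun {_} => 0) (by intros; simp), fun U i a ha => ?_⟩
  suffices h : ∀ j, a.HasDegree j → j ≠ 0 → (extHom (E := E) (G := L) (fun {_} => 0)
      (by intros; simp)).map a = 0 from h _ ha (Nat.succ_ne_zero i)
  intro j hj
  refine hom_induction (U := U) (p := fun V hV j a => j ≠ 0 →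
    (extHom (E := E) (G := L) (fun {_} => 0) (by intros; simp)).map a = 0) ?_ ?_ ?_ ?_ U le_rfl j a hj
  · intro V hV j a _ h hj
    refine Wedge.ext_local fun x hx => ?_
    obtain ⟨W, hW, hxW, e⟩ := h x hx
    exact ⟨W, hW, hxW, by rw [GradedAlgHom.map_res, e hj, map_zero]⟩
  · intro V hV f h
    exact absurd rfl h
  · intro V hV j a b _ _ ha hb hj
    rw [map_add, ha hj, hb hj, add_zero]
  · intro V hV j D a _ _ _
    rw [map_mul, extHom_ι, LinearMap.zero_apply, ι_zero, zero_mul]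

/-- With zero bracket and zero differential, the augmentation to `𝒢_𝓛` respects brackets because its
image consists of functions, whose Schouten bracket is zero. The augmentation from `Ω_𝓛` kills every
differential for degree reasons. -/
theorem nonempty_strongDiffGerstenhaber [CharZero K] (𝓛 : LieAlgebroid L)
    (E : ModSheaf.{u, v, w'} 𝒪) : Nonempty (StrongDiffGerstenhaber 𝓛 E) := by
  obtain ⟨Φ, hΦ⟩ := exists_augmentation E L
  obtain ⟨Ψ, hΨ⟩ := exists_augmentation L.dual E
  let β : GerstenhaberBracket E :=
    { br := fun _ _ => 0
      br_res := by intros; simp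
      add_br := by intros; simp
      br_add := by intros; simp
      smul_br := by intros; simp
      br_smul := by intros; simp
      degree := fun _ _ _ _ _ => hasDegree_zero _
      degree_zero := by intros; rfl
      antisymm := by intros; simp
      jacobi := by intros; simp
      leibniz := by intros; simp }
  let δ : DegOneOp E :=
    { d := fun _ => 0
      d_res := by intros; simp
      d_add := by intros; simp
      d_smul := by intros; simp
      degree := fun _ _ => hasDegree_zero _ }
  refine ⟨⟨β, Φ, fun U a b => ?_, δ, fun _ _ => rfl, fun U i a b _ => ?_, fun U i a b _ => ?_, Ψ,
    fun U a => ?_⟩⟩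
  · have hS : ∀ {U : Opens X} {i : ℕ} {a : Wedge E U}, a.HasDegree i →
        ((schouten 𝓛).ad (Φ.map a)).comp (Φ.toWOp U) = 0 := fun {U i a} ha =>
      ext_hom fun V hV j b hb => by
        simp only [comp_app, GradedAlgHom.toWOp_app, GerstenhaberBracket.ad_app, zero_app,
          Φ.map_res]
        rcases i with _ | i
        · rcases j with _ | j
          · exact (schouten 𝓛).degree_zero _ _ (Φ.degree _ (ha.res hV)) (Φ.degree _ hb)
          · rw [hΦ _ _ _ hb, GerstenhaberBracket.br_zero]
        · rw [hΦ _ _ _ (ha.res hV), GerstenhaberBracket.zero_br]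
    have := congr_app (S := ((schouten 𝓛).adRight (Φ.map b)).comp (Φ.toWOp U)) (T := 0)
      (ext_hom fun V hV i a ha => by
        have := congr_app (hS ha) (res hV b)
        simp only [comp_app, GradedAlgHom.toWOp_app, GerstenhaberBracket.ad_app,
          GerstenhaberBracket.adRight_app, zero_app, res_rfl, Φ.map_res] at this ⊢
        exact this) a
    exact (map_zero Φ.map).trans this.symm
  · change (0 : Wedge E U) = 0 * b + _ • (a * 0)
    simp
  · change (0 : Wedge E U) = 0 + _ • 0
    simp
  · refine congr_app (S := (Ψ.toWOp U).comp ((ceDifferential (evalPairing L) 𝓛).toWOp U))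
      (T := 0) (ext_hom fun V hV i a ha => ?_) a
    exact hΨ _ _ _ (DegOneOp.degree _ _ ha)

end

end

end LBialg

end

/-! ### The main theorem -/

theorem mainTheorem3 {K : Type u} {X : Type v} [Field K] [CharZero K]
    [TopologicalSpace K] [TopologicalSpace X] (𝒪 : LBialg.TopRingedSpace K X)
    (L : LBialg.ModSheaf.{u, v, w} 𝒪) (hL : L.IsLocallyFree) (𝓛 : LBialg.LieAlgebroid L)
    (L' : LBialg.ModSheaf.{u, v, w'} 𝒪) (hL' : L'.IsLocallyFree) :
    -- the Schouten brackets and the differentials occurring in the two structures are well defined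
    ((∃! β, LBialg.IsSchouten 𝓛 β) ∧
      (∃! δ, LBialg.IsCEDifferential (LBialg.evalPairing L) 𝓛 δ) ∧
      (∀ 𝓛' : LBialg.LieAlgebroid L', ∃! β, LBialg.IsSchouten 𝓛' β) ∧
      (∀ 𝓛'' : LBialg.LieAlgebroid L'.dual,
        ∃! δ, LBialg.IsCEDifferential (LBialg.evalPairing L').flip 𝓛'' δ)) ∧
    -- one structure exists if and only if the other one does
    (Nonempty (LBialg.LieBialgebroid 𝓛 L') ↔ Nonempty (LBialg.StrongDiffGerstenhaber 𝓛 L')) ∧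
    -- every strong differential Gerstenhaber algebra comes from a unique Lie bialgebroid
    (∀ S : LBialg.StrongDiffGerstenhaber 𝓛 L',
      ∃! B : LBialg.LieBialgebroid 𝓛 L', LBialg.Corresponds B S) ∧
    -- every Lie bialgebroid induces a unique strong differential Gerstenhaber algebra
    (L'.NowhereRankOne → ∀ B : LBialg.LieBialgebroid 𝓛 L',
      ∃! S : LBialg.StrongDiffGerstenhaber 𝓛 L', LBialg.Corresponds B S) := by
  refine ⟨⟨LBialg.existsUnique_isSchouten 𝓛, LBialg.existsUnique_isCEDifferential hL.isPerfect 𝓛,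
    fun 𝓛' => LBialg.existsUnique_isSchouten 𝓛',
    fun 𝓛'' => LBialg.existsUnique_isCEDifferential hL'.isPerfect.flip 𝓛''⟩,
    -- Only existence is claimed here, so the trivial structure is enough; it need not correspond to
    -- the given bialgebroid, and ranks equal to one are allowed.
    ⟨fun _ => LBialg.nonempty_strongDiffGerstenhaber 𝓛 L', fun ⟨S⟩ =>
      (LBialg.existsUnique_bialgebroid hL' hL S).exists.nonempty⟩,
    fun S => LBialg.existsUnique_bialgebroid hL' hL S,
    fun hrank B => LBialg.existsUnique_gerstenhaber hL' hL hrank B⟩
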